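/- **Setting.** There are $n\ge 1$ nodes and dimensions $p,d\ge 1$. The set $\mathcal Y\subset\mathbb R^d$ is closed and convex. Let $f_i(x,y)=\mathbb E_{\xi_i\sim\mathcal D_i}[F_i(x,y;\xi_i)]$ for $x\in\mathbb R^p$, $y\in\mathbb R^d$, let $f=\frac1n\sum_{i=1}^n f_i$, $y^*(x)=\arg\max_{y\in\mathcal Y}f(x,y)$ and $\Phi(x)=f(x,y^*(x))$. Assume the following, on $\mathbb R^p\times\mathcal Y$. 1. Each $f_i$ is $\mu$-strongly concave in $y$, $\mu>0$: $f_i(x,y)-f_i(x,y')\ge\langle\nabla_yf_i(x,y),y-y'\rangle+\frac\mu2\|y-y'\|^2$ for all $x\in\mathbb R^p$, $y,y'\in\mathcal Y$. 2. For $z\in\{x,y\}$ the maps $\nabla_zf_i$ and $\nabla^2_{zy}f_i$ exist and satisfy $\|\nabla_zf_i(x,y)-\nabla_zf_i(x',y')\|^2\le L^2(\|x-x'\|^2+\|y-y'\|^2)$, and the same inequality holds for $\nabla^2_{zy}f_i$ (operator norm); here $L>0$. Put $\kappa=L/\mu$. 3. The stochastic gradients satisfy $\mathbb E[\nabla_zF_i(x,y;\xi_i)]=\nabla_zf_i(x,y)$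 and $\|\nabla_zF_i(x,y;\xi_i)\|\le C$ almost surely, with $C>0$. 4. The weight matrix $W\in\mathbb R^{n\times n}$ is doubly stochastic (nonnegative entries, all row and column sums equal to $1$) and $\rho_W:=\|W-\mathbf 1\mathbf 1^T/n\|_2^2<1$. 5. $\Phi$ is bounded: $\Phi(x)-\Phi(x')\le\Delta$ for all $x,x'$. **Algorithm** (D-AdaST with coordinate-wise stepsizes). Let $\gamma_x,\gamma_y>0$ and $0<\beta<\alpha<1$. Start from deterministic $x_{i,0}\in\mathbb R^p$, $y_{i,0}\in\mathcal Y$ and $m^x_{i,0}\in\mathbb R^p$, $m^y_{i,0}\in\mathbb R^d$ with positive entries. At iteration $k=0,1,\dots$ node $i$ draws $\xi^x_{i,k},\xi^y_{i,k}\sim\mathcal D_i$ (all samples independent) and forms $g^z_{i,k}=\nabla_zF_i(x_{i,k},y_{i,k};\xi^z_{i,k})$ for $z\in\{x,y\}$. With $\odot$ and powers taken entrywise, $$m^z_{i,k+1}=\sum_jW_{ij}\big(m^z_{j,k}+g^z_{j,k}\odot g^z_{j,k}\big),$$ $$x_{i,k+1}=\sum_jW_{ij}\big(x_{j,k}-\gamma_x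 v_{j,k+1}^{-\alpha}\odot g^x_{j,k}\big),\qquad y_{i,k+1}=\mathcal P_{\mathcal Y}\Big(\sum_jW_{ij}\big(y_{j,k}+\gamma_y u_{j,k+1}^{-\beta}\odot g^y_{j,k}\big)\Big),$$ where $\mathcal P_{\mathcal Y}$ is the Euclidean projection, $u_{i,k}=m^y_{i,k}$, and $[v_{i,k}]_j=\max\{[m^x_{i,k}]_j,[m^y_{i,k}]_j\}$ for $j\le p$ (read as $[m^x_{i,k}]_j$ when $j>d$). Let $\bar x_k=\frac1n\sum_ix_{i,k}$. Let $V_k\in\mathbb R^{n\times p}$ and $U_k\in\mathbb R^{n\times d}$ have rows $v_{i,k}^T$ and $u_{i,k}^T$, let $\bar v_k,\bar u_k$ be the means of all their entries, and let $\mathbf J_q=\mathbf 1_q\mathbf 1_q^T/q$. Define in $[0,\infty]$, with entrywise powers and Frobenius norms, $$\zeta_V^2=\sup_{k\ge0}\frac{\|V_k^{-\alpha}-\bar v_k^{-\alpha}\mathbf 1\mathbf 1_p^T\|^2}{np(\bar v_k^{-\alpha})^2},\quad \hat\zeta_v^2=\sup_{k\ge0}\frac{\|V_k^{-\alpha}-(V_k\mathbf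 J_p)^{-\alpha}\|^2}{np(\bar v_k^{-\alpha})^2},$$ $$\zeta_U^2=\sup_{k\ge0}\frac{\|U_k^{-\beta}-\bar u_k^{-\beta}\mathbf 1\mathbf 1_d^T\|^2}{nd(\bar u_k^{-\beta})^2},\quad \hat\zeta_u^2=\sup_{k\ge0}\frac{\|U_k^{-\beta}-(U_k\mathbf J_d)^{-\beta}\|^2}{nd(\bar u_k^{-\beta})^2},$$ the suprema being also (essential) suprema over the randomness. **Theorem.** Then $\Phi$ is differentiable. If moreover $\zeta_V,\zeta_U<\infty$ and the total number of iterations $K\ge1$ satisfies $$K=\Omega\left(\max\left\{\left(\frac{\gamma_x^2\kappa^4}{\gamma_y^2}\right)^{\frac1{\alpha-\beta}},\ \left(\frac1{(1-\rho_W)^2}\right)^{\max\{\frac1\alpha,\frac1\beta\}}\right\}\right),$$ then $$\frac1K\sum_{k=0}^{K-1}\mathbb E\big[\|\nabla\Phi(\bar x_k)\|^2\big]=\tilde{\mathcal O}\left(\frac1{K^{1-\alpha}}+\frac1{(1-\rho_W)^\alpha K^\alpha}+\frac1{K^{1-\beta}}+\frac1{(1-\rho_W)K^\beta}\right)+\mathcal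 O\Big(n\big(p\hat\zeta_v^2+\kappa^2d\hat\zeta_u^2\big)C^2\Big).$$ The constant in the last $\mathcal O$ is absolute. The constant and the power of $1+\log K$ hidden in $\tilde{\mathcal O}$ depend only on $n,p,d,\alpha,\beta,\gamma_x,\gamma_y,\mu,L,C,\Delta$, on the constant in $\Omega$ (which may be any positive number), on a positive lower bound and an upper bound for the entries of the initial accumulators, on a bound for $\sum_i\|x_{i,0}-\bar x_0\|^2$, and on an upper bound for $\zeta_V^2,\zeta_U^2$; in particular not on $K$, $W$ or $\rho_W$. -/

import Mathlib

open MeasureTheory ProbabilityTheory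
open scoped ENNReal NNReal

noncomputable section

namespace DAdaST

/-- `ℝ^m` with its Euclidean norm. -/
abbrev Vec (m : ℕ) := EuclideanSpace ℝ (Fin m)

/-- The data of a distributed stochastic minimax problem with `n` nodes: the sample losses
`F i x y ξ`, the sample distribution `dist i` of each node, and the dual constraint set `Y`. -/
structure Problem (n p d : ℕ) (Ξ : Type*) [MeasurableSpace Ξ] where
  F : Fin n → Vec p → Vec d → Ξ → ℝ
  dist : Fin n → Measure Ξ
  Y : Set (Vec d)

namespace Problem

variable {n p d : ℕ} {Ξ : Type*} [MeasurableSpace Ξ] (P : Problem n p d Ξ)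

/-- Local objective `f_i(x, y) = E_{ξ ∼ D_i} F_i(x, y; ξ)`. -/
def fLoc (i : Fin n) (x : Vec p) (y : Vec d) : ℝ := ∫ ξ, P.F i x y ξ ∂(P.dist i)

/-- Global objective `f = (1/n) ∑ f_i`. -/
def f (x : Vec p) (y : Vec d) : ℝ := (1 / (n : ℝ)) * ∑ i, P.fLoc i x y

/-- `y*(x)`, a maximizer of `f(x, ·)` over `Y`. -/
def yStar (x : Vec p) : Vec d :=
  Classical.epsilon fun y => y ∈ P.Y ∧ ∀ y' ∈ P.Y, P.f x y' ≤ P.f x y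

/-- The primal function `Φ(x) = f(x, y*(x))`. -/
def Phi (x : Vec p) : ℝ := P.f x (P.yStar x)

/-- Partial gradients of the local objectives. -/
def gradX (i : Fin n) (x : Vec p) (y : Vec d) : Vec p := gradient (fun x' => P.fLoc i x' y) x

def gradY (i : Fin n) (x : Vec p) (y : Vec d) : Vec d := gradient (fun y' => P.fLoc i x y') y

/-- Partial stochastic gradients. -/
def sgradX (i : Fin n) (x : Vec p) (y : Vec d) (ξ : Ξ) : Vec p :=
  gradient (fun x' => P.F i x' y ξ) x

def sgradY (i : Fin n) (x : Vec p) (y : Vec d) (ξ : Ξ) : Vec d :=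
  gradient (fun y' => P.F i x y' ξ) y

/-- Second-order blocks `∇²_{xy} f_i` and `∇²_{yy} f_i`: the `y`-derivatives of the two partial
gradients. -/
def hessXY (i : Fin n) (x : Vec p) (y : Vec d) : Vec d →L[ℝ] Vec p :=
  fderiv ℝ (fun y' => P.gradX i x y') y

def hessYY (i : Fin n) (x : Vec p) (y : Vec d) : Vec d →L[ℝ] Vec d :=
  fderiv ℝ (fun y' => P.gradY i x y') y

/-- The standing setting: probability distributions, finite expectations, a closed convex
constraint set, and jointly measurable gradient oracles on `ℝ^p × Y`. -/
structure Setting : Prop where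
  prob : ∀ i, IsProbabilityMeasure (P.dist i)
  integrable : ∀ i x y, Integrable (P.F i x y) (P.dist i)
  closed : IsClosed P.Y
  convex : Convex ℝ P.Y
  measX : ∀ i, Measurable fun q : Vec p × P.Y × Ξ => P.sgradX i q.1 (q.2.1 : Vec d) q.2.2
  measY : ∀ i, Measurable fun q : Vec p × P.Y × Ξ => P.sgradY i q.1 (q.2.1 : Vec d) q.2.2

/-- `μ`-strong concavity of every `f_i` in `y` on `Y`. -/
def StronglyConcave (μ : ℝ) : Prop :=
  ∀ i x, ∀ y ∈ P.Y, ∀ y' ∈ P.Y,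
    inner ℝ (P.gradY i x y) (y - y') + μ / 2 * ‖y - y'‖ ^ 2 ≤ P.fLoc i x y - P.fLoc i x y'

/-- Joint `L`-smoothness of every `f_i` on `ℝ^p × Y`, with `L`-Lipschitz second-order blocks
`∇²_{xy} f_i` and `∇²_{yy} f_i` (operator norm). -/
structure Smooth (L : ℝ) : Prop where
  diffX : ∀ i x, ∀ y ∈ P.Y, DifferentiableAt ℝ (fun x' => P.fLoc i x' y) x
  diffY : ∀ i x, ∀ y ∈ P.Y, DifferentiableAt ℝ (fun y' => P.fLoc i x y') y
  lipX : ∀ i x x', ∀ y ∈ P.Y, ∀ y' ∈ P.Y,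
    ‖P.gradX i x y - P.gradX i x' y'‖ ^ 2 ≤ L ^ 2 * (‖x - x'‖ ^ 2 + ‖y - y'‖ ^ 2)
  lipY : ∀ i x x', ∀ y ∈ P.Y, ∀ y' ∈ P.Y,
    ‖P.gradY i x y - P.gradY i x' y'‖ ^ 2 ≤ L ^ 2 * (‖x - x'‖ ^ 2 + ‖y - y'‖ ^ 2)
  diffXY : ∀ i x, ∀ y ∈ P.Y, DifferentiableAt ℝ (fun y' => P.gradX i x y') y
  diffYY : ∀ i x, ∀ y ∈ P.Y, DifferentiableAt ℝ (fun y' => P.gradY i x y') y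
  lipXY : ∀ i x x', ∀ y ∈ P.Y, ∀ y' ∈ P.Y,
    ‖P.hessXY i x y - P.hessXY i x' y'‖ ^ 2 ≤ L ^ 2 * (‖x - x'‖ ^ 2 + ‖y - y'‖ ^ 2)
  lipYY : ∀ i x x', ∀ y ∈ P.Y, ∀ y' ∈ P.Y,
    ‖P.hessYY i x y - P.hessYY i x' y'‖ ^ 2 ≤ L ^ 2 * (‖x - x'‖ ^ 2 + ‖y - y'‖ ^ 2)

/-- Stochastic gradients exist, are unbiased, and are bounded by `C`, on `ℝ^p × Y`. -/
structure StochGrad (C : ℝ) : Prop where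
  diffX : ∀ i x, ∀ y ∈ P.Y, ∀ᵐ ξ ∂(P.dist i), DifferentiableAt ℝ (fun x' => P.F i x' y ξ) x
  diffY : ∀ i x, ∀ y ∈ P.Y, ∀ᵐ ξ ∂(P.dist i), DifferentiableAt ℝ (fun y' => P.F i x y' ξ) y
  unbiasedX : ∀ i x, ∀ y ∈ P.Y, ∫ ξ, P.sgradX i x y ξ ∂(P.dist i) = P.gradX i x y
  unbiasedY : ∀ i x, ∀ y ∈ P.Y, ∫ ξ, P.sgradY i x y ξ ∂(P.dist i) = P.gradY i x y
  boundX : ∀ i x, ∀ y ∈ P.Y, ∀ᵐ ξ ∂(P.dist i), ‖P.sgradX i x y ξ‖ ≤ C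
  boundY : ∀ i x, ∀ y ∈ P.Y, ∀ᵐ ξ ∂(P.dist i), ‖P.sgradY i x y ξ‖ ≤ C

end Problem

/-- `ρ_W = ‖W - J‖₂²`, with `J = 𝟏𝟏ᵀ/n` and the spectral norm. -/
def rho {n : ℕ} (W : Matrix (Fin n) (Fin n) ℝ) : ℝ :=
  ‖Matrix.toEuclideanCLM (n := Fin n) (𝕜 := ℝ)
    (W - Matrix.of fun _ _ => 1 / (n : ℝ))‖ ^ 2

/-- Multiplication by the weight matrix: `(W u)_i = ∑_j W_{ij} u_j`. -/
def mix {n : ℕ} {M : Type*} [AddCommMonoid M] [Module ℝ M]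
    (W : Matrix (Fin n) (Fin n) ℝ) (u : Fin n → M) (i : Fin n) : M :=
  ∑ j, W i j • u j

/-- Euclidean projection onto `Y`. -/
def proj {d : ℕ} (Y : Set (Vec d)) (v : Vec d) : Vec d :=
  Classical.epsilon fun w => w ∈ Y ∧ ∀ z ∈ Y, ‖v - w‖ ≤ ‖v - z‖

/-- The variables of all nodes: primal, dual, and the two coordinate-wise gradient accumulators. -/
structure State (n p d : ℕ) where
  x : Fin n → Vec p
  y : Fin n → Vec d
  mx : Fin n → Fin p → ℝ
  my : Fin n → Fin d → ℝ

/-- Entries of `V`: the maximum of the `j`-th entries of `m_i^x` and `m_i^y`. If `m_i^y` has no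
`j`-th entry (possible only if `d < p`), the maximum is over the single entry of `m_i^x`. -/
def precondV {n p d : ℕ} (mx : Fin n → Fin p → ℝ) (my : Fin n → Fin d → ℝ)
    (i : Fin n) (j : Fin p) : ℝ :=
  if h : (j : ℕ) < d then max (mx i j) (my i ⟨j, h⟩) else mx i j

/-- Network average of the primal variables. -/
def State.xbar {n p d : ℕ} (s : State n p d) : Vec p := (1 / (n : ℝ)) • ∑ i, s.x i

/-- `V` in a given state. -/
def State.V {n p d : ℕ} (s : State n p d) : Fin n → Fin p → ℝ := precondV s.mx s.my

/-- `U` in a given state: the entries of `m_i^y`. -/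
def State.U {n p d : ℕ} (s : State n p d) : Fin n → Fin d → ℝ := s.my

/-- Stepsizes and exponents. -/
structure Hyper where
  γx : ℝ
  γy : ℝ
  α : ℝ
  β : ℝ

/-- One iteration of D-AdaST with coordinate-wise stepsizes, given the stochastic gradients. -/
def step {n p d : ℕ} (Y : Set (Vec d)) (W : Matrix (Fin n) (Fin n) ℝ) (H : Hyper)
    (gx : Fin n → Vec p) (gy : Fin n → Vec d) (s : State n p d) : State n p d :=
  let mx' : Fin n → Fin p → ℝ := mix W fun i j => s.mx i j + gx i j * gx i j
  let my' : Fin n → Fin d → ℝ := mix W fun i j => s.my i j + gy i j * gy i j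
  { x := mix W fun i =>
      s.x i - H.γx • WithLp.toLp 2 fun j => precondV mx' my' i j ^ (-H.α) * gx i j
    y := fun i => proj Y (mix W (fun i =>
      s.y i + H.γy • WithLp.toLp 2 fun j => my' i j ^ (-H.β) * gy i j) i)
    mx := mx'
    my := my' }

/-- The two kinds of samples drawn by a node: for the primal and for the dual gradient. -/
inductive Block
  | primal
  | dual

/-- The random iterates: `ξ b i k` is the sample of kind `b` drawn by node `i` at iteration `k`. -/
def iter {n p d : ℕ} {Ω Ξ : Type*} [MeasurableSpace Ξ] (P : Problem n p d Ξ)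
    (W : Matrix (Fin n) (Fin n) ℝ) (H : Hyper) (s₀ : State n p d)
    (ξ : Block → Fin n → ℕ → Ω → Ξ) : ℕ → Ω → State n p d
  | 0, _ => s₀
  | k + 1, ω =>
    let s := iter P W H s₀ ξ k ω
    step P.Y W H
      (fun i => P.sgradX i (s.x i) (s.y i) (ξ Block.primal i k ω))
      (fun i => P.sgradY i (s.x i) (s.y i) (ξ Block.dual i k ω)) s

/-- All samples are mutually independent, and those of node `i` have law `D_i`. -/
structure IIDSamples {n p d : ℕ} {Ω Ξ : Type*} [MeasurableSpace Ω] [MeasurableSpace Ξ]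
    (P : Problem n p d Ξ) (Pr : Measure Ω) (ξ : Block → Fin n → ℕ → Ω → Ξ) : Prop where
  meas : ∀ b i k, Measurable (ξ b i k)
  law : ∀ b i k, Measure.map (ξ b i k) Pr = P.dist i
  indep : iIndepFun (fun t : Block × Fin n × ℕ => ξ t.1 t.2.1 t.2.2) Pr

/-- Mean of all entries of a matrix. -/
def avg {n q : ℕ} (M : Fin n → Fin q → ℝ) : ℝ := (1 / ((n : ℝ) * q)) * ∑ i, ∑ j, M i j

/-- Mean of the `i`-th row, i.e. the entries of the `i`-th row of `M J`. -/
def rowAvg {n q : ℕ} (M : Fin n → Fin q → ℝ) (i : Fin n) : ℝ := (1 / (q : ℝ)) * ∑ j, M i j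

/-- `‖M^{-a} - m̄^{-a} 𝟏𝟏ᵀ‖_F² / (n q (m̄^{-a})²)`, with entrywise powers. -/
def incons {n q : ℕ} (a : ℝ) (M : Fin n → Fin q → ℝ) : ℝ :=
  (∑ i, ∑ j, (M i j ^ (-a) - avg M ^ (-a)) ^ 2) / ((n : ℝ) * q * (avg M ^ (-a)) ^ 2)

/-- `‖M^{-a} - (M J)^{-a}‖_F² / (n q (m̄^{-a})²)`, with entrywise powers. -/
def inconsHat {n q : ℕ} (a : ℝ) (M : Fin n → Fin q → ℝ) : ℝ :=
  (∑ i, ∑ j, (M i j ^ (-a) - rowAvg M i ^ (-a)) ^ 2) / ((n : ℝ) * q * (avg M ^ (-a)) ^ 2)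

/-- The smallest deterministic bound in `[0, ∞]` that almost surely bounds a random sequence at
all times. -/
def supBound {Ω : Type*} [MeasurableSpace Ω] (Pr : Measure Ω) (r : ℕ → Ω → ℝ) : ℝ≥0∞ :=
  ⨆ k, essSup (fun ω => ENNReal.ofReal (r k ω)) Pr

end DAdaST

end

open DAdaST

/-! The stepsizes are random, local and coordinate-wise, so everything is measured against two
scalars: `v` (`State.vref`) for the primal and `u` (`avg U`) for the dual accumulators. Since `W`
preserves column means, both are nondecreasing and grow by at most `C ^ 2` per step, while the
gradients they collect satisfy `∑ v⁻¹ ‖g‖² = O(1 + log K)`; hence `∑ v ^ (-q) ‖g‖²` is of order `K ^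
(1 - q)` for `q < 1`, up to the logarithm (`Accumulates.accum`, `Accum.sum_rpow_le`). The one-step
inequalities are multiplied by an inverse stepsize `v ^ α` or `u ^ β`; a weighted difference then
sums to at most the range times the last weight (`sum_weight_mul_sub_le`), which produces `K ^ α`
and `K ^ β`. The stepsize of iteration `k` depends on the samples of iteration `k`. Replacing it by
the previous one costs a telescoping logarithm (`rpow_mul_sub_le_log`), and what remains of the
noise is linear with coefficients known from the past, so it has mean zero (`Model.integral_noiseX`,
`Model.integral_noiseY`).

`Φ` has gradient `∇ₓ f(x, y*(x))`, and `y*` is Lipschitz with constant `2κ`. The descent inequality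
(`Run.descent`) reduces the claim to the consensus errors and to the distance of the dual variables
from `y*(x̄)`. Following `y*(x̄ₖ)` directly with a merely Lipschitz `y*` would leave `∑ v ^ (-2(α -
β)) ‖g‖²` with stochastic gradients `g`, which is too large when `α - β` is small. The dual
variables are compared instead with `y*(aₖ)`, where `aₖ` (`lagRef`) relaxes towards `x̄ₖ` at the
speed of the dual stepsize. The target then moves by a multiple of the lag `r = x̄ - a`
(`Run.track`), and the lag obeys a contraction in which the noise enters linearly, leaving `v ^
(-2(α - β)) ‖G‖²` with the mean gradient `G` (`Run.lag`). As `β < α`, the factor is at most `ε + Kε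
v⁻¹`: the first part is absorbed by the `‖G‖²` gained in the descent, the second sums to a
logarithm. The comparison of `u` with `v` needed here comes from the maximum in the definition of
`V` (`Run.avg_U_le`).

Consensus errors contract with the spectral gap `e` (`consensus_step`), and the condition on `K`
turns `e⁻²` into a multiple of `K ^ β`. The mismatch of local stepsizes is split at the row means:
the spread within a row is what `ζ̂` measures and gives the steady term, the spread between rows is
a consensus error of the accumulators and is transient (`sum_norm_had_sub_sq_le_inconsHat`).
`exists_sum_bound` combines all this along a single trajectory; `Model.sum_integral_le` takes
expectations. -/

namespace DAdaST

/-! ### Real powers and sums -/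

/-- With `s = log b - log a ≥ 0` the left side is `1 - exp (-q s) ≤ q s ≤ s`. This prices the
exchange of the stepsize at `k + 1` for the one at `k`, and the price telescopes. -/
lemma rpow_mul_sub_le_log {a b q : ℝ} (ha : 0 < a) (hab : a ≤ b) (hq1 : q ≤ 1) :
    a ^ q * (a ^ (-q) - b ^ (-q)) ≤ Real.log b - Real.log a := by
  have hb : 0 < b := ha.trans_le hab
  have h1 : a ^ q * a ^ (-q) = 1 := by rw [← Real.rpow_add ha]; simp
  have h2 : 0 < a ^ q * b ^ (-q) := by positivity
  have h3 := Real.log_le_sub_one_of_pos h2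
  rw [Real.log_mul (by positivity) (by positivity), Real.log_rpow ha, Real.log_rpow hb] at h3
  have h4 : Real.log a ≤ Real.log b := Real.log_le_log ha hab
  nlinarith

/-- Summation by parts against a nondecreasing weight; `φ` may oscillate, only its range matters. -/
lemma sum_weight_mul_sub_le {w φ : ℕ → ℝ} {Δ : ℝ} (hw : Monotone w) (hw0 : ∀ k, 0 ≤ w k)
    (hφ : ∀ i j, φ i - φ j ≤ Δ) (K : ℕ) :
    ∑ k ∈ Finset.range K, w k * (φ k - φ (k + 1)) ≤ Δ * w K := by
  -- `j` is an index at which `φ` has been largest so far; keeping the running maximum on the right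
  -- closes the induction.
  have key : ∃ j, ∑ k ∈ Finset.range K, w k * (φ k - φ (k + 1)) ≤ w K * (φ j - φ K) := by
    induction K with
    | zero => exact ⟨0, by simp⟩
    | succ K ih =>
      obtain ⟨j, hj⟩ := ih
      have hm := hw (Nat.le_succ K)
      rw [Finset.sum_range_succ]
      rcases le_total (φ (K + 1)) (φ j) with h | h
      · exact ⟨j, by nlinarith [mul_le_mul_of_nonneg_right hm (sub_nonneg.2 h)]⟩
      · exact ⟨K + 1, by nlinarith [mul_nonneg (hw0 K) (sub_nonneg.2 h)]⟩
  obtain ⟨j, hj⟩ := key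
  nlinarith [mul_le_mul_of_nonneg_left (hφ j K) (hw0 K)]

/-- Each summand satisfies `a / S' ≤ 1 - S / S' ≤ log S' - log S`, with `S'` the next value of `S`.
-/
lemma sum_div_le_log {S a : ℕ → ℝ} (hS : ∀ k, 0 < S k) (h : ∀ k, S k + a k ≤ S (k + 1)) (K : ℕ) :
    ∑ k ∈ Finset.range K, a k / S (k + 1) ≤ Real.log (S K) - Real.log (S 0) := by
  rw [← Finset.sum_range_sub (fun k => Real.log (S k))]
  refine Finset.sum_le_sum fun k _ => ?_
  have h1 : 0 < S k / S (k + 1) := div_pos (hS k) (hS (k + 1))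
  have h2 := Real.log_le_sub_one_of_pos h1
  rw [Real.log_div (hS k).ne' (hS (k + 1)).ne'] at h2
  have h3 : a k / S (k + 1) ≤ 1 - S k / S (k + 1) := by
    rw [div_le_iff₀ (hS (k + 1)), sub_mul, div_mul_cancel₀ _ (hS (k + 1)).ne']
    linarith [h k]
  linarith

lemma rpow_le_rpow_add_rpow {c x D : ℝ} (hc : 0 < c) (hx : c ≤ x) (hD : x ≤ D) (t : ℝ) :
    x ^ t ≤ c ^ t + D ^ t := by
  have hx0 : 0 < x := hc.trans_le hx
  have hD0 : 0 < D := hx0.trans_le hD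
  rcases le_total 0 t with h | h
  · have := Real.rpow_le_rpow hx0.le hD h
    have : 0 < c ^ t := by positivity
    linarith
  · have := Real.rpow_le_rpow_of_nonpos hc hx h
    have : 0 < D ^ t := by positivity
    linarith

lemma abs_rpow_sub_rpow_le {a b q : ℝ} (ha : 0 ≤ a) (hb : 0 ≤ b) (hq0 : 0 ≤ q) (hq1 : q ≤ 1) :
    |a ^ q - b ^ q| ≤ |a - b| ^ q := by
  wlog hab : b ≤ a generalizing a b
  · rw [abs_sub_comm, abs_sub_comm a b]
    exact this hb ha (le_of_not_ge hab)
  have h1 := Real.rpow_add_le_add_rpow (sub_nonneg.2 hab) hb hq0 hq1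
  rw [sub_add_cancel] at h1
  rw [abs_of_nonneg (sub_nonneg.2 (Real.rpow_le_rpow hb hab hq0)), abs_of_nonneg (sub_nonneg.2 hab)]
  linarith

/-- Two bounds of the difference are multiplied: the crude one `m b ^ (-q)`, and `D ^ q m b ^ (-2
q)` from the Hölder continuity of `t ^ q`. Using the second only once leaves `D` with the exponent
`q`, hence later `(1 - ρ) ^ (-α)`. -/
lemma rpow_neg_sub_sq_le {a b q m D : ℝ} (ha : 0 < a) (hb : 0 < b) (hq0 : 0 ≤ q) (hq1 : q ≤ 1)
    (hm : 1 ≤ m) (hab : |a - b| ≤ D) (h : a ^ (-q) ≤ m * b ^ (-q)) :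
    (a ^ (-q) - b ^ (-q)) ^ 2 ≤ m ^ 2 * D ^ q * b ^ (-q) * (b ^ (-q)) ^ 2 := by
  have hA : 0 < a ^ (-q) := by positivity
  have hB : 0 < b ^ (-q) := by positivity
  have hD : 0 ≤ D := (abs_nonneg _).trans hab
  have hDq : 0 ≤ D ^ q := by positivity
  have h1 : |a ^ (-q) - b ^ (-q)| ≤ m * b ^ (-q) := by
    rw [abs_le]; constructor <;> nlinarith
  have h2 : a ^ (-q) - b ^ (-q) = (b ^ q - a ^ q) * (a ^ (-q) * b ^ (-q)) := by
    rw [Real.rpow_neg ha.le, Real.rpow_neg hb.le]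
    have : a ^ q ≠ 0 := by positivity
    have : b ^ q ≠ 0 := by positivity
    field_simp
  have h3 : |b ^ q - a ^ q| ≤ D ^ q := by
    rw [abs_sub_comm]
    exact (abs_rpow_sub_rpow_le ha.le hb.le hq0 hq1).trans
      (Real.rpow_le_rpow (abs_nonneg _) hab hq0)
  have h4 : |a ^ (-q) - b ^ (-q)| ≤ D ^ q * (m * b ^ (-q) * b ^ (-q)) := by
    rw [h2, abs_mul, abs_of_pos (mul_pos hA hB)]
    gcongr
  calc (a ^ (-q) - b ^ (-q)) ^ 2 = |a ^ (-q) - b ^ (-q)| * |a ^ (-q) - b ^ (-q)| := by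
        rw [← sq, sq_abs]
    _ ≤ (D ^ q * (m * b ^ (-q) * b ^ (-q))) * (m * b ^ (-q)) := by gcongr
    _ = _ := by ring

/-- Above the threshold `T = ε ^ (-1 / s)` the term `ε` suffices; below it `1 ≤ T / v`. With `s = 2
(α - β)` this separates the time scales: `ε` is absorbed and `v⁻¹` is summable up to a logarithm. -/
lemma exists_rpow_neg_le_add_inv {c s ε : ℝ} (hc : 0 < c) (hs : 0 < s) (hε : 0 < ε) :
    ∃ Kε, 0 ≤ Kε ∧ ∀ v, c ≤ v → v ^ (-s) ≤ ε + Kε * v⁻¹ := by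
  refine ⟨c ^ (-s) * ε ^ (-(1 / s)), by positivity, fun v hv => ?_⟩
  have hv0 : 0 < v := hc.trans_le hv
  set T := ε ^ (-(1 / s)) with hT
  have hT0 : 0 < T := by positivity
  rcases le_total T v with h | h
  · have h1 : v ^ (-s) ≤ T ^ (-s) := Real.rpow_le_rpow_of_nonpos hT0 h (by linarith)
    have h2 : T ^ (-s) = ε := by
      rw [hT, ← Real.rpow_mul hε.le]
      have : -(1 / s) * -s = 1 := by field_simp
      rw [this, Real.rpow_one]
    have : 0 ≤ c ^ (-s) * T * v⁻¹ := by positivity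
    linarith
  · have h1 : v ^ (-s) ≤ c ^ (-s) := Real.rpow_le_rpow_of_nonpos hc hv (by linarith)
    have h2 : 1 ≤ T * v⁻¹ := by rwa [← div_eq_mul_inv, one_le_div hv0]
    have h3 : 0 < c ^ (-s) := by positivity
    nlinarith [mul_le_mul_of_nonneg_left h2 h3.le]

/-! ### Averaging over the network -/

/-- Mean over the nodes. -/
noncomputable def nmean {n : ℕ} {M : Type*} [AddCommMonoid M] [Module ℝ M] (u : Fin n → M) : M :=
  (1 / (n : ℝ)) • ∑ i, u i

section network

variable {n : ℕ} {E : Type*} [NormedAddCommGroup E] [InnerProductSpace ℝ E]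

lemma smul_nmean {M : Type*} [AddCommGroup M] [Module ℝ M] (hn : 0 < n) (u : Fin n → M) :
    (n : ℝ) • nmean u = ∑ i, u i := by
  have : (n : ℝ) ≠ 0 := by positivity
  rw [nmean, smul_smul, mul_one_div_cancel this, one_smul]

lemma sum_sub_nmean {M : Type*} [AddCommGroup M] [Module ℝ M] (hn : 0 < n) (u : Fin n → M) :
    ∑ i, (u i - nmean u) = 0 := by
  rw [Finset.sum_sub_distrib, ← smul_nmean hn u]
  simp [Nat.cast_smul_eq_nsmul]

lemma nmean_const {M : Type*} [AddCommGroup M] [Module ℝ M] (hn : 0 < n) (q : M) :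
    nmean (fun _ : Fin n => q) = q := by
  have : (n : ℝ) ≠ 0 := by positivity
  rw [nmean]
  simp only [Finset.sum_const, Finset.card_univ, Fintype.card_fin]
  rw [← Nat.cast_smul_eq_nsmul ℝ, smul_smul, one_div_mul_cancel this, one_smul]

lemma nmean_add {M : Type*} [AddCommGroup M] [Module ℝ M] (u w : Fin n → M) :
    nmean (fun i => u i + w i) = nmean u + nmean w := by
  simp [nmean, Finset.sum_add_distrib]

lemma nmean_sub {M : Type*} [AddCommGroup M] [Module ℝ M] (u w : Fin n → M) :
    nmean (fun i => u i - w i) = nmean u - nmean w := by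
  simp [nmean, Finset.sum_sub_distrib, smul_sub]

lemma nmean_smul {M : Type*} [AddCommGroup M] [Module ℝ M] (c : ℝ) (u : Fin n → M) :
    nmean (fun i => c • u i) = c • nmean u := by
  simp only [nmean, ← Finset.smul_sum]
  rw [smul_comm]

lemma sum_norm_sub_sq (hn : 0 < n) (u : Fin n → E) (q : E) :
    ∑ i, ‖u i - q‖ ^ 2 = ∑ i, ‖u i - nmean u‖ ^ 2 + n * ‖nmean u - q‖ ^ 2 := by
  have h : ∀ i, ‖u i - q‖ ^ 2 = ‖u i - nmean u‖ ^ 2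
      + 2 * inner ℝ (u i - nmean u) (nmean u - q) + ‖nmean u - q‖ ^ 2 := fun i => by
    rw [← norm_add_sq_real]; congr 2; abel
  simp only [h, Finset.sum_add_distrib, ← Finset.mul_sum, ← sum_inner, sum_sub_nmean hn]
  simp

lemma sum_norm_sub_nmean_le (hn : 0 < n) (u : Fin n → E) (q : E) :
    ∑ i, ‖u i - nmean u‖ ^ 2 ≤ ∑ i, ‖u i - q‖ ^ 2 := by
  rw [sum_norm_sub_sq hn u q]
  have : 0 ≤ (n : ℝ) * ‖nmean u - q‖ ^ 2 := by positivity
  linarith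

lemma norm_nmean_sq_le (hn : 0 < n) (u : Fin n → E) :
    ‖nmean u‖ ^ 2 ≤ (1 / (n : ℝ)) * ∑ i, ‖u i‖ ^ 2 := by
  have h := sum_norm_sub_sq hn u 0
  simp only [sub_zero] at h
  have h0 : 0 ≤ ∑ i, ‖u i - nmean u‖ ^ 2 := by positivity
  have hn' : (0 : ℝ) < n := by positivity
  rw [one_div, inv_mul_eq_div, le_div_iff₀ hn']
  linarith

lemma norm_nmean_sq_le_sum (hn : 0 < n) (u : Fin n → E) :
    ‖nmean u‖ ^ 2 ≤ ∑ i, ‖u i‖ ^ 2 := by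
  refine (norm_nmean_sq_le hn u).trans ?_
  have h0 : 0 ≤ ∑ i, ‖u i‖ ^ 2 := by positivity
  have hn' : (1 : ℝ) ≤ n := by exact_mod_cast hn
  have : 1 / (n : ℝ) ≤ 1 := by rw [div_le_one (by linarith)]; exact hn'
  nlinarith

lemma norm_nmean_le (hn : 0 < n) {u : Fin n → E} {C : ℝ} (hu : ∀ i, ‖u i‖ ≤ C) : ‖nmean u‖ ≤ C := by
  have hn' : (0 : ℝ) < n := by positivity
  rw [nmean, norm_smul, Real.norm_of_nonneg (by positivity), one_div, inv_mul_le_iff₀ hn']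
  refine (norm_sum_le _ _).trans ((Finset.sum_le_sum fun i _ => hu i).trans ?_)
  simp

section mixing

variable {W : Matrix (Fin n) (Fin n) ℝ}

lemma nmean_mix {M : Type*} [AddCommGroup M] [Module ℝ M] (hW : W ∈ doublyStochastic ℝ (Fin n))
    (u : Fin n → M) : nmean (mix W u) = nmean u := by
  simp only [nmean, mix]
  rw [Finset.sum_comm]
  simp [← Finset.sum_smul, sum_col_of_mem_doublyStochastic hW]

/-- On the centred vector `𝟏𝟏ᵀ/n` vanishes, and the rows of `W` fix the mean, so this is the
operator norm bound for `W - 𝟏𝟏ᵀ/n`. -/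
lemma rho_mix_scalar (hn : 0 < n) (hW : W ∈ doublyStochastic ℝ (Fin n)) (w : Fin n → ℝ) :
    ∑ i, (mix W w i - nmean w) ^ 2 ≤ rho W * ∑ i, (w i - nmean w) ^ 2 := by
  set z : EuclideanSpace ℝ (Fin n) := WithLp.toLp 2 fun i => w i - nmean w with hz
  set T := Matrix.toEuclideanCLM (n := Fin n) (𝕜 := ℝ)
    (W - Matrix.of fun _ _ => 1 / (n : ℝ)) with hT
  have h1 : ∀ i, (T z) i = mix W w i - nmean w := fun i => by
    rw [hT, Matrix.ofLp_toEuclideanCLM]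
    simp only [hz, Matrix.mulVec, dotProduct, Matrix.sub_apply, Matrix.of_apply, sub_mul,
      Finset.sum_sub_distrib, ← Finset.mul_sum]
    rw [← Finset.sum_sub_distrib, sum_sub_nmean hn w]
    simp only [mul_sub, Finset.sum_sub_distrib, ← Finset.sum_mul,
      sum_row_of_mem_doublyStochastic hW, mix, smul_eq_mul]
    ring
  have h2 := T.le_opNorm z
  have h3 : ‖T z‖ ^ 2 ≤ ‖T‖ ^ 2 * ‖z‖ ^ 2 := by
    rw [← mul_pow]; exact pow_le_pow_left₀ (norm_nonneg _) h2 2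
  rw [EuclideanSpace.real_norm_sq_eq, EuclideanSpace.real_norm_sq_eq] at h3
  simp only [h1] at h3
  exact h3

lemma rho_mix {m : ℕ} (hn : 0 < n) (hW : W ∈ doublyStochastic ℝ (Fin n)) (u : Fin n → Vec m) :
    ∑ i, ‖mix W u i - nmean u‖ ^ 2 ≤ rho W * ∑ i, ‖u i - nmean u‖ ^ 2 := by
  have hm : ∀ i l, (mix W u i - nmean u) l = mix W (fun i => u i l) i - nmean (fun i => u i l) :=
    fun i l => by simp [mix, nmean]
  have hu : ∀ i l, (u i - nmean u) l = u i l - nmean (fun i => u i l) :=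
    fun i l => by simp [nmean]
  simp only [EuclideanSpace.real_norm_sq_eq, hm, hu]
  rw [Finset.sum_comm, Finset.sum_comm (f := fun i l => (u i l - nmean fun i => u i l) ^ 2),
    Finset.mul_sum]
  exact Finset.sum_le_sum fun l _ => rho_mix_scalar hn hW _

lemma rho_nonneg (W : Matrix (Fin n) (Fin n) ℝ) : 0 ≤ rho W := sq_nonneg _

lemma sum_norm_mix_sub_le {m : ℕ} (hn : 0 < n) (hW : W ∈ doublyStochastic ℝ (Fin n))
    (hρ : rho W ≤ 1) (u : Fin n → Vec m) (q : Vec m) :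
    ∑ i, ‖mix W u i - q‖ ^ 2 ≤ ∑ i, ‖u i - q‖ ^ 2 := by
  rw [sum_norm_sub_sq hn (mix W u) q, sum_norm_sub_sq hn u q, nmean_mix hW]
  have := rho_mix hn hW u
  have h0 : 0 ≤ ∑ i, ‖u i - nmean u‖ ^ 2 := by positivity
  nlinarith

/-- The spectral gap `1 - ‖W - J‖`. -/
noncomputable def gap (W : Matrix (Fin n) (Fin n) ℝ) : ℝ := 1 - Real.sqrt (rho W)

lemma gap_le_one (W : Matrix (Fin n) (Fin n) ℝ) : gap W ≤ 1 := by
  have := Real.sqrt_nonneg (rho W)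
  rw [gap]; linarith

/-- `1 - ρ = (1 - √ρ)(1 + √ρ)`, and the second factor is at most `2`. -/
lemma half_one_sub_rho_le_gap (hρ : rho W < 1) : (1 - rho W) / 2 ≤ gap W := by
  have h1 := Real.sqrt_nonneg (rho W)
  have h2 := Real.sq_sqrt (rho_nonneg W)
  have h3 : Real.sqrt (rho W) < 1 := by
    rw [Real.sqrt_lt' one_pos]; simpa using hρ
  rw [gap]; nlinarith

lemma gap_pos (hρ : rho W < 1) : 0 < gap W :=
  lt_of_lt_of_le (by linarith) (half_one_sub_rho_le_gap hρ)

-- Young's inequality with weights `r` and `1 - r`, where `r = √ρ`. One of the two factors `r` in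
-- `ρ` is spent on the cross term, the other remains as the contraction.
omit [InnerProductSpace ℝ E] in
lemma rho_mul_sq_add_le (hρ : rho W < 1) (a b : E) :
    rho W * ‖a + b‖ ^ 2 ≤ (1 - gap W) * ‖a‖ ^ 2 + 1 / gap W * ‖b‖ ^ 2 := by
  have hg := gap_pos hρ
  set r := Real.sqrt (rho W) with hr
  have hr0 : 0 ≤ r := Real.sqrt_nonneg _
  have hgr : gap W = 1 - r := rfl
  have hrr : rho W = r ^ 2 := (Real.sq_sqrt (rho_nonneg W)).symm
  have h1 : ‖a + b‖ ^ 2 ≤ (‖a‖ + ‖b‖) ^ 2 := pow_le_pow_left₀ (norm_nonneg _) (norm_add_le a b) 2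
  have h2 : r ^ 2 * (‖a‖ + ‖b‖) ^ 2 * gap W ≤ (r * ‖a‖ ^ 2 + 1 / gap W * ‖b‖ ^ 2) * gap W := by
    have : (r * ‖a‖ ^ 2 + 1 / gap W * ‖b‖ ^ 2) * gap W = r * gap W * ‖a‖ ^ 2 + ‖b‖ ^ 2 := by
      field_simp
    rw [this, hgr]
    have h5 : r < 1 := by linarith
    -- The square behind Young's inequality, multiplied by `r` rather than divided, so that `ρ = 0`
    -- is included.
    have h3 : 0 ≤ r * ((1 - r) * ‖a‖ - r * ‖b‖) ^ 2 := by positivity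
    have h4 : r ^ 2 * ‖b‖ ^ 2 ≤ ‖b‖ ^ 2 := by nlinarith [sq_nonneg ‖b‖, mul_nonneg hr0 hr0]
    nlinarith
  have h3 := le_of_mul_le_mul_right h2 hg
  have h4 : r ^ 2 * ‖a + b‖ ^ 2 ≤ r ^ 2 * (‖a‖ + ‖b‖) ^ 2 :=
    mul_le_mul_of_nonneg_left h1 (by positivity)
  rw [hrr]
  have : 1 - gap W = r := by rw [hgr]; ring
  rw [this]
  linarith

lemma consensus_step {m : ℕ} (hn : 0 < n) (hW : W ∈ doublyStochastic ℝ (Fin n))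
    (hρ : rho W < 1) (u h : Fin n → Vec m) :
    ∑ i, ‖mix W (fun i => u i + h i) i - nmean (fun i => u i + h i)‖ ^ 2
      ≤ (1 - gap W) * ∑ i, ‖u i - nmean u‖ ^ 2 + 1 / gap W * ∑ i, ‖h i‖ ^ 2 := by
  refine (rho_mix hn hW _).trans ?_
  have h1 : ∀ i, u i + h i - nmean (fun i => u i + h i) = (u i - nmean u) + (h i - nmean h) :=
    fun i => by rw [nmean_add]; abel
  simp only [h1]
  have hg := gap_pos hρ
  have h2 : ∑ i, ‖h i - nmean h‖ ^ 2 ≤ ∑ i, ‖h i‖ ^ 2 := by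
    simpa using sum_norm_sub_nmean_le hn h 0
  calc rho W * ∑ i, ‖(u i - nmean u) + (h i - nmean h)‖ ^ 2
      ≤ ∑ i, ((1 - gap W) * ‖u i - nmean u‖ ^ 2 + 1 / gap W * ‖h i - nmean h‖ ^ 2) := by
        rw [Finset.mul_sum]
        exact Finset.sum_le_sum fun i _ => rho_mul_sq_add_le hρ _ _
    _ = (1 - gap W) * ∑ i, ‖u i - nmean u‖ ^ 2 + 1 / gap W * ∑ i, ‖h i - nmean h‖ ^ 2 := by
        rw [Finset.sum_add_distrib, Finset.mul_sum, Finset.mul_sum]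
    _ ≤ _ := by gcongr

end mixing

end network

/-! ### Euclidean projection -/

section projection

variable {d : ℕ} {Y : Set (Vec d)}

lemma proj_spec (hc : IsClosed Y) (hconv : Convex ℝ Y) (hne : Y.Nonempty) (v : Vec d) :
    proj Y v ∈ Y ∧ ∀ z ∈ Y, ‖v - proj Y v‖ ≤ ‖v - z‖ := by
  have : ∃ w, w ∈ Y ∧ ∀ z ∈ Y, ‖v - w‖ ≤ ‖v - z‖ := by
    obtain ⟨w, hw, h⟩ := exists_norm_eq_iInf_of_complete_convex hne hc.isComplete hconv v
    refine ⟨w, hw, fun z hz => ?_⟩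
    rw [h]
    exact ciInf_le ⟨0, Set.forall_mem_range.2 fun _ => norm_nonneg _⟩ (⟨z, hz⟩ : Y)
  exact Classical.epsilon_spec this

lemma proj_mem (hc : IsClosed Y) (hconv : Convex ℝ Y) (hne : Y.Nonempty) (v : Vec d) :
    proj Y v ∈ Y := (proj_spec hc hconv hne v).1

lemma proj_inner_le (hc : IsClosed Y) (hconv : Convex ℝ Y) (hne : Y.Nonempty) (v : Vec d)
    {w : Vec d} (hw : w ∈ Y) : inner ℝ (v - proj Y v) (w - proj Y v) ≤ 0 := by
  obtain ⟨h1, h2⟩ := proj_spec hc hconv hne v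
  refine (norm_eq_iInf_iff_real_inner_le_zero hconv h1).1 ?_ w hw
  have : Nonempty Y := ⟨⟨_, h1⟩⟩
  refine le_antisymm (le_ciInf fun z => h2 z z.2) ?_
  exact ciInf_le ⟨0, Set.forall_mem_range.2 fun _ => norm_nonneg _⟩ (⟨_, h1⟩ : Y)

/-- The two obtuse-angle inequalities add up to `‖a - b‖² ≤ ⟪v - w, a - b⟫`. -/
lemma norm_proj_sub_proj_le (hc : IsClosed Y) (hconv : Convex ℝ Y) (hne : Y.Nonempty)
    (v w : Vec d) : ‖proj Y v - proj Y w‖ ≤ ‖v - w‖ := by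
  have h1 := proj_inner_le hc hconv hne v (proj_mem hc hconv hne w)
  have h2 := proj_inner_le hc hconv hne w (proj_mem hc hconv hne v)
  set a := proj Y v
  set b := proj Y w
  have h3 : ‖a - b‖ ^ 2 ≤ inner ℝ (v - w) (a - b) := by
    have e : inner ℝ (v - w) (a - b) - ‖a - b‖ ^ 2
        = - inner ℝ (v - a) (b - a) - inner ℝ (w - b) (a - b) := by
      rw [← real_inner_self_eq_norm_sq]
      simp only [inner_sub_left, inner_sub_right]
      ring
    linarith
  have h4 := real_inner_le_norm (v - w) (a - b)
  by_contra! hcon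
  have : 0 < ‖a - b‖ := (norm_nonneg _).trans_lt hcon
  nlinarith

lemma proj_eq_self (hc : IsClosed Y) (hconv : Convex ℝ Y) {v : Vec d} (hv : v ∈ Y) :
    proj Y v = v := by
  have h := (proj_spec hc hconv ⟨v, hv⟩ v).2 v hv
  rw [sub_self, norm_zero] at h
  exact (sub_eq_zero.1 (norm_le_zero_iff.1 h)).symm

lemma continuous_proj (hc : IsClosed Y) (hconv : Convex ℝ Y) (hne : Y.Nonempty) :
    Continuous (proj Y) :=
  (LipschitzWith.of_dist_le_mul (K := 1) fun v w => by
    simpa [dist_eq_norm] using norm_proj_sub_proj_le hc hconv hne v w).continuous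

lemma norm_proj_sub_le (hc : IsClosed Y) (hconv : Convex ℝ Y) {q : Vec d} (hq : q ∈ Y)
    (v : Vec d) : ‖proj Y v - q‖ ≤ ‖v - q‖ := by
  have := norm_proj_sub_proj_le hc hconv ⟨q, hq⟩ v q
  rwa [proj_eq_self hc hconv hq] at this

end projection

/-! ### The minimax problem -/

namespace Problem

variable {n p d : ℕ} {Ξ : Type*} [MeasurableSpace Ξ] {P : Problem n p d Ξ} {μ L C : ℝ}

/-- Gradients of the global objective. -/
noncomputable def avgX (P : Problem n p d Ξ) (x : Vec p) (y : Vec d) : Vec p :=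
  nmean fun i => P.gradX i x y

noncomputable def avgY (P : Problem n p d Ξ) (x : Vec p) (y : Vec d) : Vec d :=
  nmean fun i => P.gradY i x y

lemma norm_gradX_le (hS : P.Setting) (hG : P.StochGrad C) (i : Fin n) (x : Vec p) {y : Vec d}
    (hy : y ∈ P.Y) : ‖P.gradX i x y‖ ≤ C := by
  have := hS.prob i
  rw [← hG.unbiasedX i x y hy]
  simpa using norm_integral_le_of_norm_le_const (hG.boundX i x y hy)

lemma norm_gradY_le (hS : P.Setting) (hG : P.StochGrad C) (i : Fin n) (x : Vec p) {y : Vec d}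
    (hy : y ∈ P.Y) : ‖P.gradY i x y‖ ≤ C := by
  have := hS.prob i
  rw [← hG.unbiasedY i x y hy]
  simpa using norm_integral_le_of_norm_le_const (hG.boundY i x y hy)

/-- Adding the strong concavity inequalities at both points gives `μ ‖y - y'‖² ≤ 2 C ‖y - y'‖`.
Bounded gradients thus force `Y` to be bounded, which yields the maximizer and a priori bounds for
all dual errors. -/
lemma norm_sub_le_of_mem (hn : 0 < n) (hμ : 0 < μ) (hS : P.Setting) (hC : P.StronglyConcave μ)
    (hG : P.StochGrad C) (x : Vec p) {y y' : Vec d} (hy : y ∈ P.Y) (hy' : y' ∈ P.Y) :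
    ‖y - y'‖ ≤ 2 * C / μ := by
  have h1 := hC ⟨0, hn⟩ x y hy y' hy'
  have h2 := hC ⟨0, hn⟩ x y' hy' y hy
  have h3 := norm_gradY_le hS hG ⟨0, hn⟩ x hy
  have h4 := norm_gradY_le hS hG ⟨0, hn⟩ x hy'
  set g := P.gradY ⟨0, hn⟩ x y
  set g' := P.gradY ⟨0, hn⟩ x y'
  have h5 := neg_le_of_abs_le (abs_real_inner_le_norm g (y - y'))
  have h6 := neg_le_of_abs_le (abs_real_inner_le_norm g' (y' - y))
  rw [norm_sub_rev y' y] at h2 h6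
  rw [le_div_iff₀ hμ]
  by_contra! hcon
  have hpos : 0 < ‖y - y'‖ := by
    rcases (norm_nonneg (y - y')).eq_or_lt with h | h
    · rw [← h] at hcon
      have := (norm_nonneg _).trans h3
      linarith
    · exact h
  nlinarith

lemma norm_gradX_sub_le (hL : 0 < L) (hsm : P.Smooth L) (i : Fin n) (x x' : Vec p) {y : Vec d}
    (hy : y ∈ P.Y) : ‖P.gradX i x y - P.gradX i x' y‖ ≤ L * ‖x - x'‖ := by
  have h := hsm.lipX i x x' y hy y hy
  rw [sub_self, norm_zero] at h
  refine le_of_sq_le_sq ?_ (by positivity)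
  linarith [mul_pow L ‖x - x'‖ 2]

lemma norm_gradY_sub_le (hL : 0 < L) (hsm : P.Smooth L) (i : Fin n) (x x' : Vec p) {y : Vec d}
    (hy : y ∈ P.Y) : ‖P.gradY i x y - P.gradY i x' y‖ ≤ L * ‖x - x'‖ := by
  have h := hsm.lipY i x x' y hy y hy
  rw [sub_self, norm_zero] at h
  refine le_of_sq_le_sq ?_ (by positivity)
  linarith [mul_pow L ‖x - x'‖ 2]

lemma norm_avgX_sub_le' (hn : 0 < n) (hL : 0 < L) (hsm : P.Smooth L) (x : Vec p) {y y' : Vec d}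
    (hy : y ∈ P.Y) (hy' : y' ∈ P.Y) : ‖P.avgX x y - P.avgX x y'‖ ≤ L * ‖y - y'‖ := by
  rw [avgX, avgX, ← nmean_sub]
  refine norm_nmean_le hn fun i => ?_
  have h := hsm.lipX i x x y hy y' hy'
  rw [sub_self, norm_zero] at h
  refine le_of_sq_le_sq ?_ (by positivity)
  linarith [mul_pow L ‖y - y'‖ 2]

lemma norm_avgY_sub_le (hn : 0 < n) (hL : 0 < L) (hsm : P.Smooth L) (x x' : Vec p) {y : Vec d}
    (hy : y ∈ P.Y) : ‖P.avgY x y - P.avgY x' y‖ ≤ L * ‖x - x'‖ := by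
  rw [avgY, avgY, ← nmean_sub]
  exact norm_nmean_le hn fun i => norm_gradY_sub_le hL hsm i x x' hy

lemma norm_avgY_sub_le' (hn : 0 < n) (hL : 0 < L) (hsm : P.Smooth L) (x : Vec p) {y y' : Vec d}
    (hy : y ∈ P.Y) (hy' : y' ∈ P.Y) : ‖P.avgY x y - P.avgY x y'‖ ≤ L * ‖y - y'‖ := by
  rw [avgY, avgY, ← nmean_sub]
  refine norm_nmean_le hn fun i => ?_
  have h := hsm.lipY i x x y hy y' hy'
  rw [sub_self, norm_zero] at h
  refine le_of_sq_le_sq ?_ (by positivity)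
  linarith [mul_pow L ‖y - y'‖ 2]

lemma f_eq_nmean (x : Vec p) (y : Vec d) : P.f x y = nmean fun i => P.fLoc i x y := rfl

lemma inner_avgY_le (hn : 0 < n) (hC : P.StronglyConcave μ) (x : Vec p) {y y' : Vec d}
    (hy : y ∈ P.Y) (hy' : y' ∈ P.Y) :
    inner ℝ (P.avgY x y) (y - y') + μ / 2 * ‖y - y'‖ ^ 2 ≤ P.f x y - P.f x y' := by
  have hn' : (0 : ℝ) < n := by positivity
  have h := Finset.sum_le_sum fun i (_ : i ∈ Finset.univ) => hC i x y hy y' hy'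
  simp only [Finset.sum_add_distrib, Finset.sum_sub_distrib, ← sum_inner, Finset.sum_const,
    Finset.card_univ, Fintype.card_fin, nsmul_eq_mul] at h
  rw [← smul_nmean hn (fun i => P.gradY i x y), real_inner_smul_left,
    ← smul_nmean hn (fun i => P.fLoc i x y), ← smul_nmean hn (fun i => P.fLoc i x y')] at h
  simp only [smul_eq_mul] at h
  rw [f_eq_nmean, f_eq_nmean, avgY]
  refine le_of_mul_le_mul_left (a := (n : ℝ)) ?_ hn'
  linarith

/-- The mean value inequality on the segment, which gives `L` in place of `L / 2`. -/
lemma abs_fLoc_sub_le (hL : 0 < L) (hsm : P.Smooth L) (i : Fin n) (x x' : Vec p) {y : Vec d}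
    (hy : y ∈ P.Y) :
    |P.fLoc i x' y - P.fLoc i x y - inner ℝ (P.gradX i x y) (x' - x)| ≤ L * ‖x' - x‖ ^ 2 := by
  have hseg : Convex ℝ (segment ℝ x x') := convex_segment x x'
  have hfd : ∀ z, fderiv ℝ (fun z => P.fLoc i z y) z = InnerProductSpace.toDual ℝ _ (P.gradX i z y) :=
    fun z => by simp [gradX, gradient]
  have hb : ∀ z ∈ segment ℝ x x', ‖fderiv ℝ (fun z => P.fLoc i z y) z
      - InnerProductSpace.toDual ℝ _ (P.gradX i x y)‖ ≤ L * ‖x' - x‖ := fun z hz => by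
    rw [hfd, ← map_sub, LinearIsometryEquiv.norm_map]
    refine (norm_gradX_sub_le hL hsm i z x hy).trans ?_
    gcongr
    simpa [dist_eq_norm, norm_sub_rev] using! norm_sub_le_of_mem_segment hz
  have := hseg.norm_image_sub_le_of_norm_fderiv_le' (fun z _ => hsm.diffX i z y hy) hb
    (left_mem_segment ℝ x x') (right_mem_segment ℝ x x')
  rw [Real.norm_eq_abs, InnerProductSpace.toDual_apply_apply] at this
  linarith

lemma abs_f_sub_le (hn : 0 < n) (hL : 0 < L) (hsm : P.Smooth L) (x x' : Vec p) {y : Vec d}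
    (hy : y ∈ P.Y) :
    |P.f x' y - P.f x y - inner ℝ (P.avgX x y) (x' - x)| ≤ L * ‖x' - x‖ ^ 2 := by
  have e : P.f x' y - P.f x y - inner ℝ (P.avgX x y) (x' - x) = nmean fun i =>
      P.fLoc i x' y - P.fLoc i x y - inner ℝ (P.gradX i x y) (x' - x) := by
    rw [nmean_sub, nmean_sub, f_eq_nmean, f_eq_nmean, avgX]
    simp only [nmean, real_inner_smul_left, sum_inner, smul_eq_mul]
  rw [e, ← Real.norm_eq_abs]
  exact norm_nmean_le hn fun i => abs_fLoc_sub_le hL hsm i x x' hy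

/-- What is needed of the maximizer `y*`. -/
lemma yStar_spec (hn : 0 < n) (hμ : 0 < μ) (hS : P.Setting) (hC : P.StronglyConcave μ)
    (hsm : P.Smooth L) (hG : P.StochGrad C) (hne : P.Y.Nonempty) (x : Vec p) :
    P.yStar x ∈ P.Y ∧ ∀ y ∈ P.Y, P.f x y ≤ P.f x (P.yStar x) := by
  have hcomp : IsCompact P.Y := by
    refine Metric.isCompact_of_isClosed_isBounded hS.closed ?_
    refine Metric.isBounded_iff.2 ⟨2 * C / μ, fun y hy y' hy' => ?_⟩
    rw [dist_eq_norm]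
    exact norm_sub_le_of_mem hn hμ hS hC hG x hy hy'
  have hcont : ContinuousOn (P.f x) P.Y := by
    refine continuousOn_const.mul (continuousOn_finsetSum _ fun i _ => fun y hy => ?_)
    exact (hsm.diffY i x y hy).continuousAt.continuousWithinAt
  obtain ⟨y, hy, hmax⟩ := hcomp.exists_isMaxOn hne hcont
  have : ∃ y, y ∈ P.Y ∧ ∀ y' ∈ P.Y, P.f x y' ≤ P.f x y := ⟨y, hy, fun y' hy' => hmax hy'⟩
  exact Classical.epsilon_spec this

/-- First-order optimality. Strong concavity at the feasible point `q + t (y - q)`, compared with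
the maximizer `q`, makes the gradient there point away from `y - q`; Lipschitz continuity transports
this to `q` up to `O(t)`. -/
lemma inner_avgY_yStar_le (hn : 0 < n) (hμ : 0 < μ) (hL : 0 < L) (hS : P.Setting)
    (hC : P.StronglyConcave μ) (hsm : P.Smooth L) (hG : P.StochGrad C) (hne : P.Y.Nonempty)
    (x : Vec p) {y : Vec d} (hy : y ∈ P.Y) :
    inner ℝ (P.avgY x (P.yStar x)) (y - P.yStar x) ≤ 0 := by
  obtain ⟨hm, hmax⟩ := yStar_spec hn hμ hS hC hsm hG hne x
  set q := P.yStar x with hq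
  have key : ∀ t : ℝ, 0 < t → t ≤ 1 →
      inner ℝ (P.avgY x q) (y - q) ≤ t * (L * ‖y - q‖ ^ 2) := by
    intro t ht ht1
    have hyt : q + t • (y - q) ∈ P.Y := hS.convex.add_smul_sub_mem hm hy ⟨ht.le, ht1⟩
    have h1 := inner_avgY_le hn hC x hyt hm
    have h2 := hmax _ hyt
    rw [add_sub_cancel_left, real_inner_smul_right] at h1
    have h3 : 0 ≤ μ / 2 * ‖t • (y - q)‖ ^ 2 := by positivity
    have h4 : inner ℝ (P.avgY x (q + t • (y - q))) (y - q) ≤ 0 := by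
      by_contra! hcon
      nlinarith
    have h5 := norm_avgY_sub_le' hn hL hsm x hm hyt
    have h6 : ‖q - (q + t • (y - q))‖ = t * ‖y - q‖ := by
      rw [sub_add_cancel_left, norm_neg, norm_smul, Real.norm_of_nonneg ht.le]
    rw [h6] at h5
    have h7 := real_inner_le_norm (P.avgY x q - P.avgY x (q + t • (y - q))) (y - q)
    rw [inner_sub_left] at h7
    nlinarith [mul_le_mul_of_nonneg_right h5 (norm_nonneg (y - q))]
  by_contra! hcon
  set a := inner ℝ (P.avgY x q) (y - q)
  have hb : 0 ≤ L * ‖y - q‖ ^ 2 := by positivity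
  set b := L * ‖y - q‖ ^ 2
  -- Small enough that `t b ≤ a / 2 < a`; the `+ 1` covers `b = 0`.
  have h1 := key (min 1 (a / (2 * (b + 1)))) (by positivity) (min_le_left _ _)
  have h2 : min 1 (a / (2 * (b + 1))) * b ≤ a / (2 * (b + 1)) * b := by
    gcongr; exact min_le_right _ _
  have h3 : a / (2 * (b + 1)) * b ≤ a / 2 := by
    rw [div_mul_eq_mul_div, div_le_div_iff₀ (by positivity) (by positivity)]
    nlinarith
  linarith

/-- With `y = y*(x)`, `y' = y*(x')`: strong concavity of `f(x, ·)` at `y'` and first-order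
optimality of `y'` for `f(x', ·)` leave `μ/2 ‖y - y'‖² ≤ ⟪∇f(x, y') - ∇f(x', y'), y - y'⟫`. -/
lemma norm_yStar_sub_le (hn : 0 < n) (hμ : 0 < μ) (hL : 0 < L) (hS : P.Setting)
    (hC : P.StronglyConcave μ) (hsm : P.Smooth L) (hG : P.StochGrad C) (hne : P.Y.Nonempty)
    (x x' : Vec p) : ‖P.yStar x - P.yStar x'‖ ≤ 2 * (L / μ) * ‖x - x'‖ := by
  obtain ⟨hm, hmax⟩ := yStar_spec hn hμ hS hC hsm hG hne x
  obtain ⟨hm', hmax'⟩ := yStar_spec hn hμ hS hC hsm hG hne x'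
  have h1 := inner_avgY_le hn hC x hm' hm
  have h2 := hmax _ hm'
  have h3 := inner_avgY_yStar_le hn hμ hL hS hC hsm hG hne x' hm
  have h4 := norm_avgY_sub_le hn hL hsm x x' hm'
  set y := P.yStar x
  set y' := P.yStar x'
  have h5 := real_inner_le_norm (P.avgY x y' - P.avgY x' y') (y - y')
  have e : inner ℝ (P.avgY x y') (y' - y) = - inner ℝ (P.avgY x y') (y - y') := by
    rw [← inner_neg_right, neg_sub]
  rw [inner_sub_left] at h5
  rw [e, norm_sub_rev y' y] at h1
  have h6 := mul_le_mul_of_nonneg_right h4 (norm_nonneg (y - y'))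
  have h7 : μ / 2 * ‖y - y'‖ ^ 2 ≤ L * ‖x - x'‖ * ‖y - y'‖ := by linarith
  have e2 : 2 * (L / μ) * ‖x - x'‖ = 2 * L * ‖x - x'‖ / μ := by ring
  rw [e2, le_div_iff₀ hμ]
  by_contra! hcon
  have h0 : 0 ≤ 2 * L * ‖x - x'‖ := by positivity
  have hpos : 0 < ‖y - y'‖ := pos_of_mul_pos_left (h0.trans_lt hcon) hμ.le
  nlinarith

/-- Envelope argument: by maximality `Φ(x') - Φ(x)` lies between the increments of `f(·, y*(x))` and
of `f(·, y*(x'))`. Moving the gradient in the second to `y*(x)` costs `L · 2κ ‖x' - x‖²`. -/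
lemma abs_Phi_sub_le (hn : 0 < n) (hμ : 0 < μ) (hL : 0 < L) (hS : P.Setting)
    (hC : P.StronglyConcave μ) (hsm : P.Smooth L) (hG : P.StochGrad C) (hne : P.Y.Nonempty)
    (x x' : Vec p) :
    |P.Phi x' - P.Phi x - inner ℝ (P.avgX x (P.yStar x)) (x' - x)|
      ≤ (L + 2 * L * (L / μ)) * ‖x' - x‖ ^ 2 := by
  obtain ⟨hm, hmax⟩ := yStar_spec hn hμ hS hC hsm hG hne x
  obtain ⟨hm', hmax'⟩ := yStar_spec hn hμ hS hC hsm hG hne x'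
  have h1 := abs_le.1 (abs_f_sub_le hn hL hsm x x' hm)
  have h2 := abs_le.1 (abs_f_sub_le hn hL hsm x x' hm')
  have h3 := hmax' _ hm
  have h4 := hmax _ hm'
  have h5 := norm_avgX_sub_le' hn hL hsm x hm' hm
  have h6 := norm_yStar_sub_le hn hμ hL hS hC hsm hG hne x' x
  have h7 := real_inner_le_norm (P.avgX x (P.yStar x') - P.avgX x (P.yStar x)) (x' - x)
  rw [inner_sub_left] at h7
  have h8 : ‖P.avgX x (P.yStar x') - P.avgX x (P.yStar x)‖ * ‖x' - x‖
      ≤ 2 * L * (L / μ) * ‖x' - x‖ ^ 2 := by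
    calc _ ≤ L * (2 * (L / μ) * ‖x' - x‖) * ‖x' - x‖ := by
          gcongr; exact h5.trans (by gcongr)
      _ = _ := by ring
  have h9 : 0 ≤ 2 * L * (L / μ) * ‖x' - x‖ ^ 2 := by positivity
  rw [Phi, Phi, abs_le]
  constructor <;> linarith [h1.1, h2.2]

lemma hasGradientAt_Phi (hn : 0 < n) (hμ : 0 < μ) (hL : 0 < L) (hS : P.Setting)
    (hC : P.StronglyConcave μ) (hsm : P.Smooth L) (hG : P.StochGrad C) (hne : P.Y.Nonempty)
    (x : Vec p) : HasGradientAt P.Phi (P.avgX x (P.yStar x)) x := by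
  rw [hasGradientAt_iff_isLittleO]
  refine Asymptotics.IsBigO.trans_isLittleO (g := fun x' => ‖x' - x‖ ^ 2) ?_ ?_
  · refine Asymptotics.IsBigO.of_bound (L + 2 * L * (L / μ)) (Filter.Eventually.of_forall
      fun x' => ?_)
    rw [Real.norm_eq_abs, Real.norm_of_nonneg (by positivity)]
    exact abs_Phi_sub_le hn hμ hL hS hC hsm hG hne x x'
  · have h : (fun x' => ‖x' - x‖ ^ 2) = (fun z : Vec p => ‖z‖ ^ 2) ∘ fun x' => x' - x := rfl
    have h2 : (fun x' : Vec p => x' - x) = (fun z : Vec p => z) ∘ fun x' => x' - x := rfl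
    rw [h]
    nth_rewrite 2 [h2]
    refine (Asymptotics.isLittleO_norm_pow_id one_lt_two).comp_tendsto ?_
    have : Filter.Tendsto (fun x' : Vec p => x' - x) (nhds x) (nhds (x - x)) :=
      (continuous_id.sub continuous_const).tendsto x
    rwa [sub_self] at this

lemma gradient_Phi (hn : 0 < n) (hμ : 0 < μ) (hL : 0 < L) (hS : P.Setting)
    (hC : P.StronglyConcave μ) (hsm : P.Smooth L) (hG : P.StochGrad C) (hne : P.Y.Nonempty)
    (x : Vec p) : gradient P.Phi x = P.avgX x (P.yStar x) :=
  (hasGradientAt_Phi hn hμ hL hS hC hsm hG hne x).gradient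

lemma differentiable_Phi (hn : 0 < n) (hμ : 0 < μ) (hL : 0 < L) (hS : P.Setting)
    (hC : P.StronglyConcave μ) (hsm : P.Smooth L) (hG : P.StochGrad C) (hne : P.Y.Nonempty) :
    Differentiable ℝ P.Phi := fun x =>
  (hasGradientAt_Phi hn hμ hL hS hC hsm hG hne x).differentiableAt

end Problem

/-! ### Summing the one-step inequalities -/

/-- A gradient accumulator `v` and the squared gradient norms `g` that it collects. -/
structure Accum (c kV kH : ℝ) (v g : ℕ → ℝ) : Prop where
  lower : ∀ k, c ≤ v k
  mono : Monotone v
  upper : ∀ K : ℕ, 1 ≤ K → ∀ k ≤ K, v k ≤ kV * K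
  nonneg : ∀ k, 0 ≤ g k
  sum_le : ∀ K : ℕ, 1 ≤ K → ∑ k ∈ Finset.range K, g k * (v k)⁻¹ ≤ kH * (1 + Real.log K)

section accum

variable {c kV kH : ℝ} {v g : ℕ → ℝ}

lemma Accum.pos (hc : 0 < c) (h : Accum c kV kH v g) (k : ℕ) : 0 < v k := hc.trans_le (h.lower k)

lemma Accum.sum_rpow_le (hc : 0 < c) (h : Accum c kV kH v g) (q : ℝ) {K : ℕ} (hK : 1 ≤ K) :
    ∑ k ∈ Finset.range K, v k ^ (-q) * g k
      ≤ kH * (1 + Real.log K) * (c ^ (1 - q) + (kV * K) ^ (1 - q)) := by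
  have hpos : 0 ≤ c ^ (1 - q) + (kV * K) ^ (1 - q) := by
    have := (h.pos hc K).trans_le (h.upper K hK K le_rfl)
    positivity
  calc ∑ k ∈ Finset.range K, v k ^ (-q) * g k
      ≤ ∑ k ∈ Finset.range K, g k * (v k)⁻¹ * (c ^ (1 - q) + (kV * K) ^ (1 - q)) := by
        refine Finset.sum_le_sum fun k hk => ?_
        have hv := h.pos hc k
        have e : v k ^ (-q) = (v k)⁻¹ * v k ^ (1 - q) := by
          rw [← Real.rpow_neg_one, ← Real.rpow_add hv]; congr 1; ring
        have h1 := rpow_le_rpow_add_rpow hc (h.lower k)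
          (h.upper K hK k (Finset.mem_range.1 hk).le) (1 - q)
        rw [e]
        have h2 : 0 ≤ g k * (v k)⁻¹ := mul_nonneg (h.nonneg k) (by positivity)
        calc (v k)⁻¹ * v k ^ (1 - q) * g k = g k * (v k)⁻¹ * v k ^ (1 - q) := by ring
          _ ≤ _ := by gcongr
    _ ≤ _ := by
        rw [← Finset.sum_mul]
        exact mul_le_mul_of_nonneg_right (h.sum_le K hK) hpos

lemma Accum.log_le (hc : 0 < c) (h : Accum c kV kH v g) {K : ℕ} (hK : 1 ≤ K) :
    Real.log (v K) - Real.log (v 0)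
      ≤ (1 + |Real.log kV - Real.log c|) * (1 + Real.log K) := by
  have hK0 : (0 : ℝ) < K := by positivity
  have h1 := Real.log_le_log (h.pos hc K) (h.upper K hK K le_rfl)
  have h2 := Real.log_le_log hc (h.lower 0)
  have h3 : 0 < kV := pos_of_mul_pos_left ((h.pos hc K).trans_le (h.upper K hK K le_rfl)) hK0.le
  rw [Real.log_mul h3.ne' hK0.ne'] at h1
  have h4 := le_abs_self (Real.log kV - Real.log c)
  have h5 : 0 ≤ Real.log K := Real.log_nonneg (by exact_mod_cast hK)
  have h6 := abs_nonneg (Real.log kV - Real.log c)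
  nlinarith

lemma Accum.rpow_le (hc : 0 < c) (h : Accum c kV kH v g) {q : ℝ} (hq : 0 ≤ q) {K : ℕ}
    (hK : 1 ≤ K) : v K ^ q ≤ kV ^ q * (K : ℝ) ^ q := by
  have hK0 : (0 : ℝ) < K := by positivity
  have h3 : 0 < kV := pos_of_mul_pos_left ((h.pos hc K).trans_le (h.upper K hK K le_rfl)) hK0.le
  rw [← Real.mul_rpow h3.le hK0.le]
  exact Real.rpow_le_rpow (h.pos hc K).le (h.upper K hK K le_rfl) hq

end accum

/-- The rate of the transient terms, in terms of the spectral gap `e`. -/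
noncomputable def rate (α β e : ℝ) (K : ℕ) : ℝ :=
  (1 + Real.log K) * ((K : ℝ) ^ α + e ^ (-α) * (K : ℝ) ^ (1 - α) + (K : ℝ) ^ β
    + e⁻¹ * (K : ℝ) ^ (1 - β))

section rate

variable {α β e : ℝ} {K : ℕ}

lemma rate_bounds (hβ : 0 < β) (hα : β < α) (hα1 : α < 1) (he : 0 < e) (hK : 1 ≤ K) :
    (1 + Real.log K) * (K : ℝ) ^ α ≤ rate α β e K ∧
    (1 + Real.log K) * (e ^ (-α) * (K : ℝ) ^ (1 - α)) ≤ rate α β e K ∧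
    (1 + Real.log K) * (K : ℝ) ^ β ≤ rate α β e K ∧
    (1 + Real.log K) * (e⁻¹ * (K : ℝ) ^ (1 - β)) ≤ rate α β e K ∧
    1 ≤ 1 + Real.log K ∧ 1 ≤ (K : ℝ) ^ α ∧ 1 ≤ (K : ℝ) ^ (1 - α) ∧ 1 ≤ (K : ℝ) ^ β ∧
    1 ≤ (K : ℝ) ^ (1 - β) := by
  have hK1 : (1 : ℝ) ≤ K := by exact_mod_cast hK
  have hl : 0 ≤ Real.log K := Real.log_nonneg hK1
  have a1 : 1 ≤ (K : ℝ) ^ α := Real.one_le_rpow hK1 (by linarith)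
  have a2 : 1 ≤ (K : ℝ) ^ (1 - α) := Real.one_le_rpow hK1 (by linarith)
  have a3 : 1 ≤ (K : ℝ) ^ β := Real.one_le_rpow hK1 (by linarith)
  have a4 : 1 ≤ (K : ℝ) ^ (1 - β) := Real.one_le_rpow hK1 (by linarith)
  have b2 : 0 ≤ e ^ (-α) * (K : ℝ) ^ (1 - α) := by positivity
  have b4 : 0 ≤ e⁻¹ * (K : ℝ) ^ (1 - β) := by positivity
  refine ⟨?_, ?_, ?_, ?_, by linarith, a1, a2, a3, a4⟩ <;> unfold rate <;> gcongr <;> linarith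

end rate

/-- Constants of the one-step inequalities. -/
structure Consts where
  (α β γx γy μ L N κ θ m0 kV kH kE Δ RX RY RD RR kA kC1 kC2 kC3 kC4 kD1 kD2 kD3 kF kM kG : ℝ)

structure Consts.Ok (c : Consts) : Prop where
  β : 0 < c.β
  αβ : c.β < c.α
  α1 : c.α < 1
  γx : 0 < c.γx
  γy : 0 < c.γy
  μ : 0 < c.μ
  N : 0 < c.N
  θ : 0 < c.θ
  m0 : 0 < c.m0
  kV : 0 < c.kV
  kH : 0 ≤ c.kH
  kE : 0 ≤ c.kE
  Δ : 0 ≤ c.Δ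
  RX : 0 ≤ c.RX
  RY : 0 ≤ c.RY
  RD : 0 ≤ c.RD
  RR : 0 ≤ c.RR
  kA : 0 ≤ c.kA
  kC1 : 0 ≤ c.kC1
  kC2 : 0 ≤ c.kC2
  kC3 : 0 ≤ c.kC3
  kC4 : 0 ≤ c.kC4
  kD1 : 0 ≤ c.kD1
  kD2 : 0 ≤ c.kD2
  kD3 : 0 ≤ c.kD3
  kF : 0 ≤ c.kF
  kM : 0 ≤ c.kM
  kG : 0 ≤ c.kG

/-- The scalar sequences attached to a trajectory: accumulators `v`, `u`, squared norms of the
stochastic gradients `gx`, `gy`, of `∇Φ` (`P2`), of the averaged gradients (`G2`, `Gy2`), the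
gradient error `Q`, the dual tracking error `D`, the primal lag `r2`, the consensus errors `cx`,
`cy`, the stepsize inconsistencies `ev`, `eu`, the objective `φ`, and the noise terms. -/
structure Seqs where
  (v u gx gy P2 G2 Gy2 Q D r2 cx cy ev eu φ
    noiseDescent noiseTrack noiseLag noiseMeanY noiseMeanX : ℕ → ℝ)

structure Seqs.Ok (s : Seqs) (c : Consts) (e zv zu : ℝ) : Prop where
  v : Accum c.m0 c.kV c.kH s.v s.gx
  u : Accum c.m0 c.kV c.kH s.u s.gy
  cx0 : s.cx 0 ≤ c.RX
  cx : ∀ k, 0 ≤ s.cx k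
  cy : ∀ k, 0 ≤ s.cy k
  cyR : ∀ k, s.cy k ≤ c.RY
  D : ∀ k, 0 ≤ s.D k
  DR : ∀ k, s.D k ≤ c.RD
  r2 : ∀ k, 0 ≤ s.r2 k
  r2R : ∀ k, s.r2 k ≤ c.RR
  ev : ∀ k, 0 ≤ s.ev k
  G2 : ∀ k, 0 ≤ s.G2 k
  φ : ∀ i j, s.φ i - s.φ j ≤ c.Δ
  descent : ∀ k, 1 / 4 * s.P2 k + 1 / 2 * s.G2 k ≤ 1 / 2 * s.Q k + s.ev k + s.noiseDescent k
    + c.kC2 * (Real.log (s.v (k + 1)) - Real.log (s.v k))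
    + 1 / c.γx * (s.v k ^ c.α * (s.φ k - s.φ (k + 1))) + c.kA * (s.v k ^ (-c.α) * s.gx k)
  error : ∀ k, s.Q k ≤ 2 * c.L ^ 2 * (2 * (s.D k / c.N) + 8 * c.κ ^ 2 * s.r2 k)
    + 2 * c.L ^ 2 / c.N * (s.cx k + s.cy k)
  track : ∀ k, 5 / 8 * (c.γy * c.μ) * s.D k ≤ c.γy * c.μ / 8 * s.D (k + 1)
    + s.u k ^ c.β * (s.D k - s.D (k + 1)) + c.kC1 * s.r2 k
    + 2 * c.γy * (s.noiseTrack k + c.kC2 * (Real.log (s.u (k + 1)) - Real.log (s.u k))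
      + 4 / c.μ * s.eu k + e / 2 * (s.u k ^ c.β * s.cy k)
      + e⁻¹ / 2 * (s.u k ^ (-c.β) * s.Gy2 k) + c.kC3 * (s.cx k + s.cy k))
    + c.kC4 * (s.u k ^ (-c.β) * s.gy k)
  lag : ∀ k, c.θ / 2 * s.r2 k ≤ s.u k ^ c.β * (s.r2 k - s.r2 (k + 1))
    + c.kD1 * (s.v k ^ (-(2 * (c.α - c.β))) * (s.G2 k + s.ev k)) + s.noiseLag k
    + c.kD2 * (Real.log (s.v (k + 1)) - Real.log (s.v k)) + c.kD3 * (s.v k ^ (-c.α) * s.gx k)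
  meanX : ∀ k, (s.v k)⁻¹ * s.G2 k ≤ (s.v k)⁻¹ * s.gx k + s.noiseMeanX k
  meanY : ∀ k, s.u k ^ (-c.β) * s.Gy2 k ≤ s.u k ^ (-c.β) * s.gy k + s.noiseMeanY k
  consX : ∀ k, e * s.cx k ≤ s.cx k - s.cx (k + 1)
    + e⁻¹ * (c.kF * (s.v k ^ (-(2 * c.α)) * s.gx k))
  consY : ∀ k, e * s.cy k ≤ s.cy k - s.cy (k + 1)
    + e⁻¹ * (c.kF * (s.u k ^ (-(2 * c.β)) * s.gy k))
  evM : ∀ k, s.ev k ≤ c.kM * s.gx k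
  evG : ∀ k, s.ev k ≤ zv + c.kG * (e ^ (-c.α) * (s.v k ^ (-c.α) * s.gx k))
  euG : ∀ k, s.eu k ≤ zu + c.kG * (e⁻¹ * (s.u k ^ (-c.β) * s.gy k))

/-! ### Transient sums compared with the rate. -/

section bookkeeping

open Finset

variable (c : Consts) (hc : c.Ok)
include hc

set_option maxHeartbeats 1000000 in
/-- Bounds of the elementary transient sums by the rate. -/
lemma exists_elementary_bound : ∃ b, 0 ≤ b ∧ ∀ (e zv zu : ℝ) (s : Seqs) (K : ℕ),
    0 < e → e ≤ 1 → 1 ≤ K → e⁻¹ ^ 2 ≤ c.kE * (K : ℝ) ^ c.β → s.Ok c e zv zu →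
    Real.log (s.v K) - Real.log (s.v 0) ≤ b * rate c.α c.β e K ∧
    Real.log (s.u K) - Real.log (s.u 0) ≤ b * rate c.α c.β e K ∧
    s.v K ^ c.α ≤ b * rate c.α c.β e K ∧
    s.u K ^ c.β ≤ b * rate c.α c.β e K ∧
    e ^ (-c.α) * ∑ k ∈ range K, s.v k ^ (-c.α) * s.gx k ≤ b * rate c.α c.β e K ∧
    ∑ k ∈ range K, s.v k ^ (-c.α) * s.gx k ≤ b * rate c.α c.β e K ∧
    e⁻¹ * ∑ k ∈ range K, s.u k ^ (-c.β) * s.gy k ≤ b * rate c.α c.β e K ∧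
    ∑ k ∈ range K, s.u k ^ (-c.β) * s.gy k ≤ b * rate c.α c.β e K ∧
    ∑ k ∈ range K, (s.v k)⁻¹ * s.gx k ≤ b * rate c.α c.β e K ∧
    e⁻¹ ^ 2 * ∑ k ∈ range K, s.v k ^ (-(2 * c.α)) * s.gx k ≤ b * rate c.α c.β e K ∧
    e⁻¹ ^ 2 * ∑ k ∈ range K, s.u k ^ (-(2 * c.β)) * s.gy k ≤ b * rate c.α c.β e K ∧
    e⁻¹ ≤ b * rate c.α c.β e K ∧ 1 ≤ b * rate c.α c.β e K := by
  obtain ⟨hβ, hαβ, hα1⟩ : 0 < c.β ∧ c.β < c.α ∧ c.α < 1 := ⟨hc.β, hc.αβ, hc.α1⟩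
  have hc0 := hc.m0
  have hkV := hc.kV
  have hkH := hc.kH
  have hkE := hc.kE
  set l := 1 + |Real.log c.kV - Real.log c.m0| with hl
  set b1 := c.kV ^ c.α
  set b2 := c.kV ^ c.β
  set b3 := c.kH * (c.m0 ^ (1 - c.α) + c.kV ^ (1 - c.α))
  set b4 := c.kH * (c.m0 ^ (1 - c.β) + c.kV ^ (1 - c.β))
  set b5 := c.kE * (c.kH * (c.m0 ^ (1 - 2 * c.α) + c.kV ^ (1 - 2 * c.α)))
  set b6 := c.kE * (c.kH * (c.m0 ^ (1 - 2 * c.β) + c.kV ^ (1 - 2 * c.β)))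
  have hl0 : 0 ≤ l := by positivity
  have h1 : 0 ≤ b1 := by positivity
  have h2 : 0 ≤ b2 := by positivity
  have h3 : 0 ≤ b3 := by positivity
  have h4 : 0 ≤ b4 := by positivity
  have h5 : 0 ≤ b5 := by positivity
  have h6 : 0 ≤ b6 := by positivity
  refine ⟨1 + l + b1 + b2 + b3 + b4 + 2 * b5 + 2 * b6 + c.kH, by positivity, ?_⟩
  intro e zv zu s K he he1 hK hE hs
  obtain ⟨r1, r2, r3, r4, a0, a1, a2, a3, a4⟩ := rate_bounds (e := e) hβ hαβ hα1 he hK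
  set Θ := rate c.α c.β e K
  set l0 := 1 + Real.log K
  have hK1 : (1 : ℝ) ≤ K := by exact_mod_cast hK
  have hK0 : (0 : ℝ) < K := by linarith
  have hl00 : 0 ≤ l0 := by linarith
  have hie : 1 ≤ e⁻¹ := (one_le_inv₀ he).2 he1
  have hieα : 1 ≤ e ^ (-c.α) := by
    rw [Real.rpow_neg he.le]
    exact (one_le_inv₀ (by positivity)).2 (Real.rpow_le_one he.le he1 (by linarith))
  have q1 : l0 ≤ Θ := le_trans (by nlinarith) r1
  have qb : (K : ℝ) ^ c.β ≤ Θ := le_trans (by nlinarith) r3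
  have qa : (K : ℝ) ^ c.α ≤ Θ := le_trans (by nlinarith) r1
  have hΘ : 0 ≤ Θ := by linarith
  have qe : e⁻¹ ≤ Θ := by
    refine le_trans ?_ r4
    have : e⁻¹ ≤ e⁻¹ * (K : ℝ) ^ (1 - c.β) := le_mul_of_one_le_right (by positivity) a4
    nlinarith [mul_nonneg (by linarith : 0 ≤ l0 - 1) (by positivity : 0 ≤ e⁻¹ * (K : ℝ) ^ (1 - c.β))]
  have mk : ∀ {x y z : ℝ}, x ≤ y * Θ → y ≤ z → x ≤ z * Θ := fun h h' =>
    h.trans (mul_le_mul_of_nonneg_right h' hΘ)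
  have fx : ∀ q : ℝ, q ≤ 1 → c.m0 ^ (1 - q) + (c.kV * K) ^ (1 - q)
      ≤ (c.m0 ^ (1 - q) + c.kV ^ (1 - q)) * (K : ℝ) ^ (1 - q) := fun q hq => by
    rw [Real.mul_rpow hkV.le hK0.le]
    have : 1 ≤ (K : ℝ) ^ (1 - q) := Real.one_le_rpow hK1 (by linarith)
    have : 0 ≤ c.m0 ^ (1 - q) := by positivity
    nlinarith
  have sx : ∀ q : ℝ, ∑ k ∈ range K, s.v k ^ (-q) * s.gx k
      ≤ c.kH * l0 * (c.m0 ^ (1 - q) + (c.kV * K) ^ (1 - q)) :=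
    fun q => hs.v.sum_rpow_le hc0 q hK
  have sy : ∀ q : ℝ, ∑ k ∈ range K, s.u k ^ (-q) * s.gy k
      ≤ c.kH * l0 * (c.m0 ^ (1 - q) + (c.kV * K) ^ (1 - q)) :=
    fun q => hs.u.sum_rpow_le hc0 q hK
  have Sx0 : 0 ≤ ∑ k ∈ range K, s.v k ^ (-c.α) * s.gx k := sum_nonneg fun k _ =>
    mul_nonneg (Real.rpow_nonneg (hs.v.pos hc0 k).le _) (hs.v.nonneg k)
  have Sy0 : 0 ≤ ∑ k ∈ range K, s.u k ^ (-c.β) * s.gy k := sum_nonneg fun k _ =>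
    mul_nonneg (Real.rpow_nonneg (hs.u.pos hc0 k).le _) (hs.u.nonneg k)
  have tx : e ^ (-c.α) * ∑ k ∈ range K, s.v k ^ (-c.α) * s.gx k ≤ b3 * Θ := by
    calc _ ≤ e ^ (-c.α) * (c.kH * l0 * ((c.m0 ^ (1 - c.α) + c.kV ^ (1 - c.α))
          * (K : ℝ) ^ (1 - c.α))) := by
          gcongr; exact (sx c.α).trans (by gcongr; exact fx _ hα1.le)
      _ = b3 * (l0 * (e ^ (-c.α) * (K : ℝ) ^ (1 - c.α))) := by ring
      _ ≤ _ := mul_le_mul_of_nonneg_left r2 h3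
  have ty : e⁻¹ * ∑ k ∈ range K, s.u k ^ (-c.β) * s.gy k ≤ b4 * Θ := by
    calc _ ≤ e⁻¹ * (c.kH * l0 * ((c.m0 ^ (1 - c.β) + c.kV ^ (1 - c.β))
          * (K : ℝ) ^ (1 - c.β))) := by
          gcongr; exact (sy c.β).trans (by gcongr; exact fx _ (by linarith))
      _ = b4 * (l0 * (e⁻¹ * (K : ℝ) ^ (1 - c.β))) := by ring
      _ ≤ _ := mul_le_mul_of_nonneg_left r4 h4
  -- After `e⁻²` has become `K ^ β`: for `q ≥ β` one has `K ^ β K ^ (1 - 2q) ≤ K ^ (1 - β)`, and the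
  -- constant part is paid by the term `K ^ β` of the rate.
  have two : ∀ q : ℝ, c.β ≤ q → l0 * (e⁻¹ * (K : ℝ) ^ (1 - c.β)) ≤ Θ →
      (K : ℝ) ^ c.β * (c.m0 ^ (1 - 2 * q) + (c.kV * K) ^ (1 - 2 * q)) * l0
        ≤ 2 * (c.m0 ^ (1 - 2 * q) + c.kV ^ (1 - 2 * q)) * Θ := fun q hq hr => by
    have w1 : (K : ℝ) ^ c.β * (K : ℝ) ^ (1 - 2 * q) ≤ (K : ℝ) ^ (1 - c.β) := by
      rw [← Real.rpow_add hK0]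
      exact Real.rpow_le_rpow_of_exponent_le hK1 (by linarith)
    have w2 : (K : ℝ) ^ (1 - c.β) ≤ e⁻¹ * (K : ℝ) ^ (1 - c.β) :=
      le_mul_of_one_le_left (by positivity) hie
    have w3 : l0 * ((K : ℝ) ^ c.β * (K : ℝ) ^ (1 - 2 * q)) ≤ Θ :=
      (mul_le_mul_of_nonneg_left (w1.trans w2) hl00).trans hr
    have w4 : l0 * (K : ℝ) ^ c.β ≤ Θ := r3
    rw [Real.mul_rpow hkV.le hK0.le]
    have u1 : 0 ≤ c.m0 ^ (1 - 2 * q) := by positivity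
    have u2 : 0 ≤ c.kV ^ (1 - 2 * q) := by positivity
    have e1 := mul_le_mul_of_nonneg_left w4 u1
    have e2 := mul_le_mul_of_nonneg_left w3 u2
    have e3 := mul_nonneg u1 hΘ
    have e4 := mul_nonneg u2 hΘ
    linarith
  have kvpos : ∀ q : ℝ, 0 ≤ c.kH * l0 * (c.m0 ^ (1 - q) + (c.kV * K) ^ (1 - q)) := fun q => by
    positivity
  refine ⟨?_, ?_, ?_, ?_, ?_, ?_, ?_, ?_, ?_, ?_, ?_, ?_, ?_⟩
  · refine mk ((hs.v.log_le hc0 hK).trans (mul_le_mul_of_nonneg_left q1 hl0)) (by linarith)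
  · refine mk ((hs.u.log_le hc0 hK).trans (mul_le_mul_of_nonneg_left q1 hl0)) (by linarith)
  · refine mk ((hs.v.rpow_le hc0 (by linarith) hK).trans (mul_le_mul_of_nonneg_left qa h1))
      (by linarith)
  · refine mk ((hs.u.rpow_le hc0 (by linarith) hK).trans (mul_le_mul_of_nonneg_left qb h2))
      (by linarith)
  · exact mk tx (by linarith)
  · exact mk ((le_mul_of_one_le_left Sx0 hieα).trans tx) (by linarith)
  · exact mk ty (by linarith)
  · exact mk ((le_mul_of_one_le_left Sy0 hie).trans ty) (by linarith)
  · have := hs.v.sum_le K hK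
    simp only [mul_comm (s.gx _)] at this
    exact mk (this.trans (mul_le_mul_of_nonneg_left q1 hkH)) (by linarith)
  · refine mk (y := 2 * b5) ?_ (by linarith)
    calc _ ≤ c.kE * (K : ℝ) ^ c.β * (c.kH * l0 * (c.m0 ^ (1 - 2 * c.α)
          + (c.kV * K) ^ (1 - 2 * c.α))) :=
          mul_le_mul hE (sx (2 * c.α)) (sum_nonneg fun k _ =>
            mul_nonneg (Real.rpow_nonneg (hs.v.pos hc0 k).le _) (hs.v.nonneg k)) (by positivity)
      _ = c.kE * c.kH * ((K : ℝ) ^ c.β * (c.m0 ^ (1 - 2 * c.α)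
          + (c.kV * K) ^ (1 - 2 * c.α)) * l0) := by ring
      _ ≤ c.kE * c.kH * (2 * (c.m0 ^ (1 - 2 * c.α) + c.kV ^ (1 - 2 * c.α)) * Θ) := by
          gcongr ?_ * ?_; exact two c.α hαβ.le r4
      _ = _ := by ring
  · refine mk (y := 2 * b6) ?_ (by linarith)
    calc _ ≤ c.kE * (K : ℝ) ^ c.β * (c.kH * l0 * (c.m0 ^ (1 - 2 * c.β)
          + (c.kV * K) ^ (1 - 2 * c.β))) :=
          mul_le_mul hE (sy (2 * c.β)) (sum_nonneg fun k _ =>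
            mul_nonneg (Real.rpow_nonneg (hs.u.pos hc0 k).le _) (hs.u.nonneg k)) (by positivity)
      _ = c.kE * c.kH * ((K : ℝ) ^ c.β * (c.m0 ^ (1 - 2 * c.β)
          + (c.kV * K) ^ (1 - 2 * c.β)) * l0) := by ring
      _ ≤ c.kE * c.kH * (2 * (c.m0 ^ (1 - 2 * c.β) + c.kV ^ (1 - 2 * c.β)) * Θ) := by
          gcongr ?_ * ?_; exact two c.β le_rfl r4
      _ = _ := by ring
  · exact mk (y := 1) (by linarith) (by linarith)
  · exact mk (y := 1) (by linarith) (by linarith)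

end bookkeeping

/-! ### Summed sequences and their elimination. -/

section summation

open Finset

variable {c : Consts} {e zv zu : ℝ} {s : Seqs} {K : ℕ}

/-- One factor `e⁻¹` comes from summing the contraction, the other from the perturbation of a single
step. -/
lemma Seqs.Ok.sum_cx_le (he : 0 < e) (hs : s.Ok c e zv zu) (K : ℕ) :
    ∑ k ∈ range K, s.cx k
      ≤ c.RX * e⁻¹ + c.kF * (e⁻¹ ^ 2 * ∑ k ∈ range K, s.v k ^ (-(2 * c.α)) * s.gx k) := by
  have h := sum_le_sum fun k (_ : k ∈ range K) => hs.consX k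
  rw [sum_add_distrib, ← mul_sum, ← mul_sum, ← mul_sum, sum_range_sub'] at h
  have h1 := hs.cx0
  have h2 := hs.cx K
  have h3 : ∑ k ∈ range K, s.cx k = e⁻¹ * (e * ∑ k ∈ range K, s.cx k) := by
    rw [← mul_assoc, inv_mul_cancel₀ he.ne', one_mul]
  rw [h3]
  have h4 : 0 ≤ e⁻¹ := by positivity
  have h5 := mul_le_mul_of_nonneg_left
    (h.trans (add_le_add_left (by linarith : s.cx 0 - s.cx K ≤ c.RX) _)) h4
  linarith

lemma Seqs.Ok.sum_cy_le (he : 0 < e) (hs : s.Ok c e zv zu) (K : ℕ) :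
    ∑ k ∈ range K, s.cy k
      ≤ c.RY * e⁻¹ + c.kF * (e⁻¹ ^ 2 * ∑ k ∈ range K, s.u k ^ (-(2 * c.β)) * s.gy k) := by
  have h := sum_le_sum fun k (_ : k ∈ range K) => hs.consY k
  rw [sum_add_distrib, ← mul_sum, ← mul_sum, ← mul_sum, sum_range_sub'] at h
  have h1 := hs.cyR 0
  have h2 := hs.cy K
  have h3 : ∑ k ∈ range K, s.cy k = e⁻¹ * (e * ∑ k ∈ range K, s.cy k) := by
    rw [← mul_assoc, inv_mul_cancel₀ he.ne', one_mul]
  rw [h3]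
  have h4 : 0 ≤ e⁻¹ := by positivity
  have h5 := mul_le_mul_of_nonneg_left
    (h.trans (add_le_add_left (by linarith : s.cy 0 - s.cy K ≤ c.RY) _)) h4
  linarith

lemma Accum.monotone_rpow {m kV kH q : ℝ} {v g : ℕ → ℝ} (hm : 0 < m) (h : Accum m kV kH v g)
    (hq : 0 ≤ q) : Monotone fun k => v k ^ q := fun _ _ hij =>
  Real.rpow_le_rpow (h.pos hm _).le (h.mono hij) hq

/-- The consensus recursion multiplied by `u ^ β`. It controls the term `e u ^ β cy` of the tracking
inequality with only one factor `e⁻¹`. -/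
lemma Seqs.Ok.sum_weighted_cy_le (hc : c.Ok) (hs : s.Ok c e zv zu) (K : ℕ) :
    e * ∑ k ∈ range K, s.u k ^ c.β * s.cy k
      ≤ c.RY * s.u K ^ c.β + c.kF * (e⁻¹ * ∑ k ∈ range K, s.u k ^ (-c.β) * s.gy k) := by
  have hpos := hs.u.pos hc.m0
  have h1 := sum_weight_mul_sub_le (hs.u.monotone_rpow hc.m0 hc.β.le)
    (fun k => Real.rpow_nonneg (hpos k).le _) (φ := s.cy) (Δ := c.RY)
    (fun i j => by linarith [hs.cyR i, hs.cy j]) K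
  refine le_trans ?_ (add_le_add_left h1 _)
  rw [mul_sum, mul_sum, mul_sum, ← sum_add_distrib]
  refine sum_le_sum fun k _ => ?_
  have h2 : s.u k ^ c.β * s.u k ^ (-(2 * c.β)) = s.u k ^ (-c.β) := by
    rw [← Real.rpow_add (hpos k)]; congr 1; ring
  have h3 := mul_le_mul_of_nonneg_left (hs.consY k) (Real.rpow_nonneg (hpos k).le c.β)
  rw [← h2]
  linarith

/-- The factor `v ^ (-2(α - β))` is split by `hε`. The part with `ε` keeps `G2` and `ev`, to be
absorbed by the descent; only in the part with `v⁻¹` is the mean gradient exchanged for the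
stochastic one. -/
lemma Seqs.Ok.sum_lag_le (hc : c.Ok) (hs : s.Ok c e zv zu) {ε Kε : ℝ}
    (hε : ∀ v, c.m0 ≤ v → v ^ (-(2 * (c.α - c.β))) ≤ ε + Kε * v⁻¹) (hKε : 0 ≤ Kε) (K : ℕ) :
    c.θ / 2 * ∑ k ∈ range K, s.r2 k ≤ c.RR * s.u K ^ c.β
      + c.kD1 * (ε * (∑ k ∈ range K, s.G2 k + ∑ k ∈ range K, s.ev k)
        + Kε * ((1 + c.kM) * ∑ k ∈ range K, (s.v k)⁻¹ * s.gx k + ∑ k ∈ range K, s.noiseMeanX k))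
      + ∑ k ∈ range K, s.noiseLag k + c.kD2 * (Real.log (s.v K) - Real.log (s.v 0))
      + c.kD3 * ∑ k ∈ range K, s.v k ^ (-c.α) * s.gx k := by
  have hpos := hs.u.pos hc.m0
  have hposv := hs.v.pos hc.m0
  have h1 := sum_weight_mul_sub_le (hs.u.monotone_rpow hc.m0 hc.β.le)
    (fun k => Real.rpow_nonneg (hpos k).le _) (φ := s.r2) (Δ := c.RR)
    (fun i j => by linarith [hs.r2R i, hs.r2 j]) K
  have h2 : ∀ k, c.θ / 2 * s.r2 k ≤ s.u k ^ c.β * (s.r2 k - s.r2 (k + 1))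
      + c.kD1 * (ε * (s.G2 k + s.ev k)
        + Kε * ((1 + c.kM) * ((s.v k)⁻¹ * s.gx k) + s.noiseMeanX k)) + s.noiseLag k
      + c.kD2 * (Real.log (s.v (k + 1)) - Real.log (s.v k))
      + c.kD3 * (s.v k ^ (-c.α) * s.gx k) := fun k => by
    have a1 := hs.lag k
    have a2 := mul_le_mul_of_nonneg_right (hε _ (hs.v.lower k)) (add_nonneg (hs.G2 k) (hs.ev k))
    have a3 : 0 < (s.v k)⁻¹ := inv_pos.2 (hposv k)
    have a4 := hs.meanX k
    have a5 := mul_le_mul_of_nonneg_left (hs.evM k) a3.le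
    have a6 : (s.v k)⁻¹ * (s.G2 k + s.ev k)
        ≤ (1 + c.kM) * ((s.v k)⁻¹ * s.gx k) + s.noiseMeanX k := by linarith
    have a7 := mul_le_mul_of_nonneg_left a6 hKε
    have a8 := mul_le_mul_of_nonneg_left (a2.trans (by linarith :
      _ ≤ ε * (s.G2 k + s.ev k) + Kε * ((1 + c.kM) * ((s.v k)⁻¹ * s.gx k) + s.noiseMeanX k))) hc.kD1
    linarith
  have h := sum_le_sum fun k (_ : k ∈ range K) => h2 k
  simp only [sum_add_distrib, ← mul_sum] at h
  rw [sum_range_sub (fun k => Real.log (s.v k))] at h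
  linarith

/-- The shifted errors `D (k + 1)` use up `1/8` of the coefficient `5/8`, apart from one boundary
term. -/
lemma Seqs.Ok.sum_track_le (hc : c.Ok) (hs : s.Ok c e zv zu) (K : ℕ) :
    c.γy * c.μ / 2 * ∑ k ∈ range K, s.D k ≤ c.γy * c.μ / 8 * c.RD + c.RD * s.u K ^ c.β
      + c.kC1 * ∑ k ∈ range K, s.r2 k
      + 2 * c.γy * (∑ k ∈ range K, s.noiseTrack k + c.kC2 * (Real.log (s.u K) - Real.log (s.u 0))
        + 4 / c.μ * ∑ k ∈ range K, s.eu k + 1 / 2 * (e * ∑ k ∈ range K, s.u k ^ c.β * s.cy k)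
        + e⁻¹ / 2 * ∑ k ∈ range K, s.u k ^ (-c.β) * s.Gy2 k
        + c.kC3 * (∑ k ∈ range K, s.cx k + ∑ k ∈ range K, s.cy k))
      + c.kC4 * ∑ k ∈ range K, s.u k ^ (-c.β) * s.gy k := by
  have hpos := hs.u.pos hc.m0
  have h1 := sum_weight_mul_sub_le (hs.u.monotone_rpow hc.m0 hc.β.le)
    (fun k => Real.rpow_nonneg (hpos k).le _) (φ := s.D) (Δ := c.RD)
    (fun i j => by linarith [hs.DR i, hs.D j]) K
  have h2 : ∑ k ∈ range K, s.D (k + 1) ≤ ∑ k ∈ range K, s.D k + c.RD := by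
    have := sum_range_succ' s.D K
    rw [sum_range_succ] at this
    linarith [hs.D 0, hs.DR K]
  have h := sum_le_sum fun k (_ : k ∈ range K) => hs.track k
  simp only [sum_add_distrib, ← mul_sum] at h
  rw [sum_range_sub (fun k => Real.log (s.u k))] at h
  have h3 := mul_le_mul_of_nonneg_left h2 (by have := hc.γy; have := hc.μ; positivity :
    0 ≤ c.γy * c.μ / 8)
  linarith

lemma Seqs.Ok.sum_descent_le (hc : c.Ok) (hs : s.Ok c e zv zu) (K : ℕ) :
    1 / 4 * ∑ k ∈ range K, s.P2 k + 1 / 2 * ∑ k ∈ range K, s.G2 k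
      ≤ 1 / 2 * ∑ k ∈ range K, s.Q k + ∑ k ∈ range K, s.ev k + ∑ k ∈ range K, s.noiseDescent k
      + c.kC2 * (Real.log (s.v K) - Real.log (s.v 0)) + 1 / c.γx * (c.Δ * s.v K ^ c.α)
      + c.kA * ∑ k ∈ range K, s.v k ^ (-c.α) * s.gx k := by
  have hpos := hs.v.pos hc.m0
  have h1 := sum_weight_mul_sub_le (hs.v.monotone_rpow hc.m0 (hc.β.trans hc.αβ).le)
    (fun k => Real.rpow_nonneg (hpos k).le _) hs.φ K
  have h := sum_le_sum fun k (_ : k ∈ range K) => hs.descent k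
  simp only [sum_add_distrib, ← mul_sum] at h
  rw [sum_range_sub (fun k => Real.log (s.v k))] at h
  have h3 := mul_le_mul_of_nonneg_left h1 (by have := hc.γx; positivity : 0 ≤ 1 / c.γx)
  linarith

lemma Seqs.Ok.sum_Q_le (hs : s.Ok c e zv zu) (K : ℕ) :
    ∑ k ∈ range K, s.Q k ≤ 4 * (c.L ^ 2 / c.N) * ∑ k ∈ range K, s.D k
      + 16 * c.L ^ 2 * c.κ ^ 2 * ∑ k ∈ range K, s.r2 k
      + 2 * (c.L ^ 2 / c.N) * (∑ k ∈ range K, s.cx k + ∑ k ∈ range K, s.cy k) := by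
  simp only [mul_sum, ← sum_add_distrib]
  refine sum_le_sum fun k _ => (hs.error k).trans (le_of_eq ?_)
  ring

lemma Seqs.Ok.sum_ev_le (hs : s.Ok c e zv zu) (K : ℕ) :
    ∑ k ∈ range K, s.ev k
      ≤ K * zv + c.kG * (e ^ (-c.α) * ∑ k ∈ range K, s.v k ^ (-c.α) * s.gx k) := by
  have h := sum_le_sum fun k (_ : k ∈ range K) => hs.evG k
  simpa only [sum_add_distrib, ← mul_sum, sum_const, card_range, nsmul_eq_mul] using h

lemma Seqs.Ok.sum_eu_le (hs : s.Ok c e zv zu) (K : ℕ) :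
    ∑ k ∈ range K, s.eu k
      ≤ K * zu + c.kG * (e⁻¹ * ∑ k ∈ range K, s.u k ^ (-c.β) * s.gy k) := by
  have h := sum_le_sum fun k (_ : k ∈ range K) => hs.euG k
  simpa only [sum_add_distrib, ← mul_sum, sum_const, card_range, nsmul_eq_mul] using h

lemma Seqs.Ok.sum_meanY_le (hs : s.Ok c e zv zu) (K : ℕ) :
    ∑ k ∈ range K, s.u k ^ (-c.β) * s.Gy2 k
      ≤ ∑ k ∈ range K, s.u k ^ (-c.β) * s.gy k + ∑ k ∈ range K, s.noiseMeanY k := by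
  rw [← sum_add_distrib]
  exact sum_le_sum fun k _ => hs.meanY k

set_option maxHeartbeats 1000000 in
/-- The one-step inequalities bound the sum of the squared gradients of `Φ`, up to noise. -/
theorem exists_sum_bound (c : Consts) (hc : c.Ok) :
    ∃ B q3 q4 q5 q6 : ℝ, 0 ≤ B ∧ ∀ (e zv zu : ℝ) (s : Seqs) (K : ℕ),
    0 < e → e ≤ 1 → 1 ≤ K → e⁻¹ ^ 2 ≤ c.kE * (K : ℝ) ^ c.β → s.Ok c e zv zu →
    ∑ k ∈ range K, s.P2 k ≤ B * rate c.α c.β e K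
      + K * (6 * zv + 128 * (c.L ^ 2 / (c.N * c.μ ^ 2)) * zu)
      + 4 * ∑ k ∈ range K, s.noiseDescent k + q3 * ∑ k ∈ range K, s.noiseTrack k
      + q4 * ∑ k ∈ range K, s.noiseLag k
      + q5 * (e⁻¹ * ∑ k ∈ range K, s.noiseMeanY k) + q6 * ∑ k ∈ range K, s.noiseMeanX k := by
  obtain ⟨b, hb, hel⟩ := exists_elementary_bound c hc
  have hγy := hc.γy
  have hμ := hc.μ
  have hN := hc.N
  have hθ := hc.θ
  have hγx := hc.γx
  have := hc.kC1
  have := hc.kC2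
  have := hc.kC3
  have := hc.kC4
  have := hc.kD1
  have := hc.kD2
  have := hc.kD3
  have := hc.kA
  have := hc.kF
  have := hc.kM
  have := hc.kG
  have := hc.RX
  have := hc.RY
  have := hc.RD
  have := hc.RR
  have := hc.Δ
  obtain ⟨l, hl⟩ : ∃ l, l = c.L ^ 2 / c.N := ⟨_, rfl⟩
  have hl0 : 0 ≤ l := by rw [hl]; positivity
  obtain ⟨g, hg⟩ : ∃ g, g = 2 / (c.γy * c.μ) := ⟨_, rfl⟩
  have hg0 : 0 ≤ g := by rw [hg]; positivity
  -- `g` inverts the coefficient of `∑ D`, and `w` is the total coefficient of `∑ r2` once `∑ D` is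
  -- eliminated, divided by `θ / 2`.
  obtain ⟨w, hw⟩ : ∃ w, w = (2 * l * (g * c.kC1) + 8 * c.L ^ 2 * c.κ ^ 2) * (2 / c.θ) := ⟨_, rfl⟩
  have hw0 : 0 ≤ w := by rw [hw]; positivity
  -- Small enough that the mean gradients returning through the lag cost at most the `1/2 ∑ G2`
  -- supplied by the descent.
  obtain ⟨ε, hε⟩ : ∃ ε, ε = 1 / (2 * (w * c.kD1 + 1)) := ⟨_, rfl⟩
  have hε0 : 0 < ε := by rw [hε]; positivity
  have hwε : w * (c.kD1 * ε) ≤ 1 / 2 := by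
    rw [hε, ← mul_assoc, mul_one_div, div_le_div_iff₀ (by positivity) (by positivity)]
    nlinarith
  obtain ⟨Kε, hKε0, hKε⟩ := exists_rpow_neg_le_add_inv hc.m0
    (by linarith [hc.αβ] : 0 < 2 * (c.α - c.β)) hε0
  obtain ⟨B2, hB2⟩ : ∃ B2, B2 = (c.RR + c.kD1 * (Kε * (1 + c.kM)) + c.kD2 + c.kD3) * b := ⟨_, rfl⟩
  have hB20 : 0 ≤ B2 := by rw [hB2]; positivity
  obtain ⟨B3, hB3⟩ : ∃ B3, B3 = (c.γy * c.μ / 8 * c.RD + c.RD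
    + 2 * c.γy * (c.kC2 + 4 / c.μ * c.kG + 1 / 2 * (c.RY + c.kF) + 1 / 2
      + c.kC3 * (c.RX + c.RY + 2 * c.kF)) + c.kC4) * b := ⟨_, rfl⟩
  have hB30 : 0 ≤ B3 := by rw [hB3]; positivity
  obtain ⟨B1, hB1⟩ : ∃ B1, B1 = (l * (c.RX + c.RY + 2 * c.kF) + 3 / 2 * c.kG + c.kC2
    + 1 / c.γx * c.Δ + c.kA) * b := ⟨_, rfl⟩
  have hB10 : 0 ≤ B1 := by rw [hB1]; positivity
  refine ⟨4 * (B1 + 2 * l * (g * B3) + w * B2), 4 * (2 * l * (g * (2 * c.γy))), 4 * w,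
    4 * (2 * l * (g * c.γy)), 4 * (w * (c.kD1 * Kε)), by positivity, ?_⟩
  intro e zv zu s K he he1 hK hE hs
  obtain ⟨t1, t2, t3, t4, t5, t6, t7, t8, t9, t10, t11, t12, t13⟩ :=
    hel e zv zu s K he he1 hK hE hs
  have hie : 0 < e⁻¹ := inv_pos.2 he
  have k1 := hs.sum_cx_le he K
  have k2 := hs.sum_cy_le he K
  have k3 := hs.sum_weighted_cy_le hc K
  have k4 := hs.sum_lag_le hc hKε hKε0 K
  have k5 := hs.sum_track_le hc K
  have k6 := hs.sum_descent_le hc K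
  have k7 := hs.sum_Q_le K
  have k8 := hs.sum_ev_le K
  have k9 := hs.sum_eu_le K
  have k10 := mul_le_mul_of_nonneg_left (hs.sum_meanY_le K) hie.le
  have hG0 : 0 ≤ ∑ k ∈ range K, s.G2 k := sum_nonneg fun k _ => hs.G2 k
  have hev0 : 0 ≤ ∑ k ∈ range K, s.ev k := sum_nonneg fun k _ => hs.ev k
  rw [← hl] at k7
  have el : c.L ^ 2 / (c.N * c.μ ^ 2) = l / c.μ ^ 2 := by rw [hl]; field_simp
  rw [el]
  -- From here on the argument is elimination among finitely many numbers, so the sums become atoms.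
  generalize rate c.α c.β e K = Θ at *
  generalize ∑ k ∈ range K, s.cx k = Scx at *
  generalize ∑ k ∈ range K, s.cy k = Scy at *
  generalize ∑ k ∈ range K, s.G2 k = SG at *
  generalize ∑ k ∈ range K, s.P2 k = SP at *
  generalize ∑ k ∈ range K, s.ev k = Sev at *
  generalize ∑ k ∈ range K, s.eu k = Seu at *
  generalize ∑ k ∈ range K, s.Q k = SQ at *
  generalize ∑ k ∈ range K, s.D k = SD at *
  generalize ∑ k ∈ range K, s.r2 k = Sr at *
  generalize ∑ k ∈ range K, s.noiseDescent k = S1 at *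
  generalize ∑ k ∈ range K, s.noiseTrack k = S3 at *
  generalize ∑ k ∈ range K, s.noiseLag k = S4 at *
  generalize ∑ k ∈ range K, s.noiseMeanY k = S5 at *
  generalize ∑ k ∈ range K, s.noiseMeanX k = S6 at *
  generalize ∑ k ∈ range K, s.v k ^ (-(2 * c.α)) * s.gx k = X1 at *
  generalize ∑ k ∈ range K, s.u k ^ (-(2 * c.β)) * s.gy k = X2 at *
  generalize ∑ k ∈ range K, s.u k ^ (-c.β) * s.gy k = X3 at *
  generalize ∑ k ∈ range K, s.v k ^ (-c.α) * s.gx k = X4 at *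
  generalize ∑ k ∈ range K, (s.v k)⁻¹ * s.gx k = X5 at *
  generalize ∑ k ∈ range K, s.u k ^ c.β * s.cy k = X6 at *
  generalize ∑ k ∈ range K, s.u k ^ (-c.β) * s.Gy2 k = X7 at *
  generalize Real.log (s.v K) - Real.log (s.v 0) = X8 at *
  generalize Real.log (s.u K) - Real.log (s.u 0) = X9 at *
  generalize s.v K ^ c.α = X10 at *
  generalize s.u K ^ c.β = X11 at *
  have m1 : Scx ≤ (c.RX + c.kF) * (b * Θ) := k1.trans (by rw [add_mul]; gcongr)
  have m2 : Scy ≤ (c.RY + c.kF) * (b * Θ) := k2.trans (by rw [add_mul]; gcongr)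
  have m3 : e * X6 ≤ (c.RY + c.kF) * (b * Θ) := k3.trans (by rw [add_mul]; gcongr)
  have m4 : Sev ≤ K * zv + c.kG * (b * Θ) := k8.trans (by gcongr)
  have m5 : Seu ≤ K * zu + c.kG * (b * Θ) := k9.trans (by gcongr)
  have m6 : e⁻¹ / 2 * X7 ≤ 1 / 2 * (b * Θ + e⁻¹ * S5) := by linarith
  have m7 : c.θ / 2 * Sr ≤ B2 * Θ + c.kD1 * (ε * (SG + Sev)) + c.kD1 * Kε * S6 + S4 := by
    have a1 := mul_le_mul_of_nonneg_left t4 hc.RR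
    have a2 := mul_le_mul_of_nonneg_left t9 (by positivity : 0 ≤ c.kD1 * (Kε * (1 + c.kM)))
    have a3 := mul_le_mul_of_nonneg_left t1 hc.kD2
    have a4 := mul_le_mul_of_nonneg_left t6 hc.kD3
    rw [hB2]
    linarith
  have m8 : Sr ≤ 2 / c.θ * (B2 * Θ + c.kD1 * (ε * (SG + Sev)) + c.kD1 * Kε * S6 + S4) := by
    have := mul_le_mul_of_nonneg_left m7 (by positivity : 0 ≤ 2 / c.θ)
    have e1 : 2 / c.θ * (c.θ / 2 * Sr) = Sr := by field_simp
    rwa [e1] at this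
  have m9 : c.γy * c.μ / 2 * SD ≤ B3 * Θ + c.kC1 * Sr + 2 * c.γy * S3
      + 2 * c.γy * (4 / c.μ) * (K * zu) + c.γy * (e⁻¹ * S5) := by
    have a1 := mul_le_mul_of_nonneg_left t13 (by positivity : 0 ≤ c.γy * c.μ / 8 * c.RD)
    have a2 := mul_le_mul_of_nonneg_left t4 hc.RD
    have a3 := mul_le_mul_of_nonneg_left t2 hc.kC2
    have a4 := mul_le_mul_of_nonneg_left m5 (by positivity : 0 ≤ 4 / c.μ)
    have a5 := mul_le_mul_of_nonneg_left (add_le_add m1 m2) hc.kC3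
    have a6 := mul_le_mul_of_nonneg_left t8 hc.kC4
    have a7 := mul_le_mul_of_nonneg_left
      (add_le_add (add_le_add (add_le_add (add_le_add (add_le_add (le_refl S3) a3) a4)
        (mul_le_mul_of_nonneg_left m3 (by norm_num : (0 : ℝ) ≤ 1 / 2))) m6) a5)
      (by positivity : 0 ≤ 2 * c.γy)
    rw [hB3]
    linarith
  have m10 : SD ≤ g * (B3 * Θ + c.kC1 * Sr + 2 * c.γy * S3
      + 2 * c.γy * (4 / c.μ) * (K * zu) + c.γy * (e⁻¹ * S5)) := by
    have := mul_le_mul_of_nonneg_left m9 hg0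
    have e1 : g * (c.γy * c.μ / 2 * SD) = SD := by rw [hg]; field_simp
    rwa [e1] at this
  have e2 : g * (2 * c.γy * (4 / c.μ) * (K * zu)) = 16 * (K * zu) / c.μ ^ 2 := by
    rw [hg]; field_simp; ring
  have m11 : 2 * l * SD + 8 * c.L ^ 2 * c.κ ^ 2 * Sr ≤ 2 * l * (g * B3) * Θ
      + w * (B2 * Θ + c.kD1 * (ε * (SG + Sev)) + c.kD1 * Kε * S6 + S4)
      + 2 * l * (g * (2 * c.γy)) * S3 + 2 * l * (16 * (K * zu) / c.μ ^ 2)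
      + 2 * l * (g * c.γy) * (e⁻¹ * S5) := by
    have a1 := mul_le_mul_of_nonneg_left m10 (by positivity : 0 ≤ 2 * l)
    have a2 := mul_le_mul_of_nonneg_left m8
      (by positivity : 0 ≤ 2 * l * (g * c.kC1) + 8 * c.L ^ 2 * c.κ ^ 2)
    rw [← e2, hw]
    linarith
  have m12 : w * (c.kD1 * (ε * (SG + Sev))) ≤ 1 / 2 * (SG + Sev) := by
    have := mul_le_mul_of_nonneg_right hwε (add_nonneg hG0 hev0)
    linarith
  have m13 : 1 / 2 * SQ ≤ 2 * l * SD + 8 * c.L ^ 2 * c.κ ^ 2 * Sr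
      + l * ((c.RX + c.RY + 2 * c.kF) * (b * Θ)) := by
    have a1 := mul_le_mul_of_nonneg_left (add_le_add m1 m2) hl0
    linarith
  -- `1/2 SG` cancels. `Sev` occurs with `1` from the descent and `1/2` from the lag, hence `6 zv`
  -- after multiplication by `4`; the dual mismatch gives `4 · 2 · 16 = 128`.
  have m14 : 1 / 4 * SP ≤ B1 * Θ + 3 / 2 * (K * zv) + 2 * l * (g * B3) * Θ
      + w * (B2 * Θ + c.kD1 * Kε * S6 + S4)
      + 2 * l * (g * (2 * c.γy)) * S3 + 2 * l * (16 * (K * zu) / c.μ ^ 2)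
      + 2 * l * (g * c.γy) * (e⁻¹ * S5) + S1 := by
    have a1 := mul_le_mul_of_nonneg_left t1 hc.kC2
    have a2 := mul_le_mul_of_nonneg_left (mul_le_mul_of_nonneg_left t3 hc.Δ)
      (by positivity : 0 ≤ 1 / c.γx)
    have a3 := mul_le_mul_of_nonneg_left t6 hc.kA
    rw [hB1]
    linarith
  have e3 : 2 * l * (16 * (K * zu) / c.μ ^ 2) = K * (32 * (l / c.μ ^ 2) * zu) := by ring
  rw [e3] at m14
  linarith

end summation

/-! ### Entrywise products -/

/-- Entrywise product of a coefficient vector and a vector. -/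
noncomputable def had {m : ℕ} (a : Fin m → ℝ) (g : Vec m) : Vec m := WithLp.toLp 2 fun j => a j * g j

section had

variable {m : ℕ}

lemma had_add (a b : Fin m → ℝ) (g : Vec m) : had (fun j => a j + b j) g = had a g + had b g := by
  ext j; simp [had, add_mul]

lemma had_const (t : ℝ) (g : Vec m) : had (fun _ => t) g = t • g := by
  ext j; simp [had]

lemma norm_had_sq (a : Fin m → ℝ) (g : Vec m) : ‖had a g‖ ^ 2 = ∑ j, a j ^ 2 * g j ^ 2 := by
  rw [EuclideanSpace.real_norm_sq_eq]
  simp [had, mul_pow]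

lemma norm_had_sq_le {a : Fin m → ℝ} {b : ℝ} (h : ∀ j, |a j| ≤ b) (g : Vec m) :
    ‖had a g‖ ^ 2 ≤ b ^ 2 * ‖g‖ ^ 2 := by
  rw [norm_had_sq, EuclideanSpace.real_norm_sq_eq, Finset.mul_sum]
  refine Finset.sum_le_sum fun j _ => mul_le_mul_of_nonneg_right ?_ (sq_nonneg _)
  rw [← sq_abs]
  exact pow_le_pow_left₀ (abs_nonneg _) (h j) 2

lemma norm_had_le {a : Fin m → ℝ} {b : ℝ} (hb : 0 ≤ b) (h : ∀ j, |a j| ≤ b) (g : Vec m) :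
    ‖had a g‖ ≤ b * ‖g‖ := by
  refine le_of_sq_le_sq ?_ (by positivity)
  rw [mul_pow]
  exact norm_had_sq_le h g

lemma norm_had_sq_le_sum (a : Fin m → ℝ) (g : Vec m) : ‖had a g‖ ^ 2 ≤ (∑ j, a j ^ 2) * ‖g‖ ^ 2 := by
  rw [norm_had_sq, Finset.sum_mul]
  refine Finset.sum_le_sum fun j _ => mul_le_mul_of_nonneg_left ?_ (sq_nonneg _)
  rw [EuclideanSpace.real_norm_sq_eq]
  exact Finset.single_le_sum (f := fun j => g j ^ 2) (fun j _ => sq_nonneg _) (Finset.mem_univ j)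

end had

/-! ### Inconsistency of the stepsizes -/

section inconsistency

variable {n q : ℕ} {M : Fin n → Fin q → ℝ} {a t m D C Z : ℝ}

/-- One entry is bounded by the Frobenius norm, so a finite `ζ` keeps every local stepsize within a
fixed multiple of the reference. -/
lemma rpow_neg_le_of_incons_le (hn : 0 < n) (hq : 0 < q) (hM : 0 < avg M)
    (h : incons a M ≤ Z) (i : Fin n) (j : Fin q) :
    M i j ^ (-a) ≤ (1 + Real.sqrt (n * q * Z)) * avg M ^ (-a) := by
  have hA : 0 < avg M ^ (-a) := by positivity
  have hnq : 0 < (n : ℝ) * q := by positivity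
  rw [incons, div_le_iff₀ (by positivity)] at h
  have h1 : (M i j ^ (-a) - avg M ^ (-a)) ^ 2 ≤ ∑ i, ∑ j, (M i j ^ (-a) - avg M ^ (-a)) ^ 2 :=
    (Finset.single_le_sum (f := fun j => (M i j ^ (-a) - avg M ^ (-a)) ^ 2)
      (fun j _ => sq_nonneg _) (Finset.mem_univ j)).trans
    (Finset.single_le_sum (f := fun i => ∑ j, (M i j ^ (-a) - avg M ^ (-a)) ^ 2)
      (fun i _ => Finset.sum_nonneg fun j _ => sq_nonneg _) (Finset.mem_univ i))
  have h2 : (M i j ^ (-a) - avg M ^ (-a)) ^ 2 ≤ (n * q * Z) * (avg M ^ (-a)) ^ 2 := by linarith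
  have hZ : 0 ≤ n * q * Z := by
    by_contra! hcon
    have := mul_neg_of_neg_of_pos hcon (by positivity : 0 < (avg M ^ (-a)) ^ 2)
    linarith [sq_nonneg (M i j ^ (-a) - avg M ^ (-a))]
  have h3 : (M i j ^ (-a) - avg M ^ (-a)) ^ 2 ≤ (Real.sqrt (n * q * Z) * avg M ^ (-a)) ^ 2 := by
    rwa [mul_pow, Real.sq_sqrt hZ]
  have h4 := le_of_sq_le_sq h3 (by positivity)
  linarith

/-- A crude bound without steady term, for use where the mismatch carries the factor `v⁻¹`. -/
lemma sum_norm_had_sub_sq_le (hM : ∀ i j, 0 < M i j) (ht : 0 < t)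
    (hm : 1 ≤ m) (h : ∀ i j, M i j ^ (-a) ≤ m * t ^ (-a)) (g : Fin n → Vec q) :
    ∑ i, ‖had (fun j => M i j ^ (-a) - t ^ (-a)) (g i)‖ ^ 2
      ≤ (t ^ (-a)) ^ 2 * (m ^ 2 * ∑ i, ‖g i‖ ^ 2) := by
  rw [Finset.mul_sum, Finset.mul_sum]
  refine Finset.sum_le_sum fun i _ => ?_
  have hT : 0 < t ^ (-a) := by positivity
  refine (norm_had_sq_le (b := m * t ^ (-a)) (fun j => ?_) (g i)).trans (le_of_eq (by ring))
  have h1 : 0 < M i j ^ (-a) := Real.rpow_pos_of_pos (hM i j) _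
  rw [abs_le]
  constructor <;> nlinarith [h i j]

/-- Split at the row mean: the first difference is the one measured by `ζ̂`, and the second is small
relative to `t ^ (-a)` because the row mean is within `D` of `t`. -/
lemma sum_norm_had_sub_sq_le_inconsHat (hn : 0 < n) (hq : 0 < q) (hM : ∀ i j, 0 < M i j)
    (ht : 0 < t) (ha0 : 0 ≤ a) (ha1 : a ≤ 1) (hm : 1 ≤ m)
    (h : ∀ i j, M i j ^ (-a) ≤ m * t ^ (-a)) (htM : t ≤ avg M)
    (hD : ∀ i, |rowAvg M i - t| ≤ D) {g : Fin n → Vec q} (hg : ∀ i, ‖g i‖ ≤ C) :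
    ∑ i, ‖had (fun j => M i j ^ (-a) - t ^ (-a)) (g i)‖ ^ 2
      ≤ (t ^ (-a)) ^ 2 * (2 * (n * q * inconsHat a M * C ^ 2)
        + 2 * (m ^ 2 * D ^ a * (t ^ (-a) * ∑ i, ‖g i‖ ^ 2))) := by
  have hT : 0 < t ^ (-a) := by positivity
  have hA : 0 < avg M := ht.trans_le htM
  have hq' : (0 : ℝ) < q := by positivity
  -- Some entry lies below its row mean, so the stepsize bound `h` passes to the row mean.
  have hrow : ∀ i, ∃ j, M i j ≤ rowAvg M i := fun i => by
    by_contra! hcon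
    have : ∑ j : Fin q, rowAvg M i < ∑ j, M i j := Finset.sum_lt_sum_of_nonempty
      ⟨⟨0, hq⟩, Finset.mem_univ _⟩ fun j _ => hcon j
    rw [Finset.sum_const, Finset.card_univ, Fintype.card_fin, nsmul_eq_mul, rowAvg, ← mul_assoc,
      mul_one_div_cancel hq'.ne', one_mul] at this
    exact lt_irrefl _ this
  have hrow0 : ∀ i, 0 < rowAvg M i := fun i => by
    obtain ⟨j, hj⟩ := hrow i
    exact (hM i j).trans_le hj
  have hrowa : ∀ i, rowAvg M i ^ (-a) ≤ m * t ^ (-a) := fun i => by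
    obtain ⟨j, hj⟩ := hrow i
    exact (Real.rpow_le_rpow_of_nonpos (hM i j) hj (by linarith)).trans (h i j)
  have h1 : ∀ i, ‖had (fun j => M i j ^ (-a) - t ^ (-a)) (g i)‖ ^ 2
      ≤ 2 * ((∑ j, (M i j ^ (-a) - rowAvg M i ^ (-a)) ^ 2) * C ^ 2)
        + 2 * (m ^ 2 * D ^ a * t ^ (-a) * (t ^ (-a)) ^ 2 * ‖g i‖ ^ 2) := fun i => by
    have e : had (fun j => M i j ^ (-a) - t ^ (-a)) (g i)
        = had (fun j => M i j ^ (-a) - rowAvg M i ^ (-a)) (g i)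
          + (rowAvg M i ^ (-a) - t ^ (-a)) • g i := by
      rw [← had_const, ← had_add]; congr 1; ext j; ring
    have b1 := norm_had_sq_le_sum (fun j => M i j ^ (-a) - rowAvg M i ^ (-a)) (g i)
    have b2 := rpow_neg_sub_sq_le (hrow0 i) ht ha0 ha1 hm (hD i) (hrowa i)
    have b3 : ‖(rowAvg M i ^ (-a) - t ^ (-a)) • g i‖ ^ 2
        ≤ m ^ 2 * D ^ a * t ^ (-a) * (t ^ (-a)) ^ 2 * ‖g i‖ ^ 2 := by
      rw [norm_smul, mul_pow, Real.norm_eq_abs, sq_abs]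
      exact mul_le_mul_of_nonneg_right b2 (sq_nonneg _)
    have b4 : (∑ j, (M i j ^ (-a) - rowAvg M i ^ (-a)) ^ 2) * ‖g i‖ ^ 2
        ≤ (∑ j, (M i j ^ (-a) - rowAvg M i ^ (-a)) ^ 2) * C ^ 2 :=
      mul_le_mul_of_nonneg_left (pow_le_pow_left₀ (norm_nonneg _) (hg i) 2)
        (Finset.sum_nonneg fun j _ => sq_nonneg _)
    rw [e]
    set A := had (fun j => M i j ^ (-a) - rowAvg M i ^ (-a)) (g i)
    set B := (rowAvg M i ^ (-a) - t ^ (-a)) • g i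
    have b5 : ‖A + B‖ ^ 2 ≤ (‖A‖ + ‖B‖) ^ 2 := pow_le_pow_left₀ (norm_nonneg _) (norm_add_le _ _) 2
    nlinarith [sq_nonneg (‖A‖ - ‖B‖)]
  have h2 := Finset.sum_le_sum fun i (_ : i ∈ Finset.univ) => h1 i
  refine h2.trans ?_
  rw [Finset.sum_add_distrib, ← Finset.mul_sum, ← Finset.mul_sum, ← Finset.sum_mul,
    ← Finset.mul_sum]
  have h3 : ∑ i, ∑ j, (M i j ^ (-a) - rowAvg M i ^ (-a)) ^ 2
      = n * q * inconsHat a M * (avg M ^ (-a)) ^ 2 := by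
    rw [inconsHat]
    have : 0 < avg M ^ (-a) := by positivity
    field_simp
  have h4 : avg M ^ (-a) ≤ t ^ (-a) := Real.rpow_le_rpow_of_nonpos ht htM (by linarith)
  have h5 : (avg M ^ (-a)) ^ 2 ≤ (t ^ (-a)) ^ 2 := pow_le_pow_left₀ (by positivity) h4 2
  have h6 : 0 ≤ n * q * inconsHat a M * C ^ 2 := by
    have : 0 ≤ inconsHat a M := div_nonneg
      (Finset.sum_nonneg fun i _ => Finset.sum_nonneg fun j _ => sq_nonneg _) (by positivity)
    positivity
  rw [h3]
  have h7 := mul_le_mul_of_nonneg_left h5 h6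
  linarith

end inconsistency

/-! ### Gradient accumulators -/

/-- An accumulator `m` that is mixed over the network and collects the squares of `g`. -/
structure Accumulates {n q : ℕ} (W : Matrix (Fin n) (Fin n) ℝ) (c c' C : ℝ)
    (m : ℕ → Fin n → Fin q → ℝ) (g : ℕ → Fin n → Vec q) : Prop where
  succ : ∀ k, m (k + 1) = mix W fun i j => m k i j + g k i j * g k i j
  bound : ∀ k i, ‖g k i‖ ≤ C
  init : ∀ i j, c ≤ m 0 i j ∧ m 0 i j ≤ c'

/-- Mean of the columns. -/
noncomputable def colMean {n q : ℕ} (M : Fin n → Fin q → ℝ) (j : Fin q) : ℝ := nmean fun i => M i j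

section accumulator

variable {n q : ℕ} {W : Matrix (Fin n) (Fin n) ℝ} {c c' C : ℝ}
  {m : ℕ → Fin n → Fin q → ℝ} {g : ℕ → Fin n → Vec q}

lemma avg_eq_colMean (M : Fin n → Fin q → ℝ) : avg M = (1 / (q : ℝ)) * ∑ j, colMean M j := by
  simp only [avg, colMean, nmean, smul_eq_mul, ← Finset.mul_sum]
  rw [Finset.sum_comm, ← mul_assoc]
  congr 1
  rw [one_div, one_div, one_div, mul_inv, mul_comm]

lemma le_nmean (hn : 0 < n) {u : Fin n → ℝ} {a : ℝ} (h : ∀ i, a ≤ u i) : a ≤ nmean u := by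
  have hn' : (0 : ℝ) < n := by positivity
  rw [nmean, smul_eq_mul, one_div, inv_mul_eq_div, le_div_iff₀ hn']
  have := Finset.card_nsmul_le_sum Finset.univ u a (fun i _ => h i)
  simpa [mul_comm] using this

lemma nmean_le (hn : 0 < n) {u : Fin n → ℝ} {a : ℝ} (h : ∀ i, u i ≤ a) : nmean u ≤ a := by
  have hn' : (0 : ℝ) < n := by positivity
  rw [nmean, smul_eq_mul, one_div, inv_mul_eq_div, div_le_iff₀ hn']
  have := Finset.sum_le_card_nsmul Finset.univ u a (fun i _ => h i)
  simpa [mul_comm] using this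

lemma nmean_le_nmean {u w : Fin n → ℝ} (h : ∀ i, u i ≤ w i) : nmean u ≤ nmean w := by
  simp only [nmean, smul_eq_mul]
  have := Finset.sum_le_sum fun i (_ : i ∈ Finset.univ) => h i
  gcongr

lemma mix_apply_apply (M : Fin n → Fin q → ℝ) (i : Fin n) (j : Fin q) :
    mix W M i j = mix W (fun i => M i j) i := by
  simp [mix]

lemma colMean_mix (hW : W ∈ doublyStochastic ℝ (Fin n)) (M : Fin n → Fin q → ℝ) (j : Fin q) :
    colMean (mix W M) j = colMean M j := by
  rw [colMean, colMean, ← nmean_mix hW fun i => M i j]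
  congr 1; ext i; exact mix_apply_apply M i j

lemma le_mix (hW : W ∈ doublyStochastic ℝ (Fin n)) {u : Fin n → ℝ} {a : ℝ} (h : ∀ i, a ≤ u i)
    (i : Fin n) : a ≤ mix W u i := by
  have h1 : ∑ j, W i j * a ≤ mix W u i := Finset.sum_le_sum fun j _ =>
    mul_le_mul_of_nonneg_left (h j) (nonneg_of_mem_doublyStochastic hW)
  rwa [← Finset.sum_mul, sum_row_of_mem_doublyStochastic hW, one_mul] at h1

lemma sq_apply_le {g : Vec q} (h : ‖g‖ ≤ C) (j : Fin q) : g j * g j ≤ C ^ 2 := by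
  have h1 := EuclideanSpace.real_norm_sq_eq g
  have h2 := Finset.single_le_sum (f := fun j => g j ^ 2) (fun j _ => sq_nonneg _)
    (Finset.mem_univ j)
  have h3 := pow_le_pow_left₀ (norm_nonneg _) h 2
  simp only at h2
  nlinarith

lemma Accumulates.le (hW : W ∈ doublyStochastic ℝ (Fin n)) (h : Accumulates W c c' C m g)
    (k : ℕ) : ∀ i j, c ≤ m k i j := by
  induction k with
  | zero => exact fun i j => (h.init i j).1
  | succ k ih =>
    intro i j
    rw [h.succ, mix_apply_apply]
    exact le_mix hW (fun i => by nlinarith [ih i j, mul_self_nonneg (g k i j)]) i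

/-- Individual entries may decrease under mixing; column means do not feel it and are plain sums of
squared gradients. -/
lemma Accumulates.colMean_succ (hW : W ∈ doublyStochastic ℝ (Fin n))
    (h : Accumulates W c c' C m g) (k : ℕ) (j : Fin q) :
    colMean (m (k + 1)) j = colMean (m k) j + nmean fun i => g k i j * g k i j := by
  rw [h.succ, colMean_mix hW, colMean, nmean_add, colMean]

lemma Accumulates.le_colMean (hn : 0 < n) (hW : W ∈ doublyStochastic ℝ (Fin n))
    (h : Accumulates W c c' C m g) (k : ℕ) (j : Fin q) : c ≤ colMean (m k) j :=
  le_nmean hn fun i => h.le hW k i j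

lemma Accumulates.colMean_le_succ (hn : 0 < n) (hW : W ∈ doublyStochastic ℝ (Fin n))
    (h : Accumulates W c c' C m g) (k : ℕ) (j : Fin q) :
    colMean (m k) j ≤ colMean (m (k + 1)) j := by
  rw [h.colMean_succ hW]
  linarith [le_nmean hn fun i => mul_self_nonneg (g k i j)]

lemma Accumulates.colMean_succ_le (hn : 0 < n) (hW : W ∈ doublyStochastic ℝ (Fin n))
    (h : Accumulates W c c' C m g) (k : ℕ) (j : Fin q) :
    colMean (m (k + 1)) j ≤ colMean (m k) j + C ^ 2 := by
  rw [h.colMean_succ hW]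
  linarith [nmean_le hn fun i => sq_apply_le (h.bound k i) j]

lemma Accumulates.colMean_le (hn : 0 < n) (hW : W ∈ doublyStochastic ℝ (Fin n))
    (h : Accumulates W c c' C m g) (k : ℕ) (j : Fin q) :
    colMean (m k) j ≤ c' + k * C ^ 2 := by
  induction k with
  | zero => simpa [colMean] using nmean_le hn fun i => (h.init i j).2
  | succ k ih =>
    have := h.colMean_succ_le hn hW k j
    push_cast
    linarith

lemma Accumulates.avg_succ (hn : 0 < n) (hW : W ∈ doublyStochastic ℝ (Fin n))
    (h : Accumulates W c c' C m g) (k : ℕ) :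
    avg (m (k + 1)) = avg (m k) + (∑ i, ‖g k i‖ ^ 2) / (n * q) := by
  rw [avg_eq_colMean, avg_eq_colMean]
  simp only [h.colMean_succ hW, Finset.sum_add_distrib, mul_add]
  congr 1
  simp only [nmean, smul_eq_mul, ← Finset.mul_sum, EuclideanSpace.real_norm_sq_eq]
  rw [Finset.sum_comm]
  simp only [sq]
  field_simp

/-- With `Q` the first factor on the right and `e` the gap, `Q e⁻²` is the fixed point of `z ↦ (1 -
e) z + Q / e`, so the consensus recursion never leaves this bound. -/
lemma Accumulates.sum_sq_sub_le (hn : 0 < n) (hc : 0 < c) (hρ : rho W < 1)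
    (hW : W ∈ doublyStochastic ℝ (Fin n)) (h : Accumulates W c c' C m g) (k : ℕ) :
    ∑ i, ∑ j, (m k i j - colMean (m k) j) ^ 2
      ≤ (n * q * c' ^ 2 + n * C ^ 4) * (gap W)⁻¹ ^ 2 := by
  have hg := gap_pos hρ
  have hie : 1 ≤ (gap W)⁻¹ := (one_le_inv₀ hg).2 (gap_le_one W)
  have hconv : ∀ k, ∑ i, ∑ j, (m k i j - colMean (m k) j) ^ 2
      = ∑ i, ‖(WithLp.toLp 2 (m k i) : Vec q) - nmean fun i => (WithLp.toLp 2 (m k i) : Vec q)‖ ^ 2 :=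
    fun k => by
      refine Finset.sum_congr rfl fun i _ => ?_
      rw [EuclideanSpace.real_norm_sq_eq]
      simp [colMean, nmean]
  induction k with
  | zero =>
    have h1 : ∑ i, ∑ j, (m 0 i j - colMean (m 0) j) ^ 2 ≤ ∑ i : Fin n, ∑ j : Fin q, c' ^ 2 := by
      refine Finset.sum_le_sum fun i _ => Finset.sum_le_sum fun j _ => ?_
      have h2 : colMean (m 0) j ≤ c' := nmean_le hn fun i => (h.init i j).2
      have h3 := h.le_colMean hn hW 0 j
      have h4 := h.init i j
      exact sq_le_sq' (by linarith) (by linarith)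
    simp only [Finset.sum_const, Finset.card_univ, Fintype.card_fin, nsmul_eq_mul] at h1
    have h5 : 0 ≤ (n : ℝ) * q * c' ^ 2 + n * C ^ 4 := by positivity
    have h6 : 1 ≤ (gap W)⁻¹ ^ 2 := one_le_pow₀ hie
    have h7 : 0 ≤ (n : ℝ) * C ^ 4 := by positivity
    nlinarith
  | succ k ih =>
    rw [hconv] at ih ⊢
    set u : Fin n → Vec q := fun i => WithLp.toLp 2 (m k i) with hu
    set w : Fin n → Vec q := fun i => WithLp.toLp 2 fun j => g k i j * g k i j with hw
    have e1 : ∀ i, (WithLp.toLp 2 (m (k + 1) i) : Vec q) = mix W (fun i => u i + w i) i :=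
      fun i => by
        ext j
        rw [h.succ]
        simp [mix, hu, hw, mul_add]
    have e2 : (nmean fun i => (WithLp.toLp 2 (m (k + 1) i) : Vec q))
        = nmean fun i => u i + w i := by
      simp only [e1]; exact nmean_mix hW _
    rw [e2]
    simp only [e1]
    have h1 := consensus_step hn hW hρ u w
    have h2 : ∑ i, ‖w i‖ ^ 2 ≤ n * C ^ 4 := by
      have : ∀ i, ‖w i‖ ^ 2 ≤ C ^ 4 := fun i => by
        rw [EuclideanSpace.real_norm_sq_eq]
        have h3 : ∑ j, (w i j) ^ 2 ≤ ∑ j, C ^ 2 * (g k i j) ^ 2 := Finset.sum_le_sum fun j _ => by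
          have := sq_apply_le (h.bound k i) j
          simp only [hw]
          nlinarith [mul_self_nonneg (g k i j)]
        rw [← Finset.mul_sum, ← EuclideanSpace.real_norm_sq_eq (g k i)] at h3
        have h4 := pow_le_pow_left₀ (norm_nonneg _) (h.bound k i) 2
        nlinarith [sq_nonneg C]
      have h5 := Finset.sum_le_sum fun i (_ : i ∈ Finset.univ) => this i
      simpa using h5
    set e := gap W
    set Q := (n * q * c' ^ 2 + n * C ^ 4 : ℝ)
    have h3 : (n : ℝ) * C ^ 4 ≤ Q := by
      have : 0 ≤ (n : ℝ) * q * c' ^ 2 := by positivity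
      simp only [Q]; linarith
    have h4 : 0 ≤ 1 - e := by have := gap_le_one W; simp only [e]; linarith
    calc _ ≤ (1 - e) * (Q * e⁻¹ ^ 2) + 1 / e * Q := by
          refine h1.trans (add_le_add (mul_le_mul_of_nonneg_left ih h4) ?_)
          gcongr
          exact h2.trans h3
      _ = Q * e⁻¹ ^ 2 := by field_simp; ring

lemma Accumulates.abs_sub_colMean_le (hn : 0 < n) (hc : 0 < c) (hρ : rho W < 1)
    (hW : W ∈ doublyStochastic ℝ (Fin n)) (h : Accumulates W c c' C m g) (k : ℕ) (i : Fin n)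
    (j : Fin q) :
    |m k i j - colMean (m k) j| ≤ Real.sqrt (n * q * c' ^ 2 + n * C ^ 4) * (gap W)⁻¹ := by
  have h1 := h.sum_sq_sub_le hn hc hρ hW k
  have hg := gap_pos hρ
  have h2 : (m k i j - colMean (m k) j) ^ 2 ≤ ∑ i, ∑ j, (m k i j - colMean (m k) j) ^ 2 :=
    (Finset.single_le_sum (f := fun j => (m k i j - colMean (m k) j) ^ 2)
      (fun j _ => sq_nonneg _) (Finset.mem_univ j)).trans
    (Finset.single_le_sum (f := fun i => ∑ j, (m k i j - colMean (m k) j) ^ 2)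
      (fun i _ => Finset.sum_nonneg fun j _ => sq_nonneg _) (Finset.mem_univ i))
  refine abs_le_of_sq_le_sq ?_ (by positivity)
  rw [mul_pow, Real.sq_sqrt (by positivity)]
  exact h2.trans h1

end accumulator

section accumulator

variable {n q : ℕ} {W : Matrix (Fin n) (Fin n) ℝ} {c c' C : ℝ}
  {m : ℕ → Fin n → Fin q → ℝ} {g : ℕ → Fin n → Vec q}

lemma Accumulates.avg_le (hn : 0 < n) (hq : 0 < q) (hW : W ∈ doublyStochastic ℝ (Fin n))
    (h : Accumulates W c c' C m g) (k : ℕ) : avg (m k) ≤ c' + k * C ^ 2 := by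
  have : avg (m k) = nmean (colMean (m k)) := by rw [avg_eq_colMean]; rfl
  rw [this]
  exact nmean_le hq fun j => h.colMean_le hn hW k j

lemma Accumulates.le_avg (hn : 0 < n) (hq : 0 < q) (hW : W ∈ doublyStochastic ℝ (Fin n))
    (h : Accumulates W c c' C m g) (k : ℕ) : c ≤ avg (m k) := by
  have : avg (m k) = nmean (colMean (m k)) := by rw [avg_eq_colMean]; rfl
  rw [this]
  exact le_nmean hq fun j => h.le_colMean hn hW k j

/-- `v` only has to dominate the mean of the accumulator, whose exact increments give the
logarithmic sum. That sum has the next mean in the denominator, which is at most `(1 + C² / c) v k`.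
The slack `q ≤ Q` lets both accumulators share a constant. -/
lemma Accumulates.accum (hn : 0 < n) (hq : 0 < q) (hc : 0 < c)
    (hW : W ∈ doublyStochastic ℝ (Fin n)) (h : Accumulates W c c' C m g) {v : ℕ → ℝ} {Q : ℝ}
    (hQ : (q : ℝ) ≤ Q) (hv : Monotone v) (hv1 : ∀ k, v (k + 1) ≤ v k + C ^ 2)
    (hv2 : ∀ k, v k ≤ c' + k * C ^ 2) (hv3 : ∀ k, avg (m k) ≤ v k) :
    Accum c (c' + C ^ 2)
      ((1 + C ^ 2 / c) * (n * Q * (1 + |Real.log (c' + C ^ 2) - Real.log c|))) v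
      fun k => ∑ i, ‖g k i‖ ^ 2 := by
  have hn' : (0 : ℝ) < n := by positivity
  have hq' : (0 : ℝ) < q := by positivity
  have hlow : ∀ k, c ≤ avg (m k) := h.le_avg hn hq hW
  have hvl : ∀ k, c ≤ v k := fun k => (hlow k).trans (hv3 k)
  have hc' : 0 ≤ c' := by
    have := (h.init ⟨0, hn⟩ ⟨0, hq⟩).1.trans (h.init ⟨0, hn⟩ ⟨0, hq⟩).2
    linarith
  have hg0 : ∀ k, 0 ≤ ∑ i, ‖g k i‖ ^ 2 := fun k => Finset.sum_nonneg fun i _ => sq_nonneg _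
  refine ⟨hvl, hv, fun K hK k hk => ?_, hg0, fun K hK => ?_⟩
  · have h1 : (1 : ℝ) ≤ K := by exact_mod_cast hK
    have h2 : (k : ℝ) ≤ K := by exact_mod_cast hk
    have := hv2 k
    nlinarith [mul_le_mul_of_nonneg_right h2 (sq_nonneg C)]
  · have h1 : (1 : ℝ) ≤ K := by exact_mod_cast hK
    have hS := sum_div_le_log (S := fun k => avg (m k))
      (a := fun k => (∑ i, ‖g k i‖ ^ 2) / (n * q)) (fun k => hc.trans_le (hlow k))
      (fun k => (h.avg_succ hn hW k).ge) K
    have h2 : ∀ k, (∑ i, ‖g k i‖ ^ 2) * (v k)⁻¹ ≤ (1 + C ^ 2 / c) * (n * q)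
        * ((∑ i, ‖g k i‖ ^ 2) / (n * q) / avg (m (k + 1))) := fun k => by
      have hvk : 0 < v k := hc.trans_le (hvl k)
      have hm1 : 0 < avg (m (k + 1)) := hc.trans_le (hlow _)
      have h3 : avg (m (k + 1)) ≤ (1 + C ^ 2 / c) * v k := by
        have : C ^ 2 ≤ C ^ 2 / c * v k := by
          rw [div_mul_eq_mul_div, le_div_iff₀ hc]
          exact mul_le_mul_of_nonneg_left (hvl k) (sq_nonneg C)
        linarith [hv3 (k + 1), hv1 k]
      have h4 : (v k)⁻¹ ≤ (1 + C ^ 2 / c) * (avg (m (k + 1)))⁻¹ := by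
        rw [← div_eq_mul_inv, le_div_iff₀ hm1, inv_mul_le_iff₀ hvk]
        linarith
      calc _ ≤ (∑ i, ‖g k i‖ ^ 2) * ((1 + C ^ 2 / c) * (avg (m (k + 1)))⁻¹) :=
            mul_le_mul_of_nonneg_left h4 (hg0 k)
        _ = _ := by field_simp
    have hlog0 : 0 ≤ Real.log K := Real.log_nonneg h1
    have h5 : Real.log (avg (m K)) - Real.log (avg (m 0))
        ≤ (1 + |Real.log (c' + C ^ 2) - Real.log c|) * (1 + Real.log K) := by
      have hpos := hc.trans_le (hlow K)
      have hup : avg (m K) ≤ (c' + C ^ 2) * K := by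
        have := h.avg_le hn hq hW K
        nlinarith
      have hkV : 0 < c' + C ^ 2 := pos_of_mul_pos_left (hpos.trans_le hup) (by linarith)
      have a1 := Real.log_le_log hpos hup
      rw [Real.log_mul hkV.ne' (by positivity)] at a1
      have a2 := Real.log_le_log hc (hlow 0)
      have a3 := le_abs_self (Real.log (c' + C ^ 2) - Real.log c)
      have a4 := abs_nonneg (Real.log (c' + C ^ 2) - Real.log c)
      nlinarith
    have hk : 0 ≤ (1 + C ^ 2 / c) * (n * q : ℝ) := by positivity
    calc _ ≤ ∑ k ∈ Finset.range K, (1 + C ^ 2 / c) * (n * q)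
          * ((∑ i, ‖g k i‖ ^ 2) / (n * q) / avg (m (k + 1))) :=
          Finset.sum_le_sum fun k _ => h2 k
      _ ≤ (1 + C ^ 2 / c) * (n * q)
          * ((1 + |Real.log (c' + C ^ 2) - Real.log c|) * (1 + Real.log K)) := by
          rw [← Finset.mul_sum]
          exact mul_le_mul_of_nonneg_left (hS.trans h5) hk
      _ = (1 + C ^ 2 / c) * (n * q * (1 + |Real.log (c' + C ^ 2) - Real.log c|))
          * (1 + Real.log K) := by ring
      _ ≤ _ := by gcongr

end accumulator

/-! ### The reference value of the primal accumulator -/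

/-- Entrywise maximum, as in `precondV`. -/
noncomputable def pmax {p d : ℕ} (a : Fin p → ℝ) (b : Fin d → ℝ) (j : Fin p) : ℝ :=
  if h : (j : ℕ) < d then max (a j) (b ⟨j, h⟩) else a j

/-- A nondecreasing substitute for the mean of the entries of `V`. -/
noncomputable def State.vref {n p d : ℕ} (s : State n p d) : ℝ :=
  nmean (pmax (colMean s.mx) (colMean s.my))

section pmax

variable {n p d : ℕ} {a a' : Fin p → ℝ} {b b' : Fin d → ℝ}

lemma precondV_eq_pmax (mx : Fin n → Fin p → ℝ) (my : Fin n → Fin d → ℝ) (i : Fin n) :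
    precondV mx my i = pmax (mx i) (my i) := rfl

lemma le_pmax (a : Fin p → ℝ) (b : Fin d → ℝ) (j : Fin p) : a j ≤ pmax a b j := by
  unfold pmax; split_ifs
  · exact le_max_left _ _
  · exact le_rfl

lemma pmax_le_add {t : ℝ} (ha : ∀ j, a' j ≤ a j + t) (hb : ∀ j, b' j ≤ b j + t) (j : Fin p) :
    pmax a' b' j ≤ pmax a b j + t := by
  unfold pmax; split_ifs
  · rw [max_add]; exact max_le_max (ha _) (hb _)
  · exact ha j

lemma pmax_le {t : ℝ} (ha : ∀ j, a j ≤ t) (hb : ∀ j, b j ≤ t) (j : Fin p) : pmax a b j ≤ t := by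
  unfold pmax; split_ifs
  · exact max_le (ha _) (hb _)
  · exact ha j

lemma abs_pmax_sub_le {D : ℝ} (ha : ∀ j, |a' j - a j| ≤ D) (hb : ∀ j, |b' j - b j| ≤ D)
    (j : Fin p) : |pmax a' b' j - pmax a b j| ≤ D := by
  have h1 := pmax_le_add (t := D) (fun j => by linarith [(abs_le.1 (ha j)).2])
    (fun j => by linarith [(abs_le.1 (hb j)).2]) j (a := a) (a' := a') (b := b) (b' := b')
  have h2 := pmax_le_add (t := D) (fun j => by linarith [(abs_le.1 (ha j)).1])
    (fun j => by linarith [(abs_le.1 (hb j)).1]) j (a := a') (a' := a) (b := b') (b' := b)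
  rw [abs_le]; constructor <;> linarith

/-- A maximum of means is at most the mean of the maxima. `vref` is preferred since mixing can
decrease the mean of the entries of `V`. -/
lemma vref_le_avg_V (s : State n p d) : s.vref ≤ avg s.V := by
  have h : avg s.V = nmean (colMean s.V) := by rw [avg_eq_colMean]; rfl
  rw [h]
  refine nmean_le_nmean fun j => ?_
  unfold pmax State.V
  split_ifs with hj
  · refine max_le (nmean_le_nmean fun i => ?_) (nmean_le_nmean fun i => ?_)
    · rw [precondV_eq_pmax]; exact le_pmax _ _ _
    · simp [precondV, hj]
  · exact nmean_le_nmean fun i => by rw [precondV_eq_pmax]; exact le_pmax _ _ _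

lemma abs_rowAvg_sub_avg_le (hp : 0 < p) {u w : Fin p → ℝ} {D : ℝ} (h : ∀ j, |u j - w j| ≤ D) :
    |nmean u - nmean w| ≤ D := by
  rw [← nmean_sub, ← Real.norm_eq_abs]
  exact norm_nmean_le hp h

end pmax

/-! ### Trajectories -/

/-- A trajectory of the iteration, along which the stochastic gradients are bounded. -/
structure Run {n p d : ℕ} {Ξ : Type*} [MeasurableSpace Ξ] (P : Problem n p d Ξ)
    (W : Matrix (Fin n) (Fin n) ℝ) (H : Hyper) (μ L C c c' R Δ Z : ℝ)
    (s : ℕ → State n p d) (gx : ℕ → Fin n → Vec p) (gy : ℕ → Fin n → Vec d) : Prop where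
  hn : 0 < n
  hp : 0 < p
  hd : 0 < d
  hγx : 0 < H.γx
  hγy : 0 < H.γy
  hβ : 0 < H.β
  hα : H.β < H.α
  hα1 : H.α < 1
  hμ : 0 < μ
  hL : 0 < L
  hC : 0 < C
  hc : 0 < c
  setting : P.Setting
  conc : P.StronglyConcave μ
  smooth : P.Smooth L
  grad : P.StochGrad C
  hΔ : ∀ x x', P.Phi x - P.Phi x' ≤ Δ
  hW : W ∈ doublyStochastic ℝ (Fin n)
  hρ : rho W < 1
  succ : ∀ k, s (k + 1) = step P.Y W H (gx k) (gy k) (s k)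
  y0 : ∀ i, (s 0).y i ∈ P.Y
  x0 : ∑ i, ‖(s 0).x i - (s 0).xbar‖ ^ 2 ≤ R
  mx0 : ∀ i j, c ≤ (s 0).mx i j ∧ (s 0).mx i j ≤ c'
  my0 : ∀ i j, c ≤ (s 0).my i j ∧ (s 0).my i j ≤ c'
  bx : ∀ k i, ‖gx k i‖ ≤ C
  bY : ∀ k i, ‖gy k i‖ ≤ C
  iV : ∀ k, incons H.α (s k).V ≤ Z
  iU : ∀ k, incons H.β (s k).U ≤ Z

namespace Run

variable {n p d : ℕ} {Ξ : Type*} [MeasurableSpace Ξ] {P : Problem n p d Ξ}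
  {W : Matrix (Fin n) (Fin n) ℝ} {H : Hyper} {μ L C c c' R Δ Z : ℝ}
  {s : ℕ → State n p d} {gx : ℕ → Fin n → Vec p} {gy : ℕ → Fin n → Vec d}

lemma accX (h : Run P W H μ L C c c' R Δ Z s gx gy) :
    Accumulates W c c' C (fun k => (s k).mx) gx :=
  ⟨fun k => by rw [h.succ k]; rfl, h.bx, h.mx0⟩

lemma accY (h : Run P W H μ L C c c' R Δ Z s gx gy) :
    Accumulates W c c' C (fun k => (s k).U) gy :=
  ⟨fun k => by rw [h.succ k]; rfl, h.bY, h.my0⟩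

lemma vref_mono (h : Run P W H μ L C c c' R Δ Z s gx gy) : Monotone fun k => (s k).vref := by
  refine monotone_nat_of_le_succ fun k => nmean_le_nmean fun j => ?_
  have := pmax_le_add (t := 0) (a' := colMean (s k).mx) (a := colMean (s (k + 1)).mx)
    (b' := colMean (s k).my) (b := colMean (s (k + 1)).my)
    (fun j => by simpa using h.accX.colMean_le_succ h.hn h.hW k j)
    (fun j => (h.accY.colMean_le_succ h.hn h.hW k j).trans_eq (add_zero _).symm) j
  simpa using this

lemma vref_succ_le (h : Run P W H μ L C c c' R Δ Z s gx gy) (k : ℕ) :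
    (s (k + 1)).vref ≤ (s k).vref + C ^ 2 := by
  have : (s k).vref + C ^ 2 = nmean fun j => pmax (colMean (s k).mx) (colMean (s k).my) j + C ^ 2 := by
    rw [nmean_add, nmean_const h.hp, State.vref]
  rw [this]
  exact nmean_le_nmean fun j => pmax_le_add (h.accX.colMean_succ_le h.hn h.hW k)
    (h.accY.colMean_succ_le h.hn h.hW k) j

lemma vref_le (h : Run P W H μ L C c c' R Δ Z s gx gy) (k : ℕ) : (s k).vref ≤ c' + k * C ^ 2 :=
  nmean_le h.hp fun j => pmax_le (h.accX.colMean_le h.hn h.hW k) (h.accY.colMean_le h.hn h.hW k) j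

lemma avg_mx_le_vref (s : State n p d) : avg s.mx ≤ s.vref := by
  have : avg s.mx = nmean (colMean s.mx) := by rw [avg_eq_colMean]; rfl
  rw [this]
  exact nmean_le_nmean fun j => le_pmax _ _ _

lemma avg_U_mono (h : Run P W H μ L C c c' R Δ Z s gx gy) : Monotone fun k => avg (s k).U := by
  refine monotone_nat_of_le_succ fun k => ?_
  rw [h.accY.avg_succ h.hn h.hW k]
  have : 0 ≤ (∑ i, ‖gy k i‖ ^ 2) / (n * d : ℝ) := by positivity
  linarith

lemma avg_U_succ_le (h : Run P W H μ L C c c' R Δ Z s gx gy) (k : ℕ) :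
    avg (s (k + 1)).U ≤ avg (s k).U + C ^ 2 := by
  have e : ∀ k, avg (s k).U = nmean (colMean (s k).U) := fun k => by rw [avg_eq_colMean]; rfl
  have e2 : nmean (colMean (s k).U) + C ^ 2 = nmean fun j => colMean (s k).U j + C ^ 2 := by
    rw [nmean_add, nmean_const h.hd]
  rw [e, e, e2]
  exact nmean_le_nmean fun j => h.accY.colMean_succ_le h.hn h.hW k j

lemma accumX (h : Run P W H μ L C c c' R Δ Z s gx gy) : Accum c (c' + C ^ 2)
    ((1 + C ^ 2 / c) * (n * (p + d) * (1 + |Real.log (c' + C ^ 2) - Real.log c|)))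
    (fun k => (s k).vref) fun k => ∑ i, ‖gx k i‖ ^ 2 :=
  h.accX.accum h.hn h.hp h.hc h.hW (by simp) h.vref_mono h.vref_succ_le h.vref_le
    fun k => avg_mx_le_vref (s k)

lemma accumY (h : Run P W H μ L C c c' R Δ Z s gx gy) : Accum c (c' + C ^ 2)
    ((1 + C ^ 2 / c) * (n * (p + d) * (1 + |Real.log (c' + C ^ 2) - Real.log c|)))
    (fun k => avg (s k).U) fun k => ∑ i, ‖gy k i‖ ^ 2 :=
  h.accY.accum h.hn h.hd h.hc h.hW (by simp) h.avg_U_mono h.avg_U_succ_le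
    (h.accY.avg_le h.hn h.hd h.hW) fun _ => le_rfl

lemma vref_pos (h : Run P W H μ L C c c' R Δ Z s gx gy) (k : ℕ) : 0 < (s k).vref :=
  h.accumX.pos h.hc k

lemma avg_U_pos (h : Run P W H μ L C c c' R Δ Z s gx gy) (k : ℕ) : 0 < avg (s k).U :=
  h.accumY.pos h.hc k

lemma le_V (h : Run P W H μ L C c c' R Δ Z s gx gy) (k : ℕ) (i : Fin n) (j : Fin p) :
    c ≤ (s k).V i j := (h.accX.le h.hW k i j).trans (le_pmax _ _ j)

lemma le_U (h : Run P W H μ L C c c' R Δ Z s gx gy) (k : ℕ) (i : Fin n) (j : Fin d) :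
    c ≤ (s k).U i j := h.accY.le h.hW k i j

end Run

/-- Bound of the deviation of the accumulators from their means, up to the spectral gap. -/
noncomputable def devBound (n p d : ℕ) (c' C : ℝ) : ℝ :=
  Real.sqrt (n * p * c' ^ 2 + n * C ^ 4) + Real.sqrt (n * d * c' ^ 2 + n * C ^ 4)

lemma devBound_nonneg (n p d : ℕ) (c' C : ℝ) : 0 ≤ devBound n p d c' C := by
  unfold devBound; positivity

namespace Run

variable {n p d : ℕ} {Ξ : Type*} [MeasurableSpace Ξ] {P : Problem n p d Ξ}
  {W : Matrix (Fin n) (Fin n) ℝ} {H : Hyper} {μ L C c c' R Δ Z : ℝ}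
  {s : ℕ → State n p d} {gx : ℕ → Fin n → Vec p} {gy : ℕ → Fin n → Vec d}

lemma abs_sub_le (h : Run P W H μ L C c c' R Δ Z s gx gy) (k : ℕ) :
    (∀ i j, |(s k).mx i j - colMean (s k).mx j| ≤ devBound n p d c' C * (gap W)⁻¹) ∧
    ∀ i j, |(s k).my i j - colMean (s k).my j| ≤ devBound n p d c' C * (gap W)⁻¹ := by
  have hg := gap_pos h.hρ
  refine ⟨fun i j => (h.accX.abs_sub_colMean_le h.hn h.hc h.hρ h.hW k i j).trans ?_,
    fun i j => (h.accY.abs_sub_colMean_le h.hn h.hc h.hρ h.hW k i j).trans ?_⟩ <;>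
  · gcongr
    unfold devBound
    linarith [Real.sqrt_nonneg (n * p * c' ^ 2 + n * C ^ 4),
      Real.sqrt_nonneg (n * d * c' ^ 2 + n * C ^ 4)]

lemma abs_rowAvg_V_sub_le (h : Run P W H μ L C c c' R Δ Z s gx gy) (k : ℕ) (i : Fin n) :
    |rowAvg (s k).V i - (s k).vref| ≤ devBound n p d c' C * (gap W)⁻¹ :=
  abs_rowAvg_sub_avg_le h.hp fun j =>
    abs_pmax_sub_le ((h.abs_sub_le k).1 i) ((h.abs_sub_le k).2 i) j

lemma abs_rowAvg_U_sub_le (h : Run P W H μ L C c c' R Δ Z s gx gy) (k : ℕ) (i : Fin n) :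
    |rowAvg (s k).U i - avg (s k).U| ≤ devBound n p d c' C * (gap W)⁻¹ := by
  have : avg (s k).U = nmean (colMean (s k).U) := by rw [avg_eq_colMean]; rfl
  rw [this]
  exact abs_rowAvg_sub_avg_le h.hd ((h.abs_sub_le k).2 i)

/-- The dual accumulator is dominated by the primal one. -/
lemma avg_U_le (h : Run P W H μ L C c c' R Δ Z s gx gy) {m : ℝ} (hm : 1 ≤ m) (k : ℕ)
    (hU : ∀ i j, (s k).U i j ^ (-H.β) ≤ m * avg (s k).U ^ (-H.β)) :
    avg (s k).U ≤ m ^ (1 / H.β) * p * (s k).vref := by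
  have hu := h.avg_U_pos k
  have hβ := h.hβ
  have hm0 : 0 < m := by linarith
  -- Inverting the bound of the stepsizes: no entry of `U` is far below the mean.
  have h1 : ∀ i j, avg (s k).U ≤ m ^ (1 / H.β) * (s k).U i j := fun i j => by
    have hUij : 0 < (s k).U i j := h.hc.trans_le (h.le_U k i j)
    have h2 := hU i j
    rw [Real.rpow_neg hUij.le, Real.rpow_neg hu.le, ← div_eq_mul_inv,
      inv_le_iff_one_le_mul₀ (by positivity), div_mul_eq_mul_div, le_div_iff₀ (by positivity),
      one_mul] at h2
    have h3 := Real.rpow_le_rpow (by positivity) h2 (by positivity : 0 ≤ 1 / H.β)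
    rw [← Real.rpow_mul hu.le, Real.mul_rpow hm0.le (by positivity), ← Real.rpow_mul hUij.le,
      mul_one_div_cancel hβ.ne', Real.rpow_one, Real.rpow_one] at h3
    exact h3
  -- Coordinate `0` exists in both accumulators, so there the maximum includes the dual entry.
  have h4 : avg (s k).U ≤ m ^ (1 / H.β) * colMean (s k).my ⟨0, h.hd⟩ := by
    rw [colMean, ← smul_eq_mul, ← nmean_smul]
    exact le_nmean h.hn fun i => h1 i _
  have h5 : colMean (s k).my ⟨0, h.hd⟩ ≤ p * (s k).vref := by
    have e : (p : ℝ) * (s k).vref = ∑ j, pmax (colMean (s k).mx) (colMean (s k).my) j := by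
      rw [State.vref, ← smul_eq_mul, smul_nmean h.hp]
    rw [e]
    have h6 : colMean (s k).my ⟨0, h.hd⟩ ≤ pmax (colMean (s k).mx) (colMean (s k).my) ⟨0, h.hp⟩ := by
      simp [pmax, h.hd]
    refine h6.trans (Finset.single_le_sum (f := pmax (colMean (s k).mx) (colMean (s k).my))
      (fun j _ => ?_) (Finset.mem_univ _))
    exact (h.hc.le.trans (h.accX.le_colMean h.hn h.hW k j)).trans (le_pmax _ _ j)
  calc _ ≤ m ^ (1 / H.β) * (p * (s k).vref) := h4.trans (by gcongr)
    _ = _ := by ring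

end Run

/-! ### The sequences attached to a trajectory -/

/-- Network average of the dual variables. -/
noncomputable def State.ybar {n p d : ℕ} (s : State n p d) : Vec d := nmean s.y

/-- Average over the nodes of the primal gradients at the local variables. -/
noncomputable def Problem.netX {n p d : ℕ} {Ξ : Type*} [MeasurableSpace Ξ] (P : Problem n p d Ξ)
    (s : State n p d) : Vec p := nmean fun i => P.gradX i (s.x i) (s.y i)

/-- Exponential average of the primal iterates at the time scale of the dual stepsize. -/
noncomputable def lagRef {n p d : ℕ} (c β : ℝ) (s : ℕ → State n p d) : ℕ → Vec p
  | 0 => (s 0).xbar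
  | k + 1 => lagRef c β s k + (c ^ β * avg (s k).U ^ (-β)) • ((s k).xbar - lagRef c β s k)

/-- The scalar sequences attached to a trajectory. -/
noncomputable def pathSeqs {n p d : ℕ} {Ξ : Type*} [MeasurableSpace Ξ] (P : Problem n p d Ξ)
    (H : Hyper) (c : ℝ) (s : ℕ → State n p d) (gx : ℕ → Fin n → Vec p) (gy : ℕ → Fin n → Vec d) :
    Seqs where
  v k := (s k).vref
  u k := avg (s k).U
  gx k := ∑ i, ‖gx k i‖ ^ 2
  gy k := ∑ i, ‖gy k i‖ ^ 2
  P2 k := ‖P.avgX (s k).xbar (P.yStar (s k).xbar)‖ ^ 2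
  G2 k := ‖P.netX (s k)‖ ^ 2
  Gy2 k := ∑ i, ‖P.gradY i ((s k).x i) ((s k).y i)‖ ^ 2
  Q k := ‖P.avgX (s k).xbar (P.yStar (s k).xbar) - P.netX (s k)‖ ^ 2
  D k := ∑ i, ‖(s k).y i - P.yStar (lagRef c H.β s k)‖ ^ 2
  r2 k := ‖(s k).xbar - lagRef c H.β s k‖ ^ 2
  cx k := ∑ i, ‖(s k).x i - (s k).xbar‖ ^ 2
  cy k := ∑ i, ‖(s k).y i - (s k).ybar‖ ^ 2
  ev k := ((s k).vref ^ H.α) ^ 2 * ‖nmean fun i =>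
    had (fun j => (s (k + 1)).V i j ^ (-H.α) - (s (k + 1)).vref ^ (-H.α)) (gx k i)‖ ^ 2
  eu k := (avg (s k).U ^ H.β) ^ 2 * ∑ i,
    ‖had (fun j => (s (k + 1)).U i j ^ (-H.β) - avg (s (k + 1)).U ^ (-H.β)) (gy k i)‖ ^ 2
  φ k := P.Phi (s k).xbar
  noiseDescent k := - inner ℝ (P.avgX (s k).xbar (P.yStar (s k).xbar))
    (nmean fun i => gx k i - P.gradX i ((s k).x i) ((s k).y i))
  noiseTrack k := ∑ i, inner ℝ ((s k).y i - P.yStar (lagRef c H.β s k))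
    (gy k i - P.gradY i ((s k).x i) ((s k).y i))
  noiseLag k := -(2 * H.γx * (1 - c ^ H.β * avg (s k).U ^ (-H.β)) * avg (s k).U ^ H.β
      * (s k).vref ^ (-H.α)) * inner ℝ ((s k).xbar - lagRef c H.β s k)
    (nmean fun i => gx k i - P.gradX i ((s k).x i) ((s k).y i))
  noiseMeanY k := -(2 * avg (s k).U ^ (-H.β)) * ∑ i, inner ℝ (P.gradY i ((s k).x i) ((s k).y i))
    (gy k i - P.gradY i ((s k).x i) ((s k).y i))
  noiseMeanX k := -(2 * (s k).vref⁻¹) * inner ℝ (P.netX (s k))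
    (nmean fun i => gx k i - P.gradX i ((s k).x i) ((s k).y i))

/-! ### One-step inequalities in an inner product space -/

section abstract_steps

variable {E : Type*} [NormedAddCommGroup E] [InnerProductSpace ℝ E]

lemma inner_le_weighted {a b : E} {t : ℝ} (ht : 0 < t) :
    inner ℝ a b ≤ t * ‖a‖ ^ 2 + 1 / (4 * t) * ‖b‖ ^ 2 := by
  have h1 := real_inner_le_norm a b
  have h2 : 0 ≤ (2 * t * ‖a‖ - ‖b‖) ^ 2 * (1 / (4 * t)) := by positivity
  have h3 : (2 * t * ‖a‖ - ‖b‖) ^ 2 * (1 / (4 * t))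
      = t * ‖a‖ ^ 2 + 1 / (4 * t) * ‖b‖ ^ 2 - ‖a‖ * ‖b‖ := by field_simp; ring
  linarith

lemma neg_inner_le_weighted {a b : E} {t : ℝ} (ht : 0 < t) :
    -inner ℝ a b ≤ t * ‖a‖ ^ 2 + 1 / (4 * t) * ‖b‖ ^ 2 := by
  have := inner_le_weighted (a := a) (b := -b) ht
  rwa [inner_neg_right, norm_neg] at this

/-- To be read with `w = v ^ α`, `A = v ^ (-α)`, `B` the decrease of the stepsize and `ε` its
mismatch. After multiplication by `w / γ`, polarization of `⟪P, G⟫` gives half of both squares; a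
quarter of `‖P‖²` is spent on `ε`. -/
lemma descent_step {g G P ε δ : E} {φ φ' ℓ γ A B w lv C X : ℝ} (hγ : 0 < γ)
    (hφ : φ' ≤ φ + inner ℝ P δ + ℓ * ‖δ‖ ^ 2) (hδ : δ = -γ • (A • g - B • g + ε))
    (hwA : w * A = 1) (hw : 0 ≤ w) (hB : 0 ≤ B) (hwB : w * B ≤ lv) (hC : 0 ≤ C) (hP : ‖P‖ ≤ C)
    (hg : ‖g‖ ≤ C) (hℓ : 0 ≤ ℓ) (hX : w * ‖δ‖ ^ 2 ≤ X) :
    1 / 4 * ‖P‖ ^ 2 + 1 / 2 * ‖G‖ ^ 2 ≤ 1 / 2 * ‖P - G‖ ^ 2 + w ^ 2 * ‖ε‖ ^ 2 + -inner ℝ P (g - G)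
      + C ^ 2 * lv + 1 / γ * (w * (φ - φ')) + ℓ / γ * X := by
  have h1 : inner ℝ P δ = -γ * (A * inner ℝ P g - B * inner ℝ P g + inner ℝ P ε) := by
    rw [hδ, real_inner_smul_right, inner_add_right, inner_sub_right, real_inner_smul_right,
      real_inner_smul_right]
  have h2 : -(w * inner ℝ P ε) ≤ 1 / 4 * ‖P‖ ^ 2 + w ^ 2 * ‖ε‖ ^ 2 := by
    have := neg_inner_le_weighted (a := P) (b := w • ε) (t := 1 / 4) (by norm_num)
    rw [real_inner_smul_right, norm_smul, mul_pow, Real.norm_eq_abs, sq_abs] at this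
    linarith
  have h3 : w * B * inner ℝ P g ≤ C ^ 2 * lv := by
    have a1 : inner ℝ P g ≤ C * C := (real_inner_le_norm P g).trans
      (mul_le_mul hP hg (norm_nonneg _) hC)
    have a2 : 0 ≤ w * B := mul_nonneg hw hB
    nlinarith [mul_le_mul_of_nonneg_left a1 a2, mul_le_mul_of_nonneg_left hwB (sq_nonneg C)]
  have h4 : ‖P - G‖ ^ 2 = ‖P‖ ^ 2 - 2 * inner ℝ P G + ‖G‖ ^ 2 := norm_sub_sq_real P G
  rw [inner_sub_right]
  have h5 : 0 ≤ w / γ := by positivity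
  have h6 := mul_le_mul_of_nonneg_left hφ h5
  rw [h1] at h6
  have h7 : w / γ * (-γ * (A * inner ℝ P g - B * inner ℝ P g + inner ℝ P ε))
      = -(w * A * inner ℝ P g) + w * B * inner ℝ P g - w * inner ℝ P ε := by field_simp; ring
  have h8 := mul_le_mul_of_nonneg_left hX (by positivity : 0 ≤ ℓ / γ)
  have h9 : w / γ * (ℓ * ‖δ‖ ^ 2) = ℓ / γ * (w * ‖δ‖ ^ 2) := by ring
  have h10 : 1 / γ * (w * (φ - φ')) = w / γ * φ - w / γ * φ' := by ring
  rw [mul_add, mul_add, h7, h9, hwA] at h6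
  rw [h10]
  linarith

-- With `U = u ^ β = η⁻¹` the contraction of the lag gains `U t ‖r‖² = θ ‖r‖²`. The cross terms with
-- `G` and `ε` take `θ / 4` each; the one with `g - G` is kept as noise.
set_option maxHeartbeats 800000 in
lemma lag_step {g G r r' ε δ : E} {γ A B w U η t θ lv C ρ kU X : ℝ} (hγ : 0 < γ) (hθ : 0 < θ)
    (hr : r' = (1 - t) • r + δ) (hδ : δ = -γ • (A • g - B • g + ε)) (ht : t = θ * η)
    (ht0 : 0 ≤ t) (ht1 : t ≤ 1) (hUη : U * η = 1) (hU : 0 ≤ U) (hwA : w * A = 1) (hB : 0 ≤ B)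
    (hwB : w * B ≤ lv) (hC : 0 ≤ C) (hg : ‖g‖ ≤ C) (hρ : ‖r‖ ≤ ρ) (hkU : 0 ≤ kU)
    (hUw : U ≤ kU * w) (hX : w * ‖δ‖ ^ 2 ≤ X) :
    θ / 2 * ‖r‖ ^ 2 ≤ U * (‖r‖ ^ 2 - ‖r'‖ ^ 2)
      + 4 * γ ^ 2 / θ * ((U * A) ^ 2 * (‖G‖ ^ 2 + w ^ 2 * ‖ε‖ ^ 2))
      + -(2 * γ * (1 - t) * U * A) * inner ℝ r (g - G) + 2 * γ * ρ * C * kU * lv + kU * X := by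
  have h1 : inner ℝ r δ = -γ * (A * inner ℝ r g - B * inner ℝ r g + inner ℝ r ε) := by
    rw [hδ, real_inner_smul_right, inner_add_right, inner_sub_right, real_inner_smul_right,
      real_inner_smul_right]
  have h2 : ‖r'‖ ^ 2 = (1 - t) ^ 2 * ‖r‖ ^ 2 + 2 * ((1 - t) * inner ℝ r δ) + ‖δ‖ ^ 2 := by
    rw [hr, norm_add_sq_real, norm_smul, mul_pow, Real.norm_eq_abs, sq_abs, real_inner_smul_left]
  have h3 : ‖r'‖ ^ 2 ≤ (1 - t) * ‖r‖ ^ 2 + 2 * ((1 - t) * inner ℝ r δ) + ‖δ‖ ^ 2 := by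
    rw [h2]
    have : (1 - t) ^ 2 ≤ 1 - t := by nlinarith
    nlinarith [sq_nonneg ‖r‖, mul_le_mul_of_nonneg_right this (sq_nonneg ‖r‖)]
  have hUt : U * t = θ := by rw [ht]; linear_combination θ * hUη
  have h4 := mul_le_mul_of_nonneg_left h3 hU
  have hs0 : 0 ≤ 1 - t := by linarith
  have hs1 : (1 - t) ^ 2 ≤ 1 := by nlinarith
  have h5 : -(2 * γ * (1 - t) * U * A * inner ℝ r G)
      ≤ θ / 4 * ‖r‖ ^ 2 + 4 * γ ^ 2 / θ * ((U * A) ^ 2 * ‖G‖ ^ 2) := by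
    have := neg_inner_le_weighted (a := r) (b := (2 * γ * (1 - t) * U * A) • G) (t := θ / 4)
      (by positivity)
    rw [real_inner_smul_right, norm_smul, mul_pow, Real.norm_eq_abs, sq_abs] at this
    have e : 1 / (4 * (θ / 4)) * ((2 * γ * (1 - t) * U * A) ^ 2 * ‖G‖ ^ 2)
        = (1 - t) ^ 2 * (4 * γ ^ 2 / θ * ((U * A) ^ 2 * ‖G‖ ^ 2)) := by field_simp; ring
    have e2 : 0 ≤ 4 * γ ^ 2 / θ * ((U * A) ^ 2 * ‖G‖ ^ 2) := by positivity
    rw [e] at this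
    linarith [mul_le_mul_of_nonneg_right hs1 e2]
  have h6 : -(2 * γ * (1 - t) * U * inner ℝ r ε)
      ≤ θ / 4 * ‖r‖ ^ 2 + 4 * γ ^ 2 / θ * ((U * A) ^ 2 * (w ^ 2 * ‖ε‖ ^ 2)) := by
    have := neg_inner_le_weighted (a := r) (b := (2 * γ * (1 - t) * U) • ε) (t := θ / 4)
      (by positivity)
    rw [real_inner_smul_right, norm_smul, mul_pow, Real.norm_eq_abs, sq_abs] at this
    have e : 1 / (4 * (θ / 4)) * ((2 * γ * (1 - t) * U) ^ 2 * ‖ε‖ ^ 2)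
        = (1 - t) ^ 2 * (4 * γ ^ 2 / θ * (U ^ 2 * ‖ε‖ ^ 2)) := by field_simp; ring
    have e2 : 0 ≤ 4 * γ ^ 2 / θ * (U ^ 2 * ‖ε‖ ^ 2) := by positivity
    have e3 : (U * A) ^ 2 * (w ^ 2 * ‖ε‖ ^ 2) = U ^ 2 * ‖ε‖ ^ 2 := by
      have : (w * A) ^ 2 = 1 := by rw [hwA]; norm_num
      linear_combination U ^ 2 * ‖ε‖ ^ 2 * this
    rw [e] at this
    rw [e3]
    linarith [mul_le_mul_of_nonneg_right hs1 e2]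
  have h7 : 2 * γ * (1 - t) * U * B * inner ℝ r g ≤ 2 * γ * ρ * C * kU * lv := by
    have hρ0 : 0 ≤ ρ := (norm_nonneg _).trans hρ
    have a1 : inner ℝ r g ≤ ρ * C := (real_inner_le_norm r g).trans
      (mul_le_mul hρ hg (norm_nonneg _) hρ0)
    have a2 : U * B ≤ kU * lv := by
      linarith [mul_le_mul_of_nonneg_right hUw hB, mul_le_mul_of_nonneg_left hwB hkU]
    have a3 : 0 ≤ U * B := mul_nonneg hU hB
    have a4 : (1 - t) * (U * B) ≤ kU * lv :=
      (mul_le_of_le_one_left a3 (by linarith)).trans a2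
    have a5 : 0 ≤ (1 - t) * (U * B) := mul_nonneg hs0 a3
    calc _ = 2 * γ * ((1 - t) * (U * B) * inner ℝ r g) := by ring
      _ ≤ 2 * γ * ((1 - t) * (U * B) * (ρ * C)) := by gcongr
      _ ≤ 2 * γ * (kU * lv * (ρ * C)) := by gcongr
      _ = _ := by ring
  have h8 : U * ‖δ‖ ^ 2 ≤ kU * X := by
    calc _ ≤ kU * w * ‖δ‖ ^ 2 := by gcongr
      _ = kU * (w * ‖δ‖ ^ 2) := by ring
      _ ≤ _ := by gcongr
  rw [inner_sub_right]
  rw [h1] at h4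
  have h9 : U * ((1 - t) * ‖r‖ ^ 2) = U * ‖r‖ ^ 2 - θ * ‖r‖ ^ 2 := by rw [← hUt]; ring
  linarith

/-- Change of target from `q` to `q'`, with the Young term placed on the new error. -/
lemma norm_sq_sub_le_of_shift {y q q' : E} {t : ℝ} (ht : 0 < t) :
    ‖y - q'‖ ^ 2 ≤ ‖y - q‖ ^ 2 + t * ‖y - q'‖ ^ 2 + 1 / t * ‖q' - q‖ ^ 2 := by
  have h1 : ‖y - q‖ ^ 2 = ‖y - q'‖ ^ 2 + 2 * inner ℝ (y - q') (q' - q) + ‖q' - q‖ ^ 2 := by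
    rw [← norm_add_sq_real]; congr 2; abel
  have h2 := neg_inner_le_weighted (a := y - q') (b := q' - q) (t := t / 2) (by positivity)
  have e : 1 / (4 * (t / 2)) = 1 / (2 * t) := by ring
  have e2 : 1 / t * ‖q' - q‖ ^ 2 = 2 * (1 / (2 * t) * ‖q' - q‖ ^ 2) := by field_simp
  rw [e] at h2
  nlinarith [sq_nonneg ‖q' - q‖]

/-- Drops the variance. Mean gradients are thus bounded by sampled ones up to a term of mean zero.
-/
lemma norm_sq_le_of_mean {g G : E} : ‖G‖ ^ 2 ≤ ‖g‖ ^ 2 + -2 * inner ℝ G (g - G) := by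
  have h : ‖g‖ ^ 2 = ‖G‖ ^ 2 + 2 * inner ℝ G (g - G) + ‖g - G‖ ^ 2 := by
    rw [← norm_add_sq_real]; congr 2; abel
  nlinarith [sq_nonneg ‖g - G‖]

end abstract_steps

/-- Bound of the local stepsizes relative to the reference stepsize. -/
noncomputable def stepM (n p d : ℕ) (Z : ℝ) : ℝ := 1 + Real.sqrt (n * p * Z) + Real.sqrt (n * d * Z)

lemma one_le_stepM (n p d : ℕ) (Z : ℝ) : 1 ≤ stepM n p d Z := by
  unfold stepM
  linarith [Real.sqrt_nonneg (n * p * Z), Real.sqrt_nonneg (n * d * Z)]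

/-- Ratio of `u ^ β` and `v ^ α`. -/
noncomputable def ratioBound (n p d : ℕ) (Z α β c : ℝ) : ℝ :=
  (stepM n p d Z ^ (1 / β) * p) ^ β * c ^ (β - α)

/-! ### Descent of `Φ` and the lag, along a trajectory. -/

namespace Run

variable {n p d : ℕ} {Ξ : Type*} [MeasurableSpace Ξ] {P : Problem n p d Ξ}
  {W : Matrix (Fin n) (Fin n) ℝ} {H : Hyper} {μ L C c c' R Δ Z : ℝ}
  {s : ℕ → State n p d} {gx : ℕ → Fin n → Vec p} {gy : ℕ → Fin n → Vec d}

lemma α_pos (h : Run P W H μ L C c c' R Δ Z s gx gy) : 0 < H.α := h.hβ.trans h.hα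

lemma V_rpow_le (h : Run P W H μ L C c c' R Δ Z s gx gy) (k : ℕ) (i : Fin n) (j : Fin p) :
    (s k).V i j ^ (-H.α) ≤ stepM n p d Z * (s k).vref ^ (-H.α) := by
  have h1 := vref_le_avg_V (s k)
  have h0 := h.vref_pos k
  have hα := h.α_pos
  refine (rpow_neg_le_of_incons_le h.hn h.hp (h0.trans_le h1) (h.iV k) i j).trans ?_
  have h2 : avg (s k).V ^ (-H.α) ≤ (s k).vref ^ (-H.α) :=
    Real.rpow_le_rpow_of_nonpos h0 h1 (by linarith)
  have h3 : 0 < (s k).vref ^ (-H.α) := by positivity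
  have h4 : 1 + Real.sqrt (n * p * Z) ≤ stepM n p d Z := by
    unfold stepM; linarith [Real.sqrt_nonneg (n * d * Z)]
  have h5 : 0 ≤ 1 + Real.sqrt (n * p * Z) := by positivity
  exact mul_le_mul h4 h2 (Real.rpow_nonneg (h0.le.trans h1) _) (h5.trans h4)

lemma U_rpow_le (h : Run P W H μ L C c c' R Δ Z s gx gy) (k : ℕ) (i : Fin n) (j : Fin d) :
    (s k).U i j ^ (-H.β) ≤ stepM n p d Z * avg (s k).U ^ (-H.β) := by
  have h0 := h.avg_U_pos k
  refine (rpow_neg_le_of_incons_le h.hn h.hd h0 (h.iU k) i j).trans ?_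
  have h3 : 0 < avg (s k).U ^ (-H.β) := by positivity
  refine mul_le_mul_of_nonneg_right ?_ h3.le
  unfold stepM; linarith [Real.sqrt_nonneg (n * p * Z)]

lemma u_rpow_mul_le (h : Run P W H μ L C c c' R Δ Z s gx gy) (k : ℕ) :
    avg (s k).U ^ H.β ≤ (stepM n p d Z ^ (1 / H.β) * p) ^ H.β * (s k).vref ^ H.β := by
  have hm := one_le_stepM n p d Z
  have h1 := h.avg_U_le hm k (h.U_rpow_le k)
  have h2 : 0 ≤ stepM n p d Z ^ (1 / H.β) * p := by positivity
  rw [← Real.mul_rpow h2 (h.vref_pos k).le]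
  exact Real.rpow_le_rpow (h.avg_U_pos k).le h1 h.hβ.le

lemma u_rpow_le (h : Run P W H μ L C c c' R Δ Z s gx gy) (k : ℕ) :
    avg (s k).U ^ H.β ≤ ratioBound n p d Z H.α H.β c * (s k).vref ^ H.α := by
  refine (h.u_rpow_mul_le k).trans ?_
  have hm := one_le_stepM n p d Z
  have h2 : 0 ≤ (stepM n p d Z ^ (1 / H.β) * p) ^ H.β := by positivity
  rw [ratioBound, mul_assoc]
  refine mul_le_mul_of_nonneg_left ?_ h2
  have hv := h.vref_pos k
  have e : (s k).vref ^ H.β = (s k).vref ^ (H.β - H.α) * (s k).vref ^ H.α := by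
    rw [← Real.rpow_add hv]; congr 1; ring
  rw [e]
  refine mul_le_mul_of_nonneg_right ?_ (by positivity)
  exact Real.rpow_le_rpow_of_nonpos h.hc (h.accumX.lower k) (by linarith [h.hα])

lemma ratioBound_nonneg (h : Run P W H μ L C c c' R Δ Z s gx gy) :
    0 ≤ ratioBound n p d Z H.α H.β c := by
  have hm := one_le_stepM n p d Z
  have := h.hc
  unfold ratioBound; positivity

lemma vref_rpow_succ_le (h : Run P W H μ L C c c' R Δ Z s gx gy) (k : ℕ) :
    (s (k + 1)).vref ^ (-H.α) ≤ (s k).vref ^ (-H.α) :=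
  Real.rpow_le_rpow_of_nonpos (h.vref_pos k) (h.vref_mono (Nat.le_succ k)) (by linarith [h.α_pos])

lemma avg_U_rpow_succ_le (h : Run P W H μ L C c c' R Δ Z s gx gy) (k : ℕ) :
    avg (s (k + 1)).U ^ (-H.β) ≤ avg (s k).U ^ (-H.β) :=
  Real.rpow_le_rpow_of_nonpos (h.avg_U_pos k) (h.avg_U_mono (Nat.le_succ k)) (by linarith [h.hβ])

lemma nonempty (h : Run P W H μ L C c c' R Δ Z s gx gy) : P.Y.Nonempty := ⟨_, h.y0 ⟨0, h.hn⟩⟩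

lemma yStar_mem (h : Run P W H μ L C c c' R Δ Z s gx gy) (x : Vec p) : P.yStar x ∈ P.Y :=
  (Problem.yStar_spec h.hn h.hμ h.setting h.conc h.smooth h.grad h.nonempty x).1

lemma y_succ (h : Run P W H μ L C c c' R Δ Z s gx gy) (k : ℕ) (i : Fin n) :
    (s (k + 1)).y i = proj P.Y (mix W (fun i => (s k).y i
      + H.γy • had (fun j => (s (k + 1)).U i j ^ (-H.β)) (gy k i)) i) := by
  rw [h.succ k]; rfl

lemma x_succ (h : Run P W H μ L C c c' R Δ Z s gx gy) (k : ℕ) :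
    (s (k + 1)).x = mix W fun i => (s k).x i
      + -(H.γx • had (fun j => (s (k + 1)).V i j ^ (-H.α)) (gx k i)) := by
  simp only [← sub_eq_add_neg]
  rw [h.succ k]; rfl

lemma y_mem (h : Run P W H μ L C c c' R Δ Z s gx gy) (k : ℕ) (i : Fin n) : (s k).y i ∈ P.Y := by
  cases k with
  | zero => exact h.y0 i
  | succ k =>
    rw [h.y_succ]
    exact proj_mem h.setting.closed h.setting.convex h.nonempty _

lemma ybar_mem (h : Run P W H μ L C c c' R Δ Z s gx gy) (k : ℕ) : (s k).ybar ∈ P.Y := by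
  rw [State.ybar, nmean, Finset.smul_sum]
  have hn : (0 : ℝ) < n := by exact_mod_cast h.hn
  refine h.setting.convex.sum_mem (fun i _ => by positivity) ?_ fun i _ => h.y_mem k i
  simp [hn.ne']

lemma norm_sub_le (h : Run P W H μ L C c c' R Δ Z s gx gy) {y y' : Vec d} (hy : y ∈ P.Y)
    (hy' : y' ∈ P.Y) : ‖y - y'‖ ≤ 2 * C / μ :=
  Problem.norm_sub_le_of_mem h.hn h.hμ h.setting h.conc h.grad 0 hy hy'

lemma sum_norm_sub_sq_le (h : Run P W H μ L C c c' R Δ Z s gx gy) {y : Vec d} (hy : y ∈ P.Y)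
    (k : ℕ) : ∑ i, ‖(s k).y i - y‖ ^ 2 ≤ n * (2 * C / μ) ^ 2 := by
  have := Finset.sum_le_sum fun i (_ : i ∈ Finset.univ) =>
    pow_le_pow_left₀ (norm_nonneg _) (h.norm_sub_le (h.y_mem k i) hy) 2
  simpa using this

lemma abs_V_rpow_le (h : Run P W H μ L C c c' R Δ Z s gx gy) (k : ℕ) (i : Fin n) (j : Fin p) :
    |(s (k + 1)).V i j ^ (-H.α)| ≤ stepM n p d Z * (s k).vref ^ (-H.α) := by
  have h1 : 0 < (s (k + 1)).V i j := h.hc.trans_le (h.le_V (k + 1) i j)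
  rw [abs_of_pos (by positivity)]
  refine (h.V_rpow_le (k + 1) i j).trans ?_
  exact mul_le_mul_of_nonneg_left (h.vref_rpow_succ_le k)
    (zero_le_one.trans (one_le_stepM n p d Z))

lemma abs_U_rpow_le (h : Run P W H μ L C c c' R Δ Z s gx gy) (k : ℕ) (i : Fin n) (j : Fin d) :
    |(s (k + 1)).U i j ^ (-H.β)| ≤ stepM n p d Z * avg (s k).U ^ (-H.β) := by
  have h1 : 0 < (s (k + 1)).U i j := h.hc.trans_le (h.le_U (k + 1) i j)
  rw [abs_of_pos (by positivity)]
  refine (h.U_rpow_le (k + 1) i j).trans ?_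
  exact mul_le_mul_of_nonneg_left (h.avg_U_rpow_succ_le k)
    (zero_le_one.trans (one_le_stepM n p d Z))

lemma xbar_succ_sub (h : Run P W H μ L C c c' R Δ Z s gx gy) (k : ℕ) :
    (s (k + 1)).xbar - (s k).xbar
      = -H.γx • nmean fun i => had (fun j => (s (k + 1)).V i j ^ (-H.α)) (gx k i) := by
  have h1 : (s (k + 1)).xbar = nmean (s (k + 1)).x := rfl
  have h2 : (s k).xbar = nmean (s k).x := rfl
  rw [h1, h.x_succ, nmean_mix h.hW, nmean_add, h2, add_sub_cancel_left]
  simp only [← neg_smul]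
  rw [nmean_smul]

/-- The primal step in three parts: a stepsize determined by the past, the decrease of that stepsize
during the iteration, and the mismatch between nodes and coordinates. -/
lemma nmean_had_eq (k : ℕ) :
    (nmean fun i => had (fun j => (s (k + 1)).V i j ^ (-H.α)) (gx k i))
      = (s k).vref ^ (-H.α) • nmean (gx k)
        - ((s k).vref ^ (-H.α) - (s (k + 1)).vref ^ (-H.α)) • nmean (gx k)
        + nmean fun i => had (fun j => (s (k + 1)).V i j ^ (-H.α) - (s (k + 1)).vref ^ (-H.α))
          (gx k i) := by
  rw [← sub_smul, sub_sub_cancel, ← nmean_smul, ← nmean_add]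
  congr 1; ext1 i
  rw [← had_const, ← had_add]
  congr 1; ext j; ring

lemma xbar_step_sq_le (h : Run P W H μ L C c c' R Δ Z s gx gy) (k : ℕ) :
    (s k).vref ^ H.α * ‖(s (k + 1)).xbar - (s k).xbar‖ ^ 2
      ≤ H.γx ^ 2 * stepM n p d Z ^ 2 * ((s k).vref ^ (-H.α) * ∑ i, ‖gx k i‖ ^ 2) := by
  have hv := h.vref_pos k
  rw [h.xbar_succ_sub, norm_smul, mul_pow, norm_neg, Real.norm_eq_abs, sq_abs]
  have h1 := norm_nmean_sq_le_sum h.hn fun i =>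
    had (fun j => (s (k + 1)).V i j ^ (-H.α)) (gx k i)
  have h2 := Finset.sum_le_sum fun i (_ : i ∈ Finset.univ) =>
    norm_had_sq_le (h.abs_V_rpow_le k i) (gx k i)
  rw [← Finset.mul_sum] at h2
  have e : (s k).vref ^ H.α * (s k).vref ^ (-H.α) = 1 := by
    rw [← Real.rpow_add hv]; simp
  calc _ ≤ (s k).vref ^ H.α * (H.γx ^ 2 * ((stepM n p d Z * (s k).vref ^ (-H.α)) ^ 2
        * ∑ i, ‖gx k i‖ ^ 2)) := by gcongr; exact h1.trans h2
    _ = (s k).vref ^ H.α * (s k).vref ^ (-H.α) * (H.γx ^ 2 * stepM n p d Z ^ 2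
        * ((s k).vref ^ (-H.α) * ∑ i, ‖gx k i‖ ^ 2)) := by ring
    _ = _ := by rw [e, one_mul]

lemma norm_xbar_step_le (h : Run P W H μ L C c c' R Δ Z s gx gy) (k : ℕ) :
    ‖(s (k + 1)).xbar - (s k).xbar‖ ≤ H.γx * (stepM n p d Z * (s k).vref ^ (-H.α) * C) := by
  have hv := h.vref_pos k
  have hm := one_le_stepM n p d Z
  have := h.hγx
  rw [h.xbar_succ_sub, norm_smul, norm_neg, Real.norm_of_nonneg h.hγx.le]
  refine mul_le_mul_of_nonneg_left (norm_nmean_le h.hn fun i => ?_) h.hγx.le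
  refine (norm_had_le (by positivity) (h.abs_V_rpow_le k i) (gx k i)).trans ?_
  exact mul_le_mul_of_nonneg_left (h.bx k i) (by positivity)

/-- The choice `θ = c ^ β` makes the relaxation of `lagRef` a convex combination, because `u ≥ c`.
-/
lemma theta_eta_le_one (h : Run P W H μ L C c c' R Δ Z s gx gy) (k : ℕ) :
    0 ≤ c ^ H.β * avg (s k).U ^ (-H.β) ∧ c ^ H.β * avg (s k).U ^ (-H.β) ≤ 1 := by
  have hu := h.avg_U_pos k
  have hc := h.hc
  refine ⟨by positivity, ?_⟩
  have h1 : avg (s k).U ^ (-H.β) ≤ c ^ (-H.β) :=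
    Real.rpow_le_rpow_of_nonpos hc (h.accumY.lower k) (by linarith [h.hβ])
  calc _ ≤ c ^ H.β * c ^ (-H.β) := by gcongr
    _ = 1 := by rw [← Real.rpow_add hc]; simp

lemma lag_succ (k : ℕ) : (s (k + 1)).xbar - lagRef c H.β s (k + 1)
    = (1 - c ^ H.β * avg (s k).U ^ (-H.β)) • ((s k).xbar - lagRef c H.β s k)
      + ((s (k + 1)).xbar - (s k).xbar) := by
  rw [lagRef, sub_smul, one_smul]; abel

/-- Bound of the lag of the reference sequence. -/
noncomputable def lagBound (n p d : ℕ) (H : Hyper) (C c Z : ℝ) : ℝ :=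
  H.γx * stepM n p d Z * C * ratioBound n p d Z H.α H.β c / c ^ H.β

lemma lagBound_nonneg (h : Run P W H μ L C c c' R Δ Z s gx gy) : 0 ≤ lagBound n p d H C c Z := by
  have hm := one_le_stepM n p d Z
  have h1 := h.ratioBound_nonneg
  have h2 := h.hC
  have h3 := h.hc
  have h4 := h.hγx
  unfold lagBound; positivity

/-- Each primal step is at most `t · lagBound`, where `t` is the relaxation weight, so `(1 - t)
lagBound + t lagBound` reproduces the bound. -/
lemma norm_lag_le (h : Run P W H μ L C c c' R Δ Z s gx gy) (k : ℕ) :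
    ‖(s k).xbar - lagRef c H.β s k‖ ≤ lagBound n p d H C c Z := by
  induction k with
  | zero => simpa [lagRef] using h.lagBound_nonneg
  | succ k ih =>
    obtain ⟨t0, t1⟩ := h.theta_eta_le_one k
    have hc := h.hc
    have hv := h.vref_pos k
    have hu := h.avg_U_pos k
    have hm := one_le_stepM n p d Z
    have h4 := h.hγx
    have h5 := h.hC
    rw [lag_succ]
    have h1 : (s k).vref ^ (-H.α) ≤ ratioBound n p d Z H.α H.β c * avg (s k).U ^ (-H.β) := by
      have h2 := h.u_rpow_le k
      rw [Real.rpow_neg hv.le, Real.rpow_neg hu.le, ← div_eq_mul_inv,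
        le_div_iff₀ (by positivity), inv_mul_le_iff₀ (by positivity)]
      linarith
    have h2 : H.γx * (stepM n p d Z * (s k).vref ^ (-H.α) * C)
        ≤ (c ^ H.β * avg (s k).U ^ (-H.β)) * lagBound n p d H C c Z := by
      calc _ ≤ H.γx * (stepM n p d Z * (ratioBound n p d Z H.α H.β c
            * avg (s k).U ^ (-H.β)) * C) := by gcongr
        _ = _ := by unfold lagBound; field_simp
    refine (norm_add_le _ _).trans ?_
    rw [norm_smul, Real.norm_of_nonneg (by linarith)]
    have h3 := mul_le_mul_of_nonneg_left ih (by linarith :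
      0 ≤ 1 - c ^ H.β * avg (s k).U ^ (-H.β))
    have h6 := (h.norm_xbar_step_le k).trans h2
    linarith

lemma norm_avgX_le (h : Run P W H μ L C c c' R Δ Z s gx gy) (x : Vec p) {y : Vec d}
    (hy : y ∈ P.Y) : ‖P.avgX x y‖ ≤ C :=
  norm_nmean_le h.hn fun i => Problem.norm_gradX_le h.setting h.grad i x hy

lemma nmean_gx_sub (P : Problem n p d Ξ) (gx : ℕ → Fin n → Vec p) (s : ℕ → State n p d) (k : ℕ) :
    (nmean fun i => gx k i - P.gradX i ((s k).x i) ((s k).y i)) = nmean (gx k) - P.netX (s k) := by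
  rw [nmean_sub]; rfl

lemma vref_log_bound (h : Run P W H μ L C c c' R Δ Z s gx gy) (k : ℕ) :
    (s k).vref ^ H.α * ((s k).vref ^ (-H.α) - (s (k + 1)).vref ^ (-H.α))
      ≤ Real.log (s (k + 1)).vref - Real.log (s k).vref :=
  rpow_mul_sub_le_log (h.vref_pos k) (h.vref_mono (Nat.le_succ k)) h.hα1.le

lemma descent (h : Run P W H μ L C c c' R Δ Z s gx gy) (k : ℕ) :
    1 / 4 * (pathSeqs P H c s gx gy).P2 k + 1 / 2 * (pathSeqs P H c s gx gy).G2 k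
      ≤ 1 / 2 * (pathSeqs P H c s gx gy).Q k + (pathSeqs P H c s gx gy).ev k
      + (pathSeqs P H c s gx gy).noiseDescent k
      + C ^ 2 * (Real.log (s (k + 1)).vref - Real.log (s k).vref)
      + 1 / H.γx * ((s k).vref ^ H.α * (P.Phi (s k).xbar - P.Phi (s (k + 1)).xbar))
      + (L + 2 * L * (L / μ)) / H.γx * (H.γx ^ 2 * stepM n p d Z ^ 2
        * ((s k).vref ^ (-H.α) * ∑ i, ‖gx k i‖ ^ 2)) := by
  have hv := h.vref_pos k
  have hL := h.hL
  have hμ := h.hμ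
  have h1 := Problem.abs_Phi_sub_le h.hn h.hμ h.hL h.setting h.conc h.smooth h.grad h.nonempty
    (s k).xbar (s (k + 1)).xbar
  have h2 : P.Phi (s (k + 1)).xbar ≤ P.Phi (s k).xbar
      + inner ℝ (P.avgX (s k).xbar (P.yStar (s k).xbar)) ((s (k + 1)).xbar - (s k).xbar)
      + (L + 2 * L * (L / μ)) * ‖(s (k + 1)).xbar - (s k).xbar‖ ^ 2 := by
    linarith [(abs_le.1 h1).2]
  have e : (s k).vref ^ H.α * (s k).vref ^ (-H.α) = 1 := by
    rw [← Real.rpow_add hv]; simp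
  have := descent_step (G := P.netX (s k)) (C := C) h.hγx h2
    (by rw [h.xbar_succ_sub, nmean_had_eq]) e (by positivity)
    (sub_nonneg.2 (h.vref_rpow_succ_le k)) (h.vref_log_bound k) h.hC.le
    (h.norm_avgX_le _ (h.yStar_mem _)) (norm_nmean_le h.hn (h.bx k)) (by positivity)
    (h.xbar_step_sq_le k)
  simp only [pathSeqs, nmean_gx_sub]
  exact this

lemma lag (h : Run P W H μ L C c c' R Δ Z s gx gy) (k : ℕ) :
    c ^ H.β / 2 * (pathSeqs P H c s gx gy).r2 k ≤ avg (s k).U ^ H.β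
        * ((pathSeqs P H c s gx gy).r2 k - (pathSeqs P H c s gx gy).r2 (k + 1))
      + 4 * H.γx ^ 2 / c ^ H.β * ((stepM n p d Z ^ (1 / H.β) * p) ^ H.β) ^ 2
        * ((s k).vref ^ (-(2 * (H.α - H.β)))
          * ((pathSeqs P H c s gx gy).G2 k + (pathSeqs P H c s gx gy).ev k))
      + (pathSeqs P H c s gx gy).noiseLag k
      + 2 * H.γx * lagBound n p d H C c Z * C * ratioBound n p d Z H.α H.β c
        * (Real.log (s (k + 1)).vref - Real.log (s k).vref)
      + ratioBound n p d Z H.α H.β c * (H.γx ^ 2 * stepM n p d Z ^ 2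
        * ((s k).vref ^ (-H.α) * ∑ i, ‖gx k i‖ ^ 2)) := by
  have hv := h.vref_pos k
  have hu := h.avg_U_pos k
  have hc := h.hc
  have hγ := h.hγx
  obtain ⟨t0, t1⟩ := h.theta_eta_le_one k
  have e : (s k).vref ^ H.α * (s k).vref ^ (-H.α) = 1 := by
    rw [← Real.rpow_add hv]; simp
  have e2 : avg (s k).U ^ H.β * avg (s k).U ^ (-H.β) = 1 := by
    rw [← Real.rpow_add hu]; simp
  have := lag_step (G := P.netX (s k)) (C := C) h.hγx (Real.rpow_pos_of_pos hc H.β)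
    (lag_succ (s := s) (H := H) (c := c) k)
    (by rw [h.xbar_succ_sub, nmean_had_eq]) rfl t0 t1 e2 (by positivity) e
    (sub_nonneg.2 (h.vref_rpow_succ_le k)) (h.vref_log_bound k) h.hC.le
    (norm_nmean_le h.hn (h.bx k)) (h.norm_lag_le k) h.ratioBound_nonneg (h.u_rpow_le k)
    (h.xbar_step_sq_le k)
  simp only [pathSeqs, nmean_gx_sub]
  -- Here `u ^ β` is compared with `v ^ β`, not with `v ^ α`: the surplus `v ^ (β - α)` is the
  -- separation of the two time scales.
  have h3 : (avg (s k).U ^ H.β * (s k).vref ^ (-H.α)) ^ 2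
      ≤ ((stepM n p d Z ^ (1 / H.β) * p) ^ H.β) ^ 2 * (s k).vref ^ (-(2 * (H.α - H.β))) := by
    have h4 := mul_le_mul_of_nonneg_right (h.u_rpow_mul_le k)
      (by positivity : 0 ≤ (s k).vref ^ (-H.α))
    have h5 := pow_le_pow_left₀ (by positivity) h4 2
    refine h5.trans (le_of_eq ?_)
    rw [mul_assoc, mul_pow]
    congr 1
    rw [← Real.rpow_add hv, ← Real.rpow_natCast, ← Real.rpow_mul hv.le]
    congr 1; push_cast; ring
  refine this.trans ?_
  gcongr ?_ + ?_ + _ + _ + _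
  · exact le_rfl
  · rw [mul_assoc (4 * H.γx ^ 2 / c ^ H.β), ← mul_assoc (((stepM n p d Z ^ (1 / H.β) * p) ^ H.β) ^ 2)]
    gcongr

end Run

/-! ### Gradient error, consensus, stepsize mismatch and dual tracking, along a trajectory. -/

namespace Run

variable {n p d : ℕ} {Ξ : Type*} [MeasurableSpace Ξ] {P : Problem n p d Ξ}
  {W : Matrix (Fin n) (Fin n) ℝ} {H : Hyper} {μ L C c c' R Δ Z : ℝ}
  {s : ℕ → State n p d} {gx : ℕ → Fin n → Vec p} {gy : ℕ → Fin n → Vec d}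

/-- Passes through `∇ₓ f(x̄, ȳ)`. The distance from `y*(x̄)` to `ȳ` is split at `y*` of the lagging
point, and the remaining difference is a consensus error. -/
lemma error (h : Run P W H μ L C c c' R Δ Z s gx gy) (k : ℕ) :
    (pathSeqs P H c s gx gy).Q k
      ≤ 2 * L ^ 2 * (2 * ((pathSeqs P H c s gx gy).D k / n)
        + 8 * (L / μ) ^ 2 * (pathSeqs P H c s gx gy).r2 k)
      + 2 * L ^ 2 / n * ((pathSeqs P H c s gx gy).cx k + (pathSeqs P H c s gx gy).cy k) := by
  have hn : (0 : ℝ) < n := by exact_mod_cast h.hn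
  have hL := h.hL
  have hμ := h.hμ
  simp only [pathSeqs]
  have h1 := Problem.norm_avgX_sub_le' h.hn h.hL h.smooth (s k).xbar
    (h.yStar_mem (s k).xbar) (h.ybar_mem k)
  have h2 := Problem.norm_yStar_sub_le h.hn h.hμ h.hL h.setting h.conc h.smooth h.grad h.nonempty
    (s k).xbar (lagRef c H.β s k)
  have h3 : ‖P.avgX (s k).xbar (s k).ybar - P.netX (s k)‖ ^ 2
      ≤ L ^ 2 / n * (∑ i, ‖(s k).x i - (s k).xbar‖ ^ 2 + ∑ i, ‖(s k).y i - (s k).ybar‖ ^ 2) := by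
    rw [Problem.avgX, Problem.netX, ← nmean_sub]
    refine (norm_nmean_sq_le h.hn _).trans ?_
    rw [one_div_mul_eq_div, div_mul_eq_mul_div]
    gcongr
    rw [← Finset.sum_add_distrib, Finset.mul_sum]
    refine Finset.sum_le_sum fun i _ => ?_
    have := h.smooth.lipX i (s k).xbar ((s k).x i) _ (h.ybar_mem k) _ (h.y_mem k i)
    rwa [norm_sub_rev (s k).xbar, norm_sub_rev (s k).ybar] at this
  have h4 : (n : ℝ) * ‖(s k).ybar - P.yStar (lagRef c H.β s k)‖ ^ 2
      ≤ ∑ i, ‖(s k).y i - P.yStar (lagRef c H.β s k)‖ ^ 2 := by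
    rw [sum_norm_sub_sq h.hn]
    have : 0 ≤ ∑ i, ‖(s k).y i - nmean (s k).y‖ ^ 2 := by positivity
    rw [State.ybar]
    linarith
  set D := ∑ i, ‖(s k).y i - P.yStar (lagRef c H.β s k)‖ ^ 2
  set r := ‖(s k).xbar - lagRef c H.β s k‖
  have h5 : ‖(s k).ybar - P.yStar (lagRef c H.β s k)‖ ^ 2 ≤ D / n := by
    rw [le_div_iff₀ hn]; linarith
  have h6 : ‖P.avgX (s k).xbar (P.yStar (s k).xbar) - P.avgX (s k).xbar (s k).ybar‖ ^ 2
      ≤ L ^ 2 * (2 * (D / n) + 8 * (L / μ) ^ 2 * r ^ 2) := by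
    have a1 : ‖P.yStar (s k).xbar - (s k).ybar‖ ≤ 2 * (L / μ) * r
        + ‖(s k).ybar - P.yStar (lagRef c H.β s k)‖ := by
      have := norm_sub_le_norm_sub_add_norm_sub (P.yStar (s k).xbar)
        (P.yStar (lagRef c H.β s k)) (s k).ybar
      rw [norm_sub_rev (s k).ybar]
      linarith
    have a2 := pow_le_pow_left₀ (norm_nonneg _) a1 2
    have a3 := pow_le_pow_left₀ (norm_nonneg _) h1 2
    rw [mul_pow] at a3
    refine a3.trans (mul_le_mul_of_nonneg_left (a2.trans ?_) (sq_nonneg L))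
    nlinarith [sq_nonneg (2 * (L / μ) * r - ‖(s k).ybar - P.yStar (lagRef c H.β s k)‖)]
  have h7 := norm_sub_le_norm_sub_add_norm_sub (P.avgX (s k).xbar (P.yStar (s k).xbar))
    (P.avgX (s k).xbar (s k).ybar) (P.netX (s k))
  have h8 := pow_le_pow_left₀ (norm_nonneg _) h7 2
  set a := ‖P.avgX (s k).xbar (P.yStar (s k).xbar) - P.avgX (s k).xbar (s k).ybar‖
  set b := ‖P.avgX (s k).xbar (s k).ybar - P.netX (s k)‖
  have h9 : (a + b) ^ 2 ≤ 2 * a ^ 2 + 2 * b ^ 2 := by nlinarith [sq_nonneg (a - b)]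
  refine (h8.trans h9).trans ?_
  have e : ∀ z : ℝ, 2 * L ^ 2 / n * z = 2 * (L ^ 2 / n * z) := fun z => by ring
  rw [e]
  linarith

lemma vref_sq_rpow (h : Run P W H μ L C c c' R Δ Z s gx gy) (k : ℕ) :
    ((s k).vref ^ (-H.α)) ^ 2 = (s k).vref ^ (-(2 * H.α)) := by
  rw [← Real.rpow_natCast, ← Real.rpow_mul (h.vref_pos k).le]; congr 1; push_cast; ring

lemma avg_U_sq_rpow (h : Run P W H μ L C c c' R Δ Z s gx gy) (k : ℕ) :
    (avg (s k).U ^ (-H.β)) ^ 2 = avg (s k).U ^ (-(2 * H.β)) := by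
  rw [← Real.rpow_natCast, ← Real.rpow_mul (h.avg_U_pos k).le]; congr 1; push_cast; ring

lemma consX (h : Run P W H μ L C c c' R Δ Z s gx gy) (k : ℕ) :
    gap W * (pathSeqs P H c s gx gy).cx k
      ≤ (pathSeqs P H c s gx gy).cx k - (pathSeqs P H c s gx gy).cx (k + 1)
      + (gap W)⁻¹ * (H.γx ^ 2 * stepM n p d Z ^ 2
        * ((s k).vref ^ (-(2 * H.α)) * ∑ i, ‖gx k i‖ ^ 2)) := by
  have hg := gap_pos h.hρ
  simp only [pathSeqs]
  have h1 := consensus_step h.hn h.hW h.hρ (s k).x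
    fun i => -(H.γx • had (fun j => (s (k + 1)).V i j ^ (-H.α)) (gx k i))
  have e1 : (s (k + 1)).xbar = nmean fun i => (s k).x i
      + -(H.γx • had (fun j => (s (k + 1)).V i j ^ (-H.α)) (gx k i)) := by
    have : (s (k + 1)).xbar = nmean (s (k + 1)).x := rfl
    rw [this, h.x_succ, nmean_mix h.hW]
  have e2 : (s k).xbar = nmean (s k).x := rfl
  have h2 : ∑ i, ‖-(H.γx • had (fun j => (s (k + 1)).V i j ^ (-H.α)) (gx k i))‖ ^ 2
      ≤ H.γx ^ 2 * stepM n p d Z ^ 2 * ((s k).vref ^ (-(2 * H.α)) * ∑ i, ‖gx k i‖ ^ 2) := by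
    rw [← h.vref_sq_rpow, Finset.mul_sum, Finset.mul_sum]
    refine Finset.sum_le_sum fun i _ => ?_
    rw [norm_neg, norm_smul, mul_pow, Real.norm_eq_abs, sq_abs]
    calc _ ≤ H.γx ^ 2 * ((stepM n p d Z * (s k).vref ^ (-H.α)) ^ 2 * ‖gx k i‖ ^ 2) := by
          gcongr; exact norm_had_sq_le (h.abs_V_rpow_le k i) (gx k i)
      _ = _ := by ring
  rw [e1, h.x_succ, e2]
  have h3 := mul_le_mul_of_nonneg_left h2 (inv_pos.2 hg).le
  rw [one_div] at h1
  linarith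

lemma consY (h : Run P W H μ L C c c' R Δ Z s gx gy) (k : ℕ) :
    gap W * (pathSeqs P H c s gx gy).cy k
      ≤ (pathSeqs P H c s gx gy).cy k - (pathSeqs P H c s gx gy).cy (k + 1)
      + (gap W)⁻¹ * (H.γy ^ 2 * stepM n p d Z ^ 2
        * (avg (s k).U ^ (-(2 * H.β)) * ∑ i, ‖gy k i‖ ^ 2)) := by
  have hg := gap_pos h.hρ
  simp only [pathSeqs]
  set w : Fin n → Vec d := fun i => (s k).y i
      + H.γy • had (fun j => (s (k + 1)).U i j ^ (-H.β)) (gy k i) with hw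
  have h1 := consensus_step h.hn h.hW h.hρ (s k).y
    fun i => H.γy • had (fun j => (s (k + 1)).U i j ^ (-H.β)) (gy k i)
  have h2 : ∑ i, ‖H.γy • had (fun j => (s (k + 1)).U i j ^ (-H.β)) (gy k i)‖ ^ 2
      ≤ H.γy ^ 2 * stepM n p d Z ^ 2 * (avg (s k).U ^ (-(2 * H.β)) * ∑ i, ‖gy k i‖ ^ 2) := by
    rw [← h.avg_U_sq_rpow, Finset.mul_sum, Finset.mul_sum]
    refine Finset.sum_le_sum fun i _ => ?_
    rw [norm_smul, mul_pow, Real.norm_eq_abs, sq_abs]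
    calc _ ≤ H.γy ^ 2 * ((stepM n p d Z * avg (s k).U ^ (-H.β)) ^ 2 * ‖gy k i‖ ^ 2) := by
          gcongr; exact norm_had_sq_le (h.abs_U_rpow_le k i) (gy k i)
      _ = _ := by ring
  -- The mean minimizes the sum of squared distances, so it may be replaced by the projection of the
  -- mean before projecting; the projection is nonexpansive.
  have h3 : ∑ i, ‖(s (k + 1)).y i - (s (k + 1)).ybar‖ ^ 2
      ≤ ∑ i, ‖mix W w i - nmean w‖ ^ 2 := by
    refine (sum_norm_sub_nmean_le h.hn _ (proj P.Y (nmean w))).trans ?_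
    refine Finset.sum_le_sum fun i _ => ?_
    rw [h.y_succ]
    exact pow_le_pow_left₀ (norm_nonneg _)
      (norm_proj_sub_proj_le h.setting.closed h.setting.convex h.nonempty _ _) 2
  have h4 := mul_le_mul_of_nonneg_left h2 (inv_pos.2 hg).le
  rw [one_div] at h1
  have e : (s k).ybar = nmean (s k).y := rfl
  rw [e]
  linarith

lemma meanX (h : Run P W H μ L C c c' R Δ Z s gx gy) (k : ℕ) :
    (s k).vref⁻¹ * (pathSeqs P H c s gx gy).G2 k
      ≤ (s k).vref⁻¹ * (pathSeqs P H c s gx gy).gx k + (pathSeqs P H c s gx gy).noiseMeanX k := by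
  have hv := h.vref_pos k
  simp only [pathSeqs, nmean_gx_sub]
  have h1 := norm_sq_le_of_mean (g := nmean (gx k)) (G := P.netX (s k))
  have h2 := norm_nmean_sq_le_sum h.hn (gx k)
  have := mul_le_mul_of_nonneg_left (h1.trans (add_le_add_left h2 _)) (inv_pos.2 hv).le
  linarith

lemma meanY (h : Run P W H μ L C c c' R Δ Z s gx gy) (k : ℕ) :
    avg (s k).U ^ (-H.β) * (pathSeqs P H c s gx gy).Gy2 k
      ≤ avg (s k).U ^ (-H.β) * (pathSeqs P H c s gx gy).gy k
        + (pathSeqs P H c s gx gy).noiseMeanY k := by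
  have hu := h.avg_U_pos k
  simp only [pathSeqs]
  have h1 := Finset.sum_le_sum fun i (_ : i ∈ Finset.univ) =>
    norm_sq_le_of_mean (g := gy k i) (G := P.gradY i ((s k).x i) ((s k).y i))
  rw [Finset.sum_add_distrib, ← Finset.mul_sum] at h1
  have := mul_le_mul_of_nonneg_left h1 (by positivity : 0 ≤ avg (s k).U ^ (-H.β))
  linarith

lemma inconsHat_nonneg {n q : ℕ} (a : ℝ) (M : Fin n → Fin q → ℝ) : 0 ≤ inconsHat a M :=
  div_nonneg (Finset.sum_nonneg fun i _ => Finset.sum_nonneg fun j _ => sq_nonneg _) (by positivity)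

/-- The weight is taken at `k` and the stepsize at `k + 1`; by monotonicity their product is at most
`1`. -/
lemma ev_eq_le (h : Run P W H μ L C c c' R Δ Z s gx gy) {k : ℕ} {X : ℝ}
    (hX : ∑ i, ‖had (fun j => (s (k + 1)).V i j ^ (-H.α) - (s (k + 1)).vref ^ (-H.α)) (gx k i)‖ ^ 2
      ≤ ((s (k + 1)).vref ^ (-H.α)) ^ 2 * X) (hX0 : 0 ≤ X) :
    (pathSeqs P H c s gx gy).ev k ≤ 1 / (n : ℝ) * X := by
  have hv := h.vref_pos k
  have hv1 := h.vref_pos (k + 1)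
  simp only [pathSeqs]
  have e : (s k).vref ^ H.α * (s k).vref ^ (-H.α) = 1 := by rw [← Real.rpow_add hv]; simp
  have h1 : (s k).vref ^ H.α * (s (k + 1)).vref ^ (-H.α) ≤ 1 := by
    rw [← e]; exact mul_le_mul_of_nonneg_left (h.vref_rpow_succ_le k) (by positivity)
  have h2 : ((s k).vref ^ H.α) ^ 2 * ((s (k + 1)).vref ^ (-H.α)) ^ 2 ≤ 1 := by
    rw [← mul_pow]; exact pow_le_one₀ (by positivity) h1
  have h3 := (norm_nmean_sq_le h.hn fun i => had (fun j => (s (k + 1)).V i j ^ (-H.α)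
    - (s (k + 1)).vref ^ (-H.α)) (gx k i)).trans
    (mul_le_mul_of_nonneg_left hX (by positivity : 0 ≤ 1 / (n : ℝ)))
  calc _ ≤ ((s k).vref ^ H.α) ^ 2 * (1 / (n : ℝ) * (((s (k + 1)).vref ^ (-H.α)) ^ 2 * X)) := by
        gcongr
    _ = ((s k).vref ^ H.α) ^ 2 * ((s (k + 1)).vref ^ (-H.α)) ^ 2 * (1 / (n : ℝ) * X) := by ring
    _ ≤ 1 * (1 / (n : ℝ) * X) := by gcongr
    _ = _ := one_mul _

lemma evM (h : Run P W H μ L C c c' R Δ Z s gx gy) (k : ℕ) :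
    (pathSeqs P H c s gx gy).ev k ≤ stepM n p d Z ^ 2 * ∑ i, ‖gx k i‖ ^ 2 := by
  have hn : (1 : ℝ) ≤ n := by exact_mod_cast h.hn
  have hX : 0 ≤ stepM n p d Z ^ 2 * ∑ i, ‖gx k i‖ ^ 2 := by positivity
  refine (h.ev_eq_le (sum_norm_had_sub_sq_le (fun i j => h.hc.trans_le (h.le_V (k + 1) i j))
    (h.vref_pos (k + 1)) (one_le_stepM n p d Z) (h.V_rpow_le (k + 1)) (gx k)) hX).trans ?_
  exact mul_le_of_le_one_left hX (by rw [div_le_one (by linarith)]; exact hn)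

lemma devBound_rpow (h : Run P W H μ L C c c' R Δ Z s gx gy) (a : ℝ) :
    (devBound n p d c' C * (gap W)⁻¹) ^ a = devBound n p d c' C ^ a * gap W ^ (-a) := by
  have hg := gap_pos h.hρ
  rw [Real.mul_rpow (devBound_nonneg n p d c' C) (by positivity), Real.inv_rpow hg.le,
    Real.rpow_neg hg.le]

lemma evG (h : Run P W H μ L C c c' R Δ Z s gx gy) {ζ : ℝ} (hζ : ∀ k, inconsHat H.α (s k).V ≤ ζ)
    (k : ℕ) : (pathSeqs P H c s gx gy).ev k ≤ 2 * p * ζ * C ^ 2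
      + 2 * stepM n p d Z ^ 2 * devBound n p d c' C ^ H.α
        * (gap W ^ (-H.α) * ((s k).vref ^ (-H.α) * ∑ i, ‖gx k i‖ ^ 2)) := by
  have hn : (0 : ℝ) < n := by exact_mod_cast h.hn
  have hn1 : (1 : ℝ) ≤ n := by exact_mod_cast h.hn
  have hg := gap_pos h.hρ
  have hv := h.vref_pos k
  have hv1 := h.vref_pos (k + 1)
  have hdev := devBound_nonneg n p d c' C
  have hζ0 := (inconsHat_nonneg H.α (s (k + 1)).V)
  have h1 := sum_norm_had_sub_sq_le_inconsHat h.hn h.hp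
    (fun i j => h.hc.trans_le (h.le_V (k + 1) i j))
    (h.vref_pos (k + 1)) h.α_pos.le h.hα1.le (one_le_stepM n p d Z) (h.V_rpow_le (k + 1))
    (vref_le_avg_V _) (h.abs_rowAvg_V_sub_le (k + 1)) (h.bx k)
  refine (h.ev_eq_le h1 (by positivity)).trans ?_
  rw [h.devBound_rpow]
  have h2 := h.vref_rpow_succ_le k
  have hS : 0 ≤ ∑ i, ‖gx k i‖ ^ 2 := by positivity
  have h3 : 1 / (n : ℝ) ≤ 1 := by rw [div_le_one hn]; exact hn1
  rw [mul_add]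
  refine add_le_add ?_ ?_
  · calc _ = 2 * p * inconsHat H.α (s (k + 1)).V * C ^ 2 := by field_simp
      _ ≤ _ := by gcongr; exact hζ (k + 1)
  · calc _ ≤ 1 * (2 * (stepM n p d Z ^ 2 * (devBound n p d c' C ^ H.α * gap W ^ (-H.α))
          * ((s k).vref ^ (-H.α) * ∑ i, ‖gx k i‖ ^ 2))) := by gcongr
      _ = _ := by ring

/-- Nodes are summed here and not averaged, so a factor `n` stays; it cancels against the `1 / n` of
`error`. The power `gap ^ (-β)` is weakened to `gap⁻¹`. -/
lemma euG (h : Run P W H μ L C c c' R Δ Z s gx gy) {ζ : ℝ} (hζ : ∀ k, inconsHat H.β (s k).U ≤ ζ)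
    (k : ℕ) : (pathSeqs P H c s gx gy).eu k ≤ 2 * n * d * ζ * C ^ 2
      + 2 * stepM n p d Z ^ 2 * devBound n p d c' C ^ H.β
        * ((gap W)⁻¹ * (avg (s k).U ^ (-H.β) * ∑ i, ‖gy k i‖ ^ 2)) := by
  have hn : (0 : ℝ) < n := by exact_mod_cast h.hn
  have hg := gap_pos h.hρ
  have hu := h.avg_U_pos k
  have hu1 := h.avg_U_pos (k + 1)
  have hdev := devBound_nonneg n p d c' C
  have hζ0 := (inconsHat_nonneg H.β (s (k + 1)).U)
  have hβ1 : H.β ≤ 1 := (h.hα.trans h.hα1).le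
  have h1 := sum_norm_had_sub_sq_le_inconsHat h.hn h.hd
    (fun i j => h.hc.trans_le (h.le_U (k + 1) i j))
    hu1 h.hβ.le hβ1 (one_le_stepM n p d Z) (h.U_rpow_le (k + 1))
    le_rfl (h.abs_rowAvg_U_sub_le (k + 1)) (h.bY k)
  rw [h.devBound_rpow] at h1
  have h2 := h.avg_U_rpow_succ_le k
  have hS : 0 ≤ ∑ i, ‖gy k i‖ ^ 2 := by positivity
  have e : avg (s k).U ^ H.β * avg (s k).U ^ (-H.β) = 1 := by rw [← Real.rpow_add hu]; simp
  have h3 : avg (s k).U ^ H.β * avg (s (k + 1)).U ^ (-H.β) ≤ 1 := by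
    rw [← e]; exact mul_le_mul_of_nonneg_left h2 (by positivity)
  have h4 : (avg (s k).U ^ H.β) ^ 2 * (avg (s (k + 1)).U ^ (-H.β)) ^ 2 ≤ 1 := by
    rw [← mul_pow]; exact pow_le_one₀ (by positivity) h3
  have h5 : gap W ^ (-H.β) ≤ (gap W)⁻¹ := by
    rw [← Real.rpow_neg_one]
    exact Real.rpow_le_rpow_of_exponent_ge hg (gap_le_one W) (by linarith)
  simp only [pathSeqs]
  calc _ ≤ (avg (s k).U ^ H.β) ^ 2 * ((avg (s (k + 1)).U ^ (-H.β)) ^ 2 * _) :=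
        mul_le_mul_of_nonneg_left h1 (by positivity)
    _ = (avg (s k).U ^ H.β) ^ 2 * (avg (s (k + 1)).U ^ (-H.β)) ^ 2 * _ := (mul_assoc _ _ _).symm
    _ ≤ 1 * _ := mul_le_mul_of_nonneg_right h4 (by positivity)
    _ ≤ _ := ?_
  rw [one_mul]
  refine add_le_add ?_ ?_
  · calc _ = 2 * n * d * inconsHat H.β (s (k + 1)).U * C ^ 2 := by ring
      _ ≤ _ := by gcongr; exact hζ (k + 1)
  · calc _ ≤ 2 * (stepM n p d Z ^ 2 * (devBound n p d c' C ^ H.β * (gap W)⁻¹)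
          * (avg (s k).U ^ (-H.β) * ∑ i, ‖gy k i‖ ^ 2)) := by gcongr
      _ = _ := by ring

/-- One-sided monotonicity of the dual gradients at the local variables. -/
lemma sum_inner_gradY_le (h : Run P W H μ L C c c' R Δ Z s gx gy) (a : Vec p) (k : ℕ) {U : ℝ}
    (hU : 0 < U) :
    ∑ i, inner ℝ ((s k).y i - P.yStar a) (P.gradY i ((s k).x i) ((s k).y i))
      ≤ -(3 * μ / 8) * ∑ i, ‖(s k).y i - P.yStar a‖ ^ 2
        + (3 * μ / 8 + 4 * L ^ 2 / μ)
          * (∑ i, ‖(s k).x i - (s k).xbar‖ ^ 2 + ∑ i, ‖(s k).y i - (s k).ybar‖ ^ 2)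
        + 4 * L ^ 2 / μ * n * ‖(s k).xbar - a‖ ^ 2
        + U * ∑ i, ‖(s k).y i - (s k).ybar‖ ^ 2
        + 1 / (4 * U) * ∑ i, ‖P.gradY i ((s k).x i) ((s k).y i)‖ ^ 2 := by
  have hn : (0 : ℝ) < n := by exact_mod_cast h.hn
  have hμ := h.hμ
  set q := P.yStar a with hq
  have hqm : q ∈ P.Y := h.yStar_mem a
  set z := (s k).ybar - q with hz
  have hD := sum_norm_sub_sq h.hn (s k).y q
  have e : nmean (s k).y = (s k).ybar := rfl
  rw [e] at hD
  set G : Fin n → Vec d := fun i => P.gradY i ((s k).x i) ((s k).y i) with hG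
  -- Only the average of the local objectives is maximal at `q`, so the gradients are moved to the
  -- common point `(a, ȳ)`. The part along `y i - ȳ` keeps the local gradient, with a free weight
  -- `U`; the change of gradient takes `μ / 8` of the `μ / 2` from concavity.
  have h1 : ∀ i, inner ℝ ((s k).y i - q) (G i)
      ≤ (U * ‖(s k).y i - (s k).ybar‖ ^ 2 + 1 / (4 * U) * ‖G i‖ ^ 2)
        + (inner ℝ z (P.gradY i a (s k).ybar) + (μ / 8 * ‖z‖ ^ 2
          + 2 / μ * (L ^ 2 * (2 * ‖(s k).x i - (s k).xbar‖ ^ 2 + 2 * ‖(s k).xbar - a‖ ^ 2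
            + ‖(s k).y i - (s k).ybar‖ ^ 2)))) := fun i => by
    have a0 : inner ℝ ((s k).y i - q) (G i) = inner ℝ ((s k).y i - (s k).ybar) (G i)
        + (inner ℝ z (P.gradY i a (s k).ybar) + inner ℝ z (G i - P.gradY i a (s k).ybar)) := by
      rw [← inner_add_right, add_sub_cancel, ← inner_add_left, hz, sub_add_sub_cancel]
    have a1 := inner_le_weighted (a := (s k).y i - (s k).ybar) (b := G i) hU
    have a2 := inner_le_weighted (a := z) (b := G i - P.gradY i a (s k).ybar) (t := μ / 8)
      (by positivity)
    have a3 := h.smooth.lipY i ((s k).x i) a _ (h.y_mem k i) _ (h.ybar_mem k)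
    have a4 : ‖(s k).x i - a‖ ^ 2
        ≤ 2 * ‖(s k).x i - (s k).xbar‖ ^ 2 + 2 * ‖(s k).xbar - a‖ ^ 2 := by
      have := pow_le_pow_left₀ (norm_nonneg _)
        (norm_sub_le_norm_sub_add_norm_sub ((s k).x i) (s k).xbar a) 2
      nlinarith [sq_nonneg (‖(s k).x i - (s k).xbar‖ - ‖(s k).xbar - a‖)]
    have a5 : 1 / (4 * (μ / 8)) = 2 / μ := by field_simp; norm_num
    rw [a5] at a2
    have a6 : ‖G i - P.gradY i a (s k).ybar‖ ^ 2 ≤ L ^ 2 * (2 * ‖(s k).x i - (s k).xbar‖ ^ 2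
        + 2 * ‖(s k).xbar - a‖ ^ 2 + ‖(s k).y i - (s k).ybar‖ ^ 2) :=
      a3.trans (by gcongr)
    have a7 := mul_le_mul_of_nonneg_left a6 (by positivity : 0 ≤ 2 / μ)
    linarith
  have h2 := Finset.sum_le_sum fun i (_ : i ∈ Finset.univ) => h1 i
  simp only [Finset.sum_add_distrib, ← Finset.mul_sum, ← inner_sum, Finset.sum_const,
    Finset.card_univ, Fintype.card_fin, nsmul_eq_mul] at h2
  have h3 : inner ℝ z (∑ i, P.gradY i a (s k).ybar) ≤ -(n * (μ / 2 * ‖z‖ ^ 2)) := by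
    rw [← smul_nmean h.hn, real_inner_smul_right, real_inner_comm]
    have b1 := Problem.inner_avgY_le h.hn h.conc a (h.ybar_mem k) hqm
    have b2 := (Problem.yStar_spec h.hn h.hμ h.setting h.conc h.smooth h.grad h.nonempty a).2 _
      (h.ybar_mem k)
    rw [Problem.avgY] at b1
    have b3 : inner ℝ (nmean fun i => P.gradY i a (s k).ybar) z ≤ -(μ / 2 * ‖z‖ ^ 2) := by
      linarith
    have := mul_le_mul_of_nonneg_left b3 hn.le
    linarith
  set cx := ∑ i, ‖(s k).x i - (s k).xbar‖ ^ 2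
  set cy := ∑ i, ‖(s k).y i - (s k).ybar‖ ^ 2
  have hcy : 0 ≤ 2 * L ^ 2 / μ * cy := by positivity
  have hcx : 0 ≤ 3 * μ / 8 * cx := by positivity
  have e1 : 2 / μ * (L ^ 2 * (2 * cx + 2 * (n * ‖(s k).xbar - a‖ ^ 2) + cy))
      = 4 * L ^ 2 / μ * cx + 4 * L ^ 2 / μ * n * ‖(s k).xbar - a‖ ^ 2 + 2 * L ^ 2 / μ * cy := by
    ring
  have e2 : 4 * L ^ 2 / μ * cy = 2 * L ^ 2 / μ * cy + 2 * L ^ 2 / μ * cy := by ring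
  rw [e1] at h2
  rw [hD]
  linarith

/-- Replaces the local stepsizes by `u k ^ (-β)`. The decrease of the stepsize costs a logarithmic
increment and the mismatch takes `μ / 16` of the concavity. -/
lemma sum_inner_had_le (h : Run P W H μ L C c c' R Δ Z s gx gy) {q : Vec d} (hq : q ∈ P.Y) (k : ℕ) :
    avg (s k).U ^ H.β * ∑ i, inner ℝ ((s k).y i - q)
        (had (fun j => (s (k + 1)).U i j ^ (-H.β)) (gy k i))
      ≤ ∑ i, inner ℝ ((s k).y i - q) (gy k i)
        + n * (2 * C / μ) * C * (Real.log (avg (s (k + 1)).U) - Real.log (avg (s k).U))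
        + μ / 16 * ∑ i, ‖(s k).y i - q‖ ^ 2 + 4 / μ * (pathSeqs P H c s gx gy).eu k := by
  have hu := h.avg_U_pos k
  have hμ := h.hμ
  have hC := h.hC
  simp only [pathSeqs]
  set w := avg (s k).U ^ H.β with hw
  set A' := avg (s (k + 1)).U ^ (-H.β) with hA'
  have hw0 : 0 < w := by positivity
  set l := Real.log (avg (s (k + 1)).U) - Real.log (avg (s k).U)
  have e : w * avg (s k).U ^ (-H.β) = 1 := by rw [hw, ← Real.rpow_add hu]; simp
  have hl : 1 - w * A' ≤ l := by
    have := rpow_mul_sub_le_log hu (h.avg_U_mono (Nat.le_succ k)) (h.hα.trans h.hα1).le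
    rw [mul_sub] at this
    linarith
  have hl0 : 0 ≤ 1 - w * A' := by
    have := mul_le_mul_of_nonneg_left (h.avg_U_rpow_succ_le k) hw0.le
    linarith
  have h1 : ∀ i, w * inner ℝ ((s k).y i - q) (had (fun j => (s (k + 1)).U i j ^ (-H.β)) (gy k i))
      ≤ inner ℝ ((s k).y i - q) (gy k i) + 2 * C / μ * C * l + μ / 16 * ‖(s k).y i - q‖ ^ 2
        + 4 / μ * (w ^ 2 * ‖had (fun j => (s (k + 1)).U i j ^ (-H.β) - A') (gy k i)‖ ^ 2) :=
    fun i => by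
      have e1 : had (fun j => (s (k + 1)).U i j ^ (-H.β)) (gy k i) = A' • gy k i
          + had (fun j => (s (k + 1)).U i j ^ (-H.β) - A') (gy k i) := by
        rw [← had_const, ← had_add]; congr 1; ext j; ring
      rw [e1, inner_add_right, real_inner_smul_right]
      have a1 := inner_le_weighted (a := (s k).y i - q)
        (b := w • had (fun j => (s (k + 1)).U i j ^ (-H.β) - A') (gy k i)) (t := μ / 16)
        (by positivity)
      have a2 : 1 / (4 * (μ / 16)) = 4 / μ := by field_simp; norm_num
      rw [a2, real_inner_smul_right, norm_smul, mul_pow, Real.norm_eq_abs, sq_abs] at a1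
      have a3 : -(2 * C / μ * C) ≤ inner ℝ ((s k).y i - q) (gy k i) := by
        refine neg_le_of_abs_le ((abs_real_inner_le_norm _ _).trans ?_)
        exact mul_le_mul (h.norm_sub_le (h.y_mem k i) hq) (h.bY k i) (norm_nonneg _) (by positivity)
      have a4 := mul_le_mul_of_nonneg_left a3 hl0
      have a5 : (1 - w * A') * (2 * C / μ * C) ≤ l * (2 * C / μ * C) := by gcongr
      linarith
  have h2 := Finset.sum_le_sum fun i (_ : i ∈ Finset.univ) => h1 i
  simp only [Finset.sum_add_distrib, ← Finset.mul_sum, Finset.sum_const,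
    Finset.card_univ, Fintype.card_fin, nsmul_eq_mul] at h2
  linarith

/-- Neither mixing nor projection increases the summed squared distances to a point of `Y`. -/
lemma dual_step (h : Run P W H μ L C c c' R Δ Z s gx gy) {q : Vec d} (hq : q ∈ P.Y) (k : ℕ) :
    ∑ i, ‖(s (k + 1)).y i - q‖ ^ 2 ≤ ∑ i, ‖(s k).y i - q‖ ^ 2
      + 2 * H.γy * ∑ i, inner ℝ ((s k).y i - q)
        (had (fun j => (s (k + 1)).U i j ^ (-H.β)) (gy k i))
      + H.γy ^ 2 * stepM n p d Z ^ 2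
        * (avg (s k).U ^ (-(2 * H.β)) * ∑ i, ‖gy k i‖ ^ 2) := by
  have h1 : ∑ i, ‖(s (k + 1)).y i - q‖ ^ 2 ≤ ∑ i, ‖(s k).y i
      + H.γy • had (fun j => (s (k + 1)).U i j ^ (-H.β)) (gy k i) - q‖ ^ 2 := by
    refine le_trans (Finset.sum_le_sum fun i _ => ?_)
      (sum_norm_mix_sub_le h.hn h.hW h.hρ.le (fun i => (s k).y i
        + H.γy • had (fun j => (s (k + 1)).U i j ^ (-H.β)) (gy k i)) q)
    rw [h.y_succ]
    exact pow_le_pow_left₀ (norm_nonneg _)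
      (norm_proj_sub_le h.setting.closed h.setting.convex hq _) 2
  refine h1.trans ?_
  rw [← h.avg_U_sq_rpow, Finset.mul_sum, Finset.mul_sum, Finset.mul_sum, ← Finset.sum_add_distrib,
    ← Finset.sum_add_distrib]
  refine Finset.sum_le_sum fun i _ => ?_
  rw [add_sub_right_comm, norm_add_sq_real, real_inner_smul_right, norm_smul, mul_pow,
    Real.norm_eq_abs, sq_abs]
  have h2 := mul_le_mul_of_nonneg_left (norm_had_sq_le (h.abs_U_rpow_le k i) (gy k i))
    (sq_nonneg H.γy)
  linarith

/-- `5/8 = 2 (3/8 - 1/16)` is what is left of the concavity. The target moves by at most `2κ θ η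
‖r‖`; the weight `u ^ β = η⁻¹` and the Young factor of order `η⁻¹` compensate both powers of `η`,
leaving a constant times `‖r‖²`. -/
lemma track (h : Run P W H μ L C c c' R Δ Z s gx gy) (k : ℕ) :
    5 / 8 * (H.γy * μ) * (pathSeqs P H c s gx gy).D k
      ≤ H.γy * μ / 8 * (pathSeqs P H c s gx gy).D (k + 1)
      + avg (s k).U ^ H.β * ((pathSeqs P H c s gx gy).D k - (pathSeqs P H c s gx gy).D (k + 1))
      + (32 * n * (L / μ) ^ 2 * (c ^ H.β) ^ 2 / (H.γy * μ) + 8 * H.γy * L ^ 2 / μ * n)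
        * (pathSeqs P H c s gx gy).r2 k
      + 2 * H.γy * ((pathSeqs P H c s gx gy).noiseTrack k
        + n * (2 * C / μ) * C * (Real.log (avg (s (k + 1)).U) - Real.log (avg (s k).U))
        + 4 / μ * (pathSeqs P H c s gx gy).eu k
        + gap W / 2 * (avg (s k).U ^ H.β * (pathSeqs P H c s gx gy).cy k)
        + (gap W)⁻¹ / 2 * (avg (s k).U ^ (-H.β) * (pathSeqs P H c s gx gy).Gy2 k)
        + (3 * μ / 8 + 4 * L ^ 2 / μ)
          * ((pathSeqs P H c s gx gy).cx k + (pathSeqs P H c s gx gy).cy k))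
      + H.γy ^ 2 * stepM n p d Z ^ 2 * (avg (s k).U ^ (-H.β) * ∑ i, ‖gy k i‖ ^ 2) := by
  have hn : (0 : ℝ) < n := by exact_mod_cast h.hn
  have hu := h.avg_U_pos k
  have hμ := h.hμ
  have hγ := h.hγy
  have hg := gap_pos h.hρ
  set a := lagRef c H.β s k with ha
  set w := avg (s k).U ^ H.β with hw
  set η := avg (s k).U ^ (-H.β) with hη
  have hw0 : 0 < w := by positivity
  have hη0 : 0 < η := by positivity
  have hwη : w * η = 1 := by rw [hw, hη, ← Real.rpow_add hu]; simp
  have hwη2 : w * avg (s k).U ^ (-(2 * H.β)) = η := by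
    rw [hw, hη, ← Real.rpow_add hu]; congr 1; ring
  have hq := h.yStar_mem a
  have h1 := h.dual_step hq k
  have h2 := h.sum_inner_had_le hq k
  -- This weight gives `e u ^ β cy`, which the weighted consensus sum controls, against `e⁻¹ u ^
  -- (-β)` times the squared gradients, which is of the order of the last term of the rate.
  have h3 := h.sum_inner_gradY_le a k (U := gap W * w / 2) (by positivity)
  have h4 : ∑ i, ‖(s (k + 1)).y i - P.yStar (lagRef c H.β s (k + 1))‖ ^ 2
      ≤ ∑ i, ‖(s (k + 1)).y i - P.yStar a‖ ^ 2
        + H.γy * μ / 8 * η * ∑ i, ‖(s (k + 1)).y i - P.yStar (lagRef c H.β s (k + 1))‖ ^ 2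
        + 1 / (H.γy * μ / 8 * η)
          * (n * ‖P.yStar (lagRef c H.β s (k + 1)) - P.yStar a‖ ^ 2) := by
    have := Finset.sum_le_sum fun i (_ : i ∈ Finset.univ) => norm_sq_sub_le_of_shift
      (y := (s (k + 1)).y i) (q := P.yStar a) (q' := P.yStar (lagRef c H.β s (k + 1)))
      (t := H.γy * μ / 8 * η) (by positivity)
    simpa only [Finset.sum_add_distrib, ← Finset.mul_sum, Finset.sum_const,
      Finset.card_univ, Fintype.card_fin, nsmul_eq_mul] using this
  have h5 := Problem.norm_yStar_sub_le h.hn h.hμ h.hL h.setting h.conc h.smooth h.grad h.nonempty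
    (lagRef c H.β s (k + 1)) a
  have h6 : ‖lagRef c H.β s (k + 1) - a‖ = c ^ H.β * η * ‖(s k).xbar - a‖ := by
    rw [lagRef, ← ha, add_sub_cancel_left, norm_smul,
      Real.norm_of_nonneg (h.theta_eta_le_one k).1]
  rw [h6] at h5
  have h7 := pow_le_pow_left₀ (norm_nonneg _) h5 2
  have h8 : w * (1 / (H.γy * μ / 8 * η)
      * (n * ‖P.yStar (lagRef c H.β s (k + 1)) - P.yStar a‖ ^ 2))
      ≤ 32 * n * (L / μ) ^ 2 * (c ^ H.β) ^ 2 / (H.γy * μ) * ‖(s k).xbar - a‖ ^ 2 := by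
    calc _ ≤ w * (1 / (H.γy * μ / 8 * η)
          * (n * (2 * (L / μ) * (c ^ H.β * η * ‖(s k).xbar - a‖)) ^ 2)) := by gcongr
      _ = w * η * (w * η) * (32 * n * (L / μ) ^ 2 * (c ^ H.β) ^ 2 / (H.γy * μ)
          * ‖(s k).xbar - a‖ ^ 2) := by
            have e8 : 1 / (H.γy * μ / 8 * η) = w * (8 / (H.γy * μ)) := by
              rw [eq_inv_of_mul_eq_one_left hwη]; field_simp
            rw [e8]
            ring
      _ = _ := by rw [hwη, one_mul, one_mul]
  have h9 : 1 / (4 * (gap W * w / 2)) = (gap W)⁻¹ / 2 * η := by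
    have : η = w⁻¹ := eq_inv_of_mul_eq_one_right hwη
    rw [this]; field_simp; norm_num
  rw [h9] at h3
  simp only [pathSeqs] at h2 ⊢
  rw [← ha]
  set D := ∑ i, ‖(s k).y i - P.yStar a‖ ^ 2
  set D' := ∑ i, ‖(s (k + 1)).y i - P.yStar (lagRef c H.β s (k + 1))‖ ^ 2
  set X := ∑ i, ‖gy k i‖ ^ 2
  have h10 := mul_le_mul_of_nonneg_left (h4.trans (by gcongr :
    _ ≤ (D + 2 * H.γy * ∑ i, inner ℝ ((s k).y i - P.yStar a)
        (had (fun j => (s (k + 1)).U i j ^ (-H.β)) (gy k i))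
      + H.γy ^ 2 * stepM n p d Z ^ 2 * (avg (s k).U ^ (-(2 * H.β)) * X))
      + H.γy * μ / 8 * η * D' + 1 / (H.γy * μ / 8 * η)
          * (n * ‖P.yStar (lagRef c H.β s (k + 1)) - P.yStar a‖ ^ 2))) hw0.le
  have h11 : w * (H.γy ^ 2 * stepM n p d Z ^ 2 * (avg (s k).U ^ (-(2 * H.β)) * X))
      = H.γy ^ 2 * stepM n p d Z ^ 2 * (η * X) := by rw [← hwη2]; ring
  have h12 : w * (H.γy * μ / 8 * η * D') = H.γy * μ / 8 * D' := by
    linear_combination H.γy * μ / 8 * D' * hwη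
  have h13 := mul_le_mul_of_nonneg_left h2 (by positivity : 0 ≤ 2 * H.γy)
  have h14 := mul_le_mul_of_nonneg_left h3 (by positivity : 0 ≤ 2 * H.γy)
  have h15 : ∑ i, inner ℝ ((s k).y i - P.yStar a) (gy k i)
      = ∑ i, inner ℝ ((s k).y i - P.yStar a) (gy k i - P.gradY i ((s k).x i) ((s k).y i))
        + ∑ i, inner ℝ ((s k).y i - P.yStar a) (P.gradY i ((s k).x i) ((s k).y i)) := by
    rw [← Finset.sum_add_distrib]
    refine Finset.sum_congr rfl fun i _ => ?_
    rw [← inner_add_right, sub_add_cancel]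
  rw [h15] at h13
  rw [mul_add, mul_add, mul_add, mul_add, h11, h12] at h10
  have e3 : 2 * H.γy * (4 * L ^ 2 / μ * n * ‖(s k).xbar - a‖ ^ 2)
      = 8 * H.γy * L ^ 2 / μ * n * ‖(s k).xbar - a‖ ^ 2 := by ring
  linarith

end Run

/-- The constants of the one-step inequalities of the iteration. -/
noncomputable def consts (n p d : ℕ) (H : Hyper) (μ L C Δ R c c' kE Z : ℝ) : Consts where
  α := H.α
  β := H.β
  γx := H.γx
  γy := H.γy
  μ := μ
  L := L
  N := n
  κ := L / μ
  θ := c ^ H.β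
  m0 := c
  kV := c' + C ^ 2
  kH := (1 + C ^ 2 / c) * (n * (p + d) * (1 + |Real.log (c' + C ^ 2) - Real.log c|))
  kE := kE
  Δ := |Δ|
  RX := |R|
  RY := n * (2 * C / μ) ^ 2
  RD := n * (2 * C / μ) ^ 2
  RR := Run.lagBound n p d H C c Z ^ 2
  kA := (L + 2 * L * (L / μ)) / H.γx * (H.γx ^ 2 * stepM n p d Z ^ 2)
  kC1 := 32 * n * (L / μ) ^ 2 * (c ^ H.β) ^ 2 / (H.γy * μ) + 8 * H.γy * L ^ 2 / μ * n
  kC2 := C ^ 2 + n * (2 * C / μ) * C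
  kC3 := 3 * μ / 8 + 4 * L ^ 2 / μ
  kC4 := H.γy ^ 2 * stepM n p d Z ^ 2
  kD1 := 4 * H.γx ^ 2 / c ^ H.β * ((stepM n p d Z ^ (1 / H.β) * p) ^ H.β) ^ 2
  kD2 := 2 * H.γx * Run.lagBound n p d H C c Z * C * ratioBound n p d Z H.α H.β c
  kD3 := ratioBound n p d Z H.α H.β c * (H.γx ^ 2 * stepM n p d Z ^ 2)
  kF := (H.γx ^ 2 + H.γy ^ 2) * stepM n p d Z ^ 2
  kM := stepM n p d Z ^ 2
  kG := 2 * stepM n p d Z ^ 2 * (devBound n p d c' C ^ H.α + devBound n p d c' C ^ H.β)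

lemma consts_ok {n p d : ℕ} {H : Hyper} {μ L C c c' kE : ℝ} (Δ R Z : ℝ) (hn : 0 < n)
    (hγx : 0 < H.γx) (hγy : 0 < H.γy) (hβ : 0 < H.β) (hα : H.β < H.α) (hα1 : H.α < 1) (hμ : 0 < μ)
    (hL : 0 < L) (hC : 0 < C) (hc : 0 < c) (hcc : c ≤ c') (hkE : 0 ≤ kE) :
    (consts n p d H μ L C Δ R c c' kE Z).Ok := by
  have hm := one_le_stepM n p d Z
  have hm0 : 0 < stepM n p d Z := by linarith
  have hr : 0 ≤ ratioBound n p d Z H.α H.β c := by unfold ratioBound; positivity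
  have hl : 0 ≤ Run.lagBound n p d H C c Z := by unfold Run.lagBound; positivity
  have hdev := devBound_nonneg n p d c' C
  have hc' : 0 < c' := hc.trans_le hcc
  have hn' : (0 : ℝ) < n := by exact_mod_cast hn
  constructor <;> simp only [consts] <;> first | assumption | positivity

namespace Run

variable {n p d : ℕ} {Ξ : Type*} [MeasurableSpace Ξ] {P : Problem n p d Ξ}
  {W : Matrix (Fin n) (Fin n) ℝ} {H : Hyper} {μ L C c c' R Δ Z : ℝ}
  {s : ℕ → State n p d} {gx : ℕ → Fin n → Vec p} {gy : ℕ → Fin n → Vec d}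

lemma seqs_ok (h : Run P W H μ L C c c' R Δ Z s gx gy) {ζv ζu : ℝ} (kE : ℝ)
    (hζv : ∀ k, inconsHat H.α (s k).V ≤ ζv) (hζu : ∀ k, inconsHat H.β (s k).U ≤ ζu) :
    (pathSeqs P H c s gx gy).Ok (consts n p d H μ L C Δ R c c' kE Z) (gap W)
      (2 * p * ζv * C ^ 2) (2 * n * d * ζu * C ^ 2) := by
  have hg := gap_pos h.hρ
  have hC := h.hC
  have hμ := h.hμ
  have hγx := h.hγx
  have hγy := h.hγy
  have hlv : ∀ k, 0 ≤ Real.log (s (k + 1)).vref - Real.log (s k).vref := fun k =>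
    sub_nonneg.2 (Real.log_le_log (h.vref_pos k) (h.vref_mono (Nat.le_succ k)))
  have hlu : ∀ k, 0 ≤ Real.log (avg (s (k + 1)).U) - Real.log (avg (s k).U) := fun k =>
    sub_nonneg.2 (Real.log_le_log (h.avg_U_pos k) (h.avg_U_mono (Nat.le_succ k)))
  have hvg : ∀ (a : ℝ) k, 0 ≤ (s k).vref ^ a * ∑ i, ‖gx k i‖ ^ 2 := fun a k =>
    mul_nonneg (Real.rpow_nonneg (h.vref_pos k).le _) (by positivity)
  have hug : ∀ (a : ℝ) k, 0 ≤ avg (s k).U ^ a * ∑ i, ‖gy k i‖ ^ 2 := fun a k =>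
    mul_nonneg (Real.rpow_nonneg (h.avg_U_pos k).le _) (by positivity)
  have hdev := devBound_nonneg n p d c' C
  constructor
  case v => exact h.accumX
  case u => exact h.accumY
  case cx0 => exact h.x0.trans (le_abs_self R)
  case cx => exact fun k => by simp only [pathSeqs]; positivity
  case cy => exact fun k => by simp only [pathSeqs]; positivity
  case cyR => exact fun k => h.sum_norm_sub_sq_le (h.ybar_mem k) k
  case D => exact fun k => by simp only [pathSeqs]; positivity
  case DR => exact fun k => h.sum_norm_sub_sq_le (h.yStar_mem _) k
  case r2 => exact fun k => sq_nonneg _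
  case r2R => exact fun k => pow_le_pow_left₀ (norm_nonneg _) (h.norm_lag_le k) 2
  case ev => exact fun k => mul_nonneg (sq_nonneg _) (sq_nonneg _)
  case G2 => exact fun k => sq_nonneg _
  case φ => exact fun i j => (h.hΔ _ _).trans (le_abs_self Δ)
  case descent =>
    intro k
    refine (h.descent k).trans ?_
    -- `kC2` serves the descent and the tracking inequality; the excess is nonnegative.
    have e : 0 ≤ n * (2 * C / μ) * C * (Real.log (s (k + 1)).vref - Real.log (s k).vref) :=
      mul_nonneg (by positivity) (hlv k)
    simp only [consts]
    simp only [pathSeqs] at *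
    linarith
  case error => exact h.error
  case track =>
    intro k
    refine (h.track k).trans ?_
    have e : 0 ≤ 2 * H.γy * (C ^ 2 * (Real.log (avg (s (k + 1)).U) - Real.log (avg (s k).U))) :=
      mul_nonneg (by positivity) (mul_nonneg (by positivity) (hlu k))
    simp only [consts]
    simp only [pathSeqs] at *
    linarith
  case lag =>
    intro k
    refine (h.lag k).trans (le_of_eq ?_)
    simp only [consts]
    simp only [pathSeqs]
    ring
  case meanX => exact h.meanX
  case meanY => exact h.meanY
  case consX =>
    intro k
    refine (h.consX k).trans ?_
    simp only [consts]
    simp only [pathSeqs]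
    have e : 0 ≤ (gap W)⁻¹ * (H.γy ^ 2 * stepM n p d Z ^ 2
      * ((s k).vref ^ (-(2 * H.α)) * ∑ i, ‖gx k i‖ ^ 2)) :=
      mul_nonneg (by positivity) (mul_nonneg (by positivity) (hvg _ k))
    linarith
  case consY =>
    intro k
    refine (h.consY k).trans ?_
    simp only [consts]
    simp only [pathSeqs]
    have e : 0 ≤ (gap W)⁻¹ * (H.γx ^ 2 * stepM n p d Z ^ 2
      * (avg (s k).U ^ (-(2 * H.β)) * ∑ i, ‖gy k i‖ ^ 2)) :=
      mul_nonneg (by positivity) (mul_nonneg (by positivity) (hug _ k))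
    linarith
  case evM => exact h.evM
  case evG =>
    intro k
    refine (h.evG hζv k).trans ?_
    simp only [consts]
    simp only [pathSeqs]
    have e : 0 ≤ 2 * stepM n p d Z ^ 2 * devBound n p d c' C ^ H.β
        * (gap W ^ (-H.α) * ((s k).vref ^ (-H.α) * ∑ i, ‖gx k i‖ ^ 2)) :=
      mul_nonneg (by positivity) (mul_nonneg (by positivity) (hvg _ k))
    linarith
  case euG =>
    intro k
    refine (h.euG hζu k).trans ?_
    simp only [consts]
    simp only [pathSeqs]
    have e : 0 ≤ 2 * stepM n p d Z ^ 2 * devBound n p d c' C ^ H.α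
        * ((gap W)⁻¹ * (avg (s k).U ^ (-H.β) * ∑ i, ‖gy k i‖ ^ 2)) :=
      mul_nonneg (by positivity) (mul_nonneg (by positivity) (hug _ k))
    linarith

end Run

/-! ### The conditions on the number of iterations -/

/-- The hypothesis gives `K / c₀ ≥ (1 - ρ) ^ (-2 / β)`; raise it to the power `β` and use `gap ≥ (1
- ρ) / 2`. -/
lemma inv_gap_sq_le {n : ℕ} {W : Matrix (Fin n) (Fin n) ℝ} (hρ : rho W < 1) {α β c₀ : ℝ} {K : ℕ}
    (hβ : 0 < β) (hc₀ : 0 < c₀)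
    (hK : c₀ * (1 / (1 - rho W) ^ 2) ^ max (1 / α) (1 / β) ≤ K) :
    (gap W)⁻¹ ^ 2 ≤ 4 * c₀ ^ (-β) * (K : ℝ) ^ β := by
  have hr : 0 < 1 - rho W := by linarith
  have hg := gap_pos hρ
  have hr1 : 1 - rho W ≤ 1 := by
    have : 0 ≤ rho W := sq_nonneg _
    linarith
  have h1 : 1 ≤ 1 / (1 - rho W) ^ 2 := by
    rw [le_div_iff₀ (by positivity), one_mul]; exact pow_le_one₀ hr.le hr1
  have h2 : (1 / (1 - rho W) ^ 2) ^ (1 / β) ≤ (K : ℝ) / c₀ := by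
    rw [le_div_iff₀ hc₀, mul_comm]
    refine le_trans ?_ hK
    refine mul_le_mul_of_nonneg_left ?_ hc₀.le
    exact Real.rpow_le_rpow_of_exponent_le h1 (le_max_right _ _)
  have h3 := Real.rpow_le_rpow (by positivity) h2 hβ.le
  rw [← Real.rpow_mul (by positivity), one_div_mul_cancel hβ.ne', Real.rpow_one,
    Real.div_rpow (by positivity) hc₀.le] at h3
  have h4 : (gap W)⁻¹ ≤ 2 / (1 - rho W) := by
    rw [inv_le_comm₀ hg (by positivity), inv_div]; exact half_one_sub_rho_le_gap hρ
  calc (gap W)⁻¹ ^ 2 ≤ (2 / (1 - rho W)) ^ 2 := by gcongr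
    _ = 4 * (1 / (1 - rho W) ^ 2) := by rw [div_pow]; ring
    _ ≤ 4 * ((K : ℝ) ^ β / c₀ ^ β) := by gcongr
    _ = _ := by rw [Real.rpow_neg hc₀.le]; ring

/-- Passing from the gap to `1 - ρ` costs a factor `2`, also for the power `α`, because `2 ^ α ≤ 2`.
-/
lemma rate_div_le {n : ℕ} {W : Matrix (Fin n) (Fin n) ℝ} (hρ : rho W < 1) {α β : ℝ} {K : ℕ}
    (hβ : 0 < β) (hα : β < α) (hα1 : α < 1) (hK : 1 ≤ K) :
    rate α β (gap W) K / K ≤ 2 * (1 + Real.log K) * (1 / (K : ℝ) ^ (1 - α)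
      + 1 / ((1 - rho W) ^ α * (K : ℝ) ^ α) + 1 / (K : ℝ) ^ (1 - β)
      + 1 / ((1 - rho W) * (K : ℝ) ^ β)) := by
  have hr : 0 < 1 - rho W := by linarith
  have hg := gap_pos hρ
  have hK1 : (1 : ℝ) ≤ K := by exact_mod_cast hK
  have hK0 : (0 : ℝ) < K := by linarith
  have hl : 0 ≤ Real.log K := Real.log_nonneg hK1
  have h4 : (gap W)⁻¹ ≤ 2 * (1 - rho W)⁻¹ := by
    rw [inv_le_comm₀ hg (by positivity), mul_inv, inv_inv, inv_mul_eq_div]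
    exact half_one_sub_rho_le_gap hρ
  have h5 : gap W ^ (-α) ≤ 2 * ((1 - rho W) ^ α)⁻¹ := by
    rw [Real.rpow_neg hg.le, ← Real.inv_rpow hg.le, ← Real.inv_rpow hr.le]
    calc _ ≤ (2 * (1 - rho W)⁻¹) ^ α := by gcongr; linarith
      _ = 2 ^ α * (1 - rho W)⁻¹ ^ α := Real.mul_rpow (by norm_num) (by positivity)
      _ ≤ 2 ^ (1 : ℝ) * (1 - rho W)⁻¹ ^ α := by gcongr; norm_num
      _ = _ := by rw [Real.rpow_one]
  have e : ∀ a : ℝ, (K : ℝ) ^ a / K = 1 / (K : ℝ) ^ (1 - a) := fun a => by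
    rw [Real.rpow_sub hK0, Real.rpow_one]; field_simp
  have e' : ∀ a : ℝ, (K : ℝ) ^ (1 - a) / K = 1 / (K : ℝ) ^ a := fun a => by
    rw [Real.rpow_sub hK0, Real.rpow_one]; field_simp
  have hsum : rate α β (gap W) K / K = (1 + Real.log K) * ((K : ℝ) ^ α / K
      + gap W ^ (-α) * ((K : ℝ) ^ (1 - α) / K) + (K : ℝ) ^ β / K
      + (gap W)⁻¹ * ((K : ℝ) ^ (1 - β) / K)) := by unfold rate; ring
  rw [hsum, e', e', e, e, mul_comm 2, mul_assoc]
  refine mul_le_mul_of_nonneg_left ?_ (by linarith)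
  have a1 : 0 ≤ 1 / (K : ℝ) ^ (1 - α) := by positivity
  have a3 : 0 ≤ 1 / (K : ℝ) ^ (1 - β) := by positivity
  have a2 := mul_le_mul_of_nonneg_right h5 (by positivity : 0 ≤ 1 / (K : ℝ) ^ α)
  have a4 := mul_le_mul_of_nonneg_right h4 (by positivity : 0 ≤ 1 / (K : ℝ) ^ β)
  have e2 : 1 / ((1 - rho W) ^ α * (K : ℝ) ^ α) = ((1 - rho W) ^ α)⁻¹ * (1 / (K : ℝ) ^ α) := by
    rw [one_div, mul_inv, one_div]
  have e4 : 1 / ((1 - rho W) * (K : ℝ) ^ β) = (1 - rho W)⁻¹ * (1 / (K : ℝ) ^ β) := by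
    rw [one_div, mul_inv, one_div]
  rw [e2, e4]
  linarith

/-! ### Unbiased oracles evaluated at independent samples -/

section oracle

variable {Ω Ξ A E : Type*} {m : MeasurableSpace Ω} [mΩ : MeasurableSpace Ω]
  [mΞ : MeasurableSpace Ξ] [MeasurableSpace A]
  {Pr : Measure Ω} [IsProbabilityMeasure Pr] {ν : Measure Ξ}
  {ξ : Ω → Ξ} {X : Ω → A}

lemma map_prodMk_eq (hm : m ≤ mΩ) (hξ : Measurable ξ) (hlaw : Pr.map ξ = ν)
    (hind : Indep m (mΞ.comap ξ) Pr) (hX : Measurable[m] X) :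
    Pr.map (fun ω => (X ω, ξ ω)) = (Pr.map X).prod ν := by
  have h : IndepFun X ξ Pr := by
    rw [IndepFun_iff_Indep]
    exact indep_of_indep_of_le_left hind hX.comap_le
  rw [← hlaw]
  exact h.map_prod_eq_prod_map_map (hX.mono hm le_rfl).aemeasurable hξ.aemeasurable

variable [IsProbabilityMeasure ν] [NormedAddCommGroup E] [MeasurableSpace E] [BorelSpace E]

lemma ae_norm_oracle_le (hm : m ≤ mΩ) (hξ : Measurable ξ) (hlaw : Pr.map ξ = ν)
    (hind : Indep m (mΞ.comap ξ) Pr) (hX : Measurable[m] X) {G : A × Ξ → E} (hG : Measurable G)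
    {C : ℝ} (hC : ∀ a, ∀ᵐ z ∂ν, ‖G (a, z)‖ ≤ C) : ∀ᵐ ω ∂Pr, ‖G (X ω, ξ ω)‖ ≤ C := by
  have hX' : Measurable X := hX.mono hm le_rfl
  have hs : MeasurableSet {q : A × Ξ | ‖G q‖ ≤ C} := measurableSet_le hG.norm measurable_const
  have h1 : ∀ᵐ q ∂(Pr.map X).prod ν, ‖G q‖ ≤ C := by
    have := Measure.isProbabilityMeasure_map (μ := Pr) hX'.aemeasurable
    exact (Measure.ae_prod_iff_ae_ae hs).2 (Filter.Eventually.of_forall hC)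
  rw [← map_prodMk_eq hm hξ hlaw hind hX] at h1
  exact (ae_map_iff (hX'.prodMk hξ).aemeasurable hs).1 h1

variable [InnerProductSpace ℝ E] [SecondCountableTopology E]

lemma integrable_inner_of_ae_bound {T g : Ω → E} (hT : Measurable T) (hg : Measurable g)
    {M C : ℝ} (hTM : ∀ᵐ ω ∂Pr, ‖T ω‖ ≤ M) (hgC : ∀ᵐ ω ∂Pr, ‖g ω‖ ≤ C) :
    Integrable (fun ω => (inner ℝ (T ω) (g ω) : ℝ)) Pr := by
  refine Integrable.of_bound (hT.inner hg).aestronglyMeasurable (M * C) ?_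
  filter_upwards [hTM, hgC] with ω h1 h2
  exact (norm_inner_le_norm _ _).trans
    (mul_le_mul h1 h2 (norm_nonneg _) ((norm_nonneg _).trans h1))

lemma measurable_oracle_mean {G : A × Ξ → E} (hG : Measurable G) :
    Measurable fun a => ∫ z, G (a, z) ∂ν :=
  (hG.stronglyMeasurable.integral_prod_right' (ν := ν)).measurable

/-- The joint law of `(T, X)` and the fresh sample is a product measure. By Fubini the inner
integral over the sample, with `T` and `X` frozen, is zero. -/
lemma integral_inner_oracle_sub_mean [CompleteSpace E] (hm : m ≤ mΩ) (hξ : Measurable ξ)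
    (hlaw : Pr.map ξ = ν) (hind : Indep m (mΞ.comap ξ) Pr) (hX : Measurable[m] X)
    {G : A × Ξ → E} (hG : Measurable G) {C : ℝ} (hC : ∀ a, ∀ᵐ z ∂ν, ‖G (a, z)‖ ≤ C)
    {T : Ω → E} (hT : Measurable[m] T) {M : ℝ} (hTM : ∀ᵐ ω ∂Pr, ‖T ω‖ ≤ M) :
    Integrable (fun ω => (inner ℝ (T ω) (G (X ω, ξ ω) - ∫ z, G (X ω, z) ∂ν) : ℝ)) Pr ∧
    ∫ ω, (inner ℝ (T ω) (G (X ω, ξ ω) - ∫ z, G (X ω, z) ∂ν) : ℝ) ∂Pr = 0 := by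
  have hX' : Measurable X := hX.mono hm le_rfl
  have hT' : Measurable T := hT.mono hm le_rfl
  have hmean : Measurable fun a => ∫ z, G (a, z) ∂ν := measurable_oracle_mean hG
  have hmeanC : ∀ a, ‖∫ z, G (a, z) ∂ν‖ ≤ C := fun a => by
    simpa using norm_integral_le_of_norm_le_const (hC a)
  have hg : Measurable fun ω => G (X ω, ξ ω) - ∫ z, G (X ω, z) ∂ν :=
    (hG.comp (hX'.prodMk hξ)).sub (hmean.comp hX')
  have hint : Integrable (fun ω => (inner ℝ (T ω) (G (X ω, ξ ω) - ∫ z, G (X ω, z) ∂ν) : ℝ)) Pr := by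
    refine integrable_inner_of_ae_bound (C := C + C) hT' hg hTM ?_
    filter_upwards [ae_norm_oracle_le hm hξ hlaw hind hX hG hC] with ω h
    exact (norm_sub_le _ _).trans (add_le_add h (hmeanC _))
  refine ⟨hint, ?_⟩
  set h : (E × A) × Ξ → ℝ := fun q => inner ℝ q.1.1 (G (q.1.2, q.2) - ∫ z, G (q.1.2, z) ∂ν) with hh
  have hhm : Measurable h := by
    refine Measurable.inner (measurable_fst.comp measurable_fst) ?_
    exact (hG.comp ((measurable_snd.comp measurable_fst).prodMk measurable_snd)).sub
      (hmean.comp (measurable_snd.comp measurable_fst))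
  have hTX : Measurable[m] fun ω => (T ω, X ω) := hT.prodMk hX
  have hTX' : Measurable fun ω => (T ω, X ω) := hTX.mono hm le_rfl
  have hmap := map_prodMk_eq hm hξ hlaw hind hTX
  have e1 : ∫ ω, (inner ℝ (T ω) (G (X ω, ξ ω) - ∫ z, G (X ω, z) ∂ν) : ℝ) ∂Pr
      = ∫ q, h q ∂(Pr.map fun ω => (T ω, X ω)).prod ν := by
    rw [← hmap, integral_map (hTX'.prodMk hξ).aemeasurable hhm.aestronglyMeasurable]
  have hinth : Integrable h ((Pr.map fun ω => (T ω, X ω)).prod ν) := by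
    rw [← hmap, integrable_map_measure hhm.aestronglyMeasurable (hTX'.prodMk hξ).aemeasurable]
    exact hint
  have : IsProbabilityMeasure (Pr.map fun ω => (T ω, X ω)) :=
    Measure.isProbabilityMeasure_map hTX'.aemeasurable
  rw [e1, integral_prod _ hinth]
  refine integral_eq_zero_of_ae (Filter.Eventually.of_forall fun q => ?_)
  have hGi : Integrable (fun z => G (q.2, z)) ν :=
    Integrable.of_bound (hG.comp (measurable_const.prodMk measurable_id)).aestronglyMeasurable C
      (hC q.2)
  simp only [hh, Pi.zero_apply]
  have e2 := integral_inner (𝕜 := ℝ) (f := fun z => G (q.2, z) - ∫ z, G (q.2, z) ∂ν)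
    (hGi.sub (integrable_const _)) q.1
  rw [e2, integral_sub hGi (integrable_const _)]
  simp

end oracle

/-! ### Measurability of the iteration -/

/-- A random state with measurable entries. -/
structure MeasurableState {n p d : ℕ} {Ω : Type*}
    (m : MeasurableSpace Ω) (s : Ω → State n p d) :
    Prop where
  x : ∀ i, Measurable fun ω => (s ω).x i
  y : ∀ i, Measurable fun ω => (s ω).y i
  mx : ∀ i j, Measurable fun ω => (s ω).mx i j
  my : ∀ i j, Measurable fun ω => (s ω).my i j

section measurable

variable {n p d : ℕ} {Ω : Type*} {m : MeasurableSpace Ω} {s : Ω → State n p d}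

lemma measurable_nmean {E : Type*} [NormedAddCommGroup E] [NormedSpace ℝ E] [MeasurableSpace E]
    [BorelSpace E] [SecondCountableTopology E] {u : Ω → Fin n → E}
    (h : ∀ i, Measurable fun ω => u ω i) : Measurable fun ω => nmean (u ω) := by
  unfold nmean
  exact (Finset.measurable_fun_sum _ fun i _ => h i).const_smul _

lemma measurable_mix {E : Type*} [NormedAddCommGroup E] [NormedSpace ℝ E] [MeasurableSpace E]
    [BorelSpace E] [SecondCountableTopology E] {W : Matrix (Fin n) (Fin n) ℝ} {u : Ω → Fin n → E}
    (h : ∀ i, Measurable fun ω => u ω i) (i : Fin n) : Measurable fun ω => mix W (u ω) i := by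
  unfold mix
  exact Finset.measurable_fun_sum _ fun j _ => (h j).const_smul _

lemma measurable_toLp {q : ℕ} {u : Ω → Fin q → ℝ} (h : ∀ j, Measurable fun ω => u ω j) :
    Measurable fun ω => (WithLp.toLp 2 (u ω) : Vec q) :=
  (WithLp.measurable_toLp 2 _).comp (measurable_pi_iff.2 h)

lemma measurable_apply {q : ℕ} {u : Ω → Vec q} (h : Measurable u) (j : Fin q) :
    Measurable fun ω => u ω j :=
  (measurable_pi_apply j).comp ((WithLp.measurable_ofLp 2 _).comp h)

namespace MeasurableState

lemma mono {m' : MeasurableSpace Ω} (h : MeasurableState m s) (hm : m ≤ m') :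
    MeasurableState m' s :=
  ⟨fun i => (h.x i).mono hm le_rfl, fun i => (h.y i).mono hm le_rfl,
    fun i j => (h.mx i j).mono hm le_rfl, fun i j => (h.my i j).mono hm le_rfl⟩

lemma xbar (h : MeasurableState m s) : Measurable fun ω => (s ω).xbar := measurable_nmean h.x

lemma pmax {a : Ω → Fin p → ℝ} {b : Ω → Fin d → ℝ} (ha : ∀ j, Measurable fun ω => a ω j)
    (hb : ∀ j, Measurable fun ω => b ω j) (j : Fin p) :
    Measurable fun ω => pmax (a ω) (b ω) j := by
  unfold DAdaST.pmax
  split_ifs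
  · exact (ha j).max (hb _)
  · exact ha j

lemma vref (h : MeasurableState m s) : Measurable fun ω => (s ω).vref := by
  unfold State.vref
  exact measurable_nmean (pmax (fun j => measurable_nmean fun i => h.mx i j)
    fun j => measurable_nmean fun i => h.my i j)

lemma avg_U (h : MeasurableState m s) : Measurable fun ω => avg (s ω).U := by
  unfold avg
  exact (Finset.measurable_fun_sum _ fun i _ =>
    Finset.measurable_fun_sum _ fun j _ => h.my i j).const_mul _

lemma step {Y : Set (Vec d)} (hY : IsClosed Y) (hconv : Convex ℝ Y) (hne : Y.Nonempty)
    {W : Matrix (Fin n) (Fin n) ℝ} {H : Hyper} {gx : Ω → Fin n → Vec p} {gy : Ω → Fin n → Vec d}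
    (h : MeasurableState m s) (hgx : ∀ i, Measurable fun ω => gx ω i)
    (hgy : ∀ i, Measurable fun ω => gy ω i) :
    MeasurableState m fun ω => step Y W H (gx ω) (gy ω) (s ω) := by
  have hmx : ∀ i j, Measurable fun ω => (DAdaST.step Y W H (gx ω) (gy ω) (s ω)).mx i j :=
    fun i j => by
      have e : ∀ ω, (DAdaST.step Y W H (gx ω) (gy ω) (s ω)).mx i j
          = mix W (fun i => (s ω).mx i j + gx ω i j * gx ω i j) i := fun ω => by
        simp [DAdaST.step, mix, Finset.sum_apply]
      simp only [e]
      exact measurable_mix (fun i => (h.mx i j).add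
        ((measurable_apply (hgx i) j).mul (measurable_apply (hgx i) j))) i
  have hmy : ∀ i j, Measurable fun ω => (DAdaST.step Y W H (gx ω) (gy ω) (s ω)).my i j :=
    fun i j => by
      have e : ∀ ω, (DAdaST.step Y W H (gx ω) (gy ω) (s ω)).my i j
          = mix W (fun i => (s ω).my i j + gy ω i j * gy ω i j) i := fun ω => by
        simp [DAdaST.step, mix, Finset.sum_apply]
      simp only [e]
      exact measurable_mix (fun i => (h.my i j).add
        ((measurable_apply (hgy i) j).mul (measurable_apply (hgy i) j))) i
  refine ⟨fun i => ?_, fun i => ?_, hmx, hmy⟩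
  · have e : (fun ω => (DAdaST.step Y W H (gx ω) (gy ω) (s ω)).x i) = fun ω => mix W (fun i =>
        (s ω).x i - H.γx • WithLp.toLp 2 fun j =>
          DAdaST.pmax ((DAdaST.step Y W H (gx ω) (gy ω) (s ω)).mx i)
            ((DAdaST.step Y W H (gx ω) (gy ω) (s ω)).my i) j ^ (-H.α) * gx ω i j) i := rfl
    rw [e]
    refine measurable_mix (fun i => (h.x i).sub (Measurable.const_smul (measurable_toLp fun j => ?_)
      H.γx)) i
    exact ((pmax (hmx i) (hmy i) j).pow_const _).mul (measurable_apply (hgx i) j)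
  · have e : (fun ω => (DAdaST.step Y W H (gx ω) (gy ω) (s ω)).y i) = fun ω => proj Y (mix W
        (fun i => (s ω).y i + H.γy • WithLp.toLp 2 fun j =>
          (DAdaST.step Y W H (gx ω) (gy ω) (s ω)).my i j ^ (-H.β) * gy ω i j) i) := rfl
    rw [e]
    refine (continuous_proj hY hconv hne).measurable.comp
      (measurable_mix (fun i => (h.y i).add (Measurable.const_smul (measurable_toLp fun j => ?_)
        H.γy)) i)
    exact ((hmy i j).pow_const _).mul (measurable_apply (hgy i) j)

end MeasurableState

end measurable

namespace Problem

variable {n p d : ℕ} {Ξ : Type*} [MeasurableSpace Ξ] {P : Problem n p d Ξ} {μ L C : ℝ}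

/-- The primal stochastic gradient oracle on `ℝ^p × Y`. -/
noncomputable def oracleX (P : Problem n p d Ξ) (i : Fin n) (q : (Vec p × P.Y) × Ξ) : Vec p :=
  P.sgradX i q.1.1 (q.1.2 : Vec d) q.2

/-- The dual stochastic gradient oracle on `ℝ^p × Y`. -/
noncomputable def oracleY (P : Problem n p d Ξ) (i : Fin n) (q : (Vec p × P.Y) × Ξ) : Vec d :=
  P.sgradY i q.1.1 (q.1.2 : Vec d) q.2

lemma measurable_oracleX (hS : P.Setting) (i : Fin n) : Measurable (P.oracleX i) :=
  (hS.measX i).comp ((measurable_fst.comp measurable_fst).prodMk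
    ((measurable_snd.comp measurable_fst).prodMk measurable_snd))

lemma measurable_oracleY (hS : P.Setting) (i : Fin n) : Measurable (P.oracleY i) :=
  (hS.measY i).comp ((measurable_fst.comp measurable_fst).prodMk
    ((measurable_snd.comp measurable_fst).prodMk measurable_snd))

variable {Ω : Type*} {m : MeasurableSpace Ω} {x : Ω → Vec p} {y : Ω → Vec d}

/-- Unbiasedness presents the gradient as an integral of the jointly measurable oracle. That oracle
is measurable only over `Y`, hence the subtype. -/
lemma measurable_gradX (hS : P.Setting) (hG : P.StochGrad C) (i : Fin n) (hx : Measurable x)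
    (hy : Measurable y) (hyY : ∀ ω, y ω ∈ P.Y) : Measurable fun ω => P.gradX i (x ω) (y ω) := by
  have := hS.prob i
  have e : ∀ ω, P.gradX i (x ω) (y ω) = ∫ z, P.oracleX i ((x ω, ⟨y ω, hyY ω⟩), z) ∂P.dist i :=
    fun ω => (hG.unbiasedX i (x ω) (y ω) (hyY ω)).symm
  simp only [e]
  exact (measurable_oracle_mean (measurable_oracleX hS i)).comp (hx.prodMk (hy.subtype_mk))

lemma measurable_gradY (hS : P.Setting) (hG : P.StochGrad C) (i : Fin n) (hx : Measurable x)
    (hy : Measurable y) (hyY : ∀ ω, y ω ∈ P.Y) : Measurable fun ω => P.gradY i (x ω) (y ω) := by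
  have := hS.prob i
  have e : ∀ ω, P.gradY i (x ω) (y ω) = ∫ z, P.oracleY i ((x ω, ⟨y ω, hyY ω⟩), z) ∂P.dist i :=
    fun ω => (hG.unbiasedY i (x ω) (y ω) (hyY ω)).symm
  simp only [e]
  exact (measurable_oracle_mean (measurable_oracleY hS i)).comp (hx.prodMk (hy.subtype_mk))

lemma continuous_yStar (hn : 0 < n) (hμ : 0 < μ) (hL : 0 < L) (hS : P.Setting)
    (hC : P.StronglyConcave μ) (hsm : P.Smooth L) (hG : P.StochGrad C) (hne : P.Y.Nonempty) :
    Continuous P.yStar :=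
  (LipschitzWith.of_dist_le_mul (K := (2 * (L / μ)).toNNReal) fun x x' => by
    rw [Real.coe_toNNReal _ (by positivity), dist_eq_norm, dist_eq_norm]
    exact norm_yStar_sub_le hn hμ hL hS hC hsm hG hne x x').continuous

end Problem

/-- The information carried by the samples drawn before iteration `k`. -/
@[reducible] def past {n : ℕ} {Ω Ξ : Type*} [MeasurableSpace Ξ]
    (ξ : Block → Fin n → ℕ → Ω → Ξ) (k : ℕ) : MeasurableSpace Ω :=
  ⨆ t ∈ {t : Block × Fin n × ℕ | t.2.2 < k}, MeasurableSpace.comap (ξ t.1 t.2.1 t.2.2) inferInstance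

section past

variable {n p d : ℕ} {Ω Ξ : Type*} [mΞ : MeasurableSpace Ξ]
  {ξ : Block → Fin n → ℕ → Ω → Ξ}

lemma past_le [mΩ : MeasurableSpace Ω] {Pr : Measure Ω} {P : Problem n p d Ξ}
    (h : IIDSamples P Pr ξ) (k : ℕ) : past ξ k ≤ mΩ :=
  iSup₂_le fun t _ => (h.meas t.1 t.2.1 t.2.2).comap_le

lemma past_mono {k l : ℕ} (h : k ≤ l) : past ξ k ≤ past ξ l :=
  biSup_mono fun _ ht => lt_of_lt_of_le ht h

lemma measurable_sample_past (b : Block) (i : Fin n) (k : ℕ) :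
    Measurable[past ξ (k + 1)] (ξ b i k) := by
  rw [measurable_iff_comap_le]
  exact le_biSup (fun t : Block × Fin n × ℕ => mΞ.comap (ξ t.1 t.2.1 t.2.2))
    (i := (b, i, k)) (Nat.lt_succ_self k)

/-- The indices before `k` and the single index `(b, i, k)` are disjoint sets in an independent
family. -/
lemma indep_past [MeasurableSpace Ω] {Pr : Measure Ω} {P : Problem n p d Ξ}
    (h : IIDSamples P Pr ξ) (b : Block) (i : Fin n) (k : ℕ) :
    Indep (past ξ k) (mΞ.comap (ξ b i k)) Pr := by
  have h1 := indep_iSup_of_disjoint (fun t : Block × Fin n × ℕ => (h.meas t.1 t.2.1 t.2.2).comap_le)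
    h.indep.iIndep (S := {t | t.2.2 < k}) (T := {(b, i, k)})
    (Set.disjoint_singleton_right.2 (by simp))
  rwa [iSup_singleton] at h1

end past

/-- The primal stochastic gradients drawn along the iteration. -/
noncomputable def sampleX {n p d : ℕ} {Ω Ξ : Type*} [MeasurableSpace Ξ] (P : Problem n p d Ξ)
    (W : Matrix (Fin n) (Fin n) ℝ) (H : Hyper) (s₀ : State n p d) (ξ : Block → Fin n → ℕ → Ω → Ξ)
    (k : ℕ) (ω : Ω) (i : Fin n) : Vec p :=
  P.sgradX i ((iter P W H s₀ ξ k ω).x i) ((iter P W H s₀ ξ k ω).y i) (ξ Block.primal i k ω)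

/-- The dual stochastic gradients drawn along the iteration. -/
noncomputable def sampleY {n p d : ℕ} {Ω Ξ : Type*} [MeasurableSpace Ξ] (P : Problem n p d Ξ)
    (W : Matrix (Fin n) (Fin n) ℝ) (H : Hyper) (s₀ : State n p d) (ξ : Block → Fin n → ℕ → Ω → Ξ)
    (k : ℕ) (ω : Ω) (i : Fin n) : Vec d :=
  P.sgradY i ((iter P W H s₀ ξ k ω).x i) ((iter P W H s₀ ξ k ω).y i) (ξ Block.dual i k ω)

/-- The assumptions on the problem, the network, the samples and the initial state. -/
structure Model {n p d : ℕ} {Ω Ξ : Type*} {mΩ : MeasurableSpace Ω} [MeasurableSpace Ξ]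
    (Pr : Measure Ω) (P : Problem n p d Ξ) (W : Matrix (Fin n) (Fin n) ℝ) (H : Hyper)
    (s₀ : State n p d) (ξ : Block → Fin n → ℕ → Ω → Ξ) (μ L C c c' R Δ : ℝ) (Z : ℝ≥0) : Prop where
  hn : 0 < n
  hp : 0 < p
  hd : 0 < d
  hγx : 0 < H.γx
  hγy : 0 < H.γy
  hβ : 0 < H.β
  hα : H.β < H.α
  hα1 : H.α < 1
  hμ : 0 < μ
  hL : 0 < L
  hC : 0 < C
  hc : 0 < c
  setting : P.Setting
  conc : P.StronglyConcave μ
  smooth : P.Smooth L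
  grad : P.StochGrad C
  hΔ : ∀ x x', P.Phi x - P.Phi x' ≤ Δ
  hW : W ∈ doublyStochastic ℝ (Fin n)
  hρ : rho W < 1
  iid : IIDSamples P Pr ξ
  y0 : ∀ i, s₀.y i ∈ P.Y
  x0 : ∑ i, ‖s₀.x i - s₀.xbar‖ ^ 2 ≤ R
  mx0 : ∀ i j, c ≤ s₀.mx i j ∧ s₀.mx i j ≤ c'
  my0 : ∀ i j, c ≤ s₀.my i j ∧ s₀.my i j ≤ c'
  iV : supBound Pr (fun k ω => incons H.α (iter P W H s₀ ξ k ω).V) ≤ Z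
  iU : supBound Pr (fun k ω => incons H.β (iter P W H s₀ ξ k ω).U) ≤ Z

lemma ae_le_of_supBound_le {Ω : Type*} [MeasurableSpace Ω] {Pr : Measure Ω} {r : ℕ → Ω → ℝ}
    {Z : ℝ≥0∞} (hZ : Z ≠ ⊤) (h : supBound Pr r ≤ Z) : ∀ᵐ ω ∂Pr, ∀ k, r k ω ≤ Z.toReal := by
  rw [ae_all_iff]
  intro k
  filter_upwards [ENNReal.ae_le_essSup (μ := Pr) fun ω => ENNReal.ofReal (r k ω)] with ω hω
  have h1 : ENNReal.ofReal (r k ω) ≤ Z :=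
    hω.trans ((le_iSup (fun k => essSup (fun ω => ENNReal.ofReal (r k ω)) Pr) k).trans h)
  exact (ENNReal.ofReal_le_iff_le_toReal hZ).1 h1

namespace Model

variable {n p d : ℕ} {Ω Ξ : Type*} {mΩ : MeasurableSpace Ω} [mΞ : MeasurableSpace Ξ]
  {Pr : Measure Ω} [IsProbabilityMeasure Pr] {P : Problem n p d Ξ}
  {W : Matrix (Fin n) (Fin n) ℝ} {H : Hyper} {s₀ : State n p d} {ξ : Block → Fin n → ℕ → Ω → Ξ}
  {μ L C c c' R Δ : ℝ} {Z : ℝ≥0}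

section

omit [IsProbabilityMeasure Pr]

lemma nonempty (h : Model Pr P W H s₀ ξ μ L C c c' R Δ Z) : P.Y.Nonempty := ⟨_, h.y0 ⟨0, h.hn⟩⟩

lemma y_mem (h : Model Pr P W H s₀ ξ μ L C c c' R Δ Z) (k : ℕ) (ω : Ω) (i : Fin n) :
    (iter P W H s₀ ξ k ω).y i ∈ P.Y := by
  cases k with
  | zero => exact h.y0 i
  | succ k => exact proj_mem h.setting.closed h.setting.convex h.nonempty _

lemma measurable_sampleX (h : Model Pr P W H s₀ ξ μ L C c c' R Δ Z) {m : MeasurableSpace Ω} {k : ℕ}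
    (hs : MeasurableState m fun ω => iter P W H s₀ ξ k ω)
    (hξ : ∀ b i, Measurable[m] (ξ b i k)) (i : Fin n) :
    Measurable[m] fun ω => sampleX P W H s₀ ξ k ω i :=
  (Problem.measurable_oracleX h.setting i).comp
    (((hs.x i).prodMk ((hs.y i).subtype_mk (h := fun ω => h.y_mem k ω i))).prodMk
      (hξ Block.primal i))

lemma measurable_sampleY (h : Model Pr P W H s₀ ξ μ L C c c' R Δ Z) {m : MeasurableSpace Ω} {k : ℕ}
    (hs : MeasurableState m fun ω => iter P W H s₀ ξ k ω)
    (hξ : ∀ b i, Measurable[m] (ξ b i k)) (i : Fin n) :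
    Measurable[m] fun ω => sampleY P W H s₀ ξ k ω i :=
  (Problem.measurable_oracleY h.setting i).comp
    (((hs.x i).prodMk ((hs.y i).subtype_mk (h := fun ω => h.y_mem k ω i))).prodMk
      (hξ Block.dual i))

lemma measurableState (h : Model Pr P W H s₀ ξ μ L C c c' R Δ Z) (k : ℕ) :
    MeasurableState (past ξ k) fun ω => iter P W H s₀ ξ k ω := by
  induction k with
  | zero =>
    simp only [iter]
    exact ⟨fun i => measurable_const, fun i => measurable_const, fun i j => measurable_const,
      fun i j => measurable_const⟩
  | succ k ih =>
    have hs := ih.mono (past_mono (ξ := ξ) (Nat.le_succ k))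
    exact hs.step h.setting.closed h.setting.convex h.nonempty
      (h.measurable_sampleX hs fun b i => measurable_sample_past b i k)
      (h.measurable_sampleY hs fun b i => measurable_sample_past b i k)

lemma measurable_lagRef (h : Model Pr P W H s₀ ξ μ L C c c' R Δ Z) (k : ℕ) :
    Measurable[past ξ k] fun ω => lagRef c H.β (fun k => iter P W H s₀ ξ k ω) k := by
  induction k with
  | zero => exact (h.measurableState 0).xbar
  | succ k ih =>
    have h1 : Measurable[past ξ k] fun ω => lagRef c H.β (fun k => iter P W H s₀ ξ k ω) (k + 1) :=
      ih.add (((((h.measurableState k).avg_U).pow_const _).const_mul _).smul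
        ((h.measurableState k).xbar.sub ih))
    exact h1.mono (past_mono (Nat.le_succ k)) le_rfl

lemma continuous_yStar (h : Model Pr P W H s₀ ξ μ L C c c' R Δ Z) : Continuous P.yStar :=
  Problem.continuous_yStar h.hn h.hμ h.hL h.setting h.conc h.smooth h.grad h.nonempty

lemma yStar_mem (h : Model Pr P W H s₀ ξ μ L C c c' R Δ Z) (x : Vec p) : P.yStar x ∈ P.Y :=
  (Problem.yStar_spec h.hn h.hμ h.setting h.conc h.smooth h.grad h.nonempty x).1

lemma measurable_gradient (h : Model Pr P W H s₀ ξ μ L C c c' R Δ Z) (k : ℕ) :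
    Measurable[past ξ k] fun ω =>
      P.avgX (iter P W H s₀ ξ k ω).xbar (P.yStar (iter P W H s₀ ξ k ω).xbar) := by
  have hx := (h.measurableState k).xbar
  exact measurable_nmean fun i => Problem.measurable_gradX h.setting h.grad i hx
    (h.continuous_yStar.measurable.comp hx) fun ω => h.yStar_mem _

end

lemma ae_norm_sampleX_le (h : Model Pr P W H s₀ ξ μ L C c c' R Δ Z) :
    ∀ᵐ ω ∂Pr, ∀ k i, ‖sampleX P W H s₀ ξ k ω i‖ ≤ C := by
  simp only [ae_all_iff]
  intro k i
  have := h.setting.prob i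
  have hs := h.measurableState k
  have key := ae_norm_oracle_le (past_le h.iid k) (h.iid.meas Block.primal i k)
    (h.iid.law Block.primal i k) (indep_past h.iid Block.primal i k)
    (X := fun ω => ((iter P W H s₀ ξ k ω).x i, (⟨(iter P W H s₀ ξ k ω).y i, h.y_mem k ω i⟩ : P.Y)))
    ((hs.x i).prodMk ((hs.y i).subtype_mk)) (Problem.measurable_oracleX h.setting i)
    fun a => h.grad.boundX i a.1 a.2 a.2.2
  exact key

lemma ae_norm_sampleY_le (h : Model Pr P W H s₀ ξ μ L C c c' R Δ Z) :
    ∀ᵐ ω ∂Pr, ∀ k i, ‖sampleY P W H s₀ ξ k ω i‖ ≤ C := by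
  simp only [ae_all_iff]
  intro k i
  have := h.setting.prob i
  have hs := h.measurableState k
  have key := ae_norm_oracle_le (past_le h.iid k) (h.iid.meas Block.dual i k)
    (h.iid.law Block.dual i k) (indep_past h.iid Block.dual i k)
    (X := fun ω => ((iter P W H s₀ ξ k ω).x i, (⟨(iter P W H s₀ ξ k ω).y i, h.y_mem k ω i⟩ : P.Y)))
    ((hs.x i).prodMk ((hs.y i).subtype_mk)) (Problem.measurable_oracleY h.setting i)
    fun a => h.grad.boundY i a.1 a.2 a.2.2
  exact key

/-- Almost every realization is a trajectory with bounded gradients and bounded inconsistency. -/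
lemma ae_run (h : Model Pr P W H s₀ ξ μ L C c c' R Δ Z) :
    ∀ᵐ ω ∂Pr, Run P W H μ L C c c' R Δ Z (fun k => iter P W H s₀ ξ k ω)
      (fun k => sampleX P W H s₀ ξ k ω) (fun k => sampleY P W H s₀ ξ k ω) := by
  filter_upwards [h.ae_norm_sampleX_le, h.ae_norm_sampleY_le,
    ae_le_of_supBound_le ENNReal.coe_ne_top h.iV,
    ae_le_of_supBound_le ENNReal.coe_ne_top h.iU] with ω h1 h2 h3 h4
  exact ⟨h.hn, h.hp, h.hd, h.hγx, h.hγy, h.hβ, h.hα, h.hα1, h.hμ, h.hL, h.hC, h.hc, h.setting,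
    h.conc, h.smooth, h.grad, h.hΔ, h.hW, h.hρ, fun k => rfl, h.y0, h.x0, h.mx0, h.my0, h1, h2,
    h3, h4⟩

/-! ### The noise terms have mean zero -/

/-- The coefficient `a` is merged into the test vector, which is known before iteration `k`; then
every node contributes zero. -/
lemma integral_noiseX (h : Model Pr P W H s₀ ξ μ L C c c' R Δ Z) (k : ℕ) {a : Ω → ℝ}
    {T : Ω → Vec p} (ha : Measurable[past ξ k] a) (hT : Measurable[past ξ k] T) {M N : ℝ}
    (haM : ∀ᵐ ω ∂Pr, |a ω| ≤ M) (hTN : ∀ᵐ ω ∂Pr, ‖T ω‖ ≤ N) :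
    Integrable (fun ω => a ω * inner ℝ (T ω) (nmean fun i => sampleX P W H s₀ ξ k ω i
      - P.gradX i ((iter P W H s₀ ξ k ω).x i) ((iter P W H s₀ ξ k ω).y i))) Pr ∧
    ∫ ω, a ω * inner ℝ (T ω) (nmean fun i => sampleX P W H s₀ ξ k ω i
      - P.gradX i ((iter P W H s₀ ξ k ω).x i) ((iter P W H s₀ ξ k ω).y i)) ∂Pr = 0 := by
  have hs := h.measurableState k
  have e : ∀ ω, a ω * inner ℝ (T ω) (nmean fun i => sampleX P W H s₀ ξ k ω i
      - P.gradX i ((iter P W H s₀ ξ k ω).x i) ((iter P W H s₀ ξ k ω).y i))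
      = 1 / (n : ℝ) * ∑ i, inner ℝ (a ω • T ω) (sampleX P W H s₀ ξ k ω i
        - P.gradX i ((iter P W H s₀ ξ k ω).x i) ((iter P W H s₀ ξ k ω).y i)) := fun ω => by
    rw [← inner_sum, real_inner_smul_left, nmean, real_inner_smul_right]; ring
  have e2 : ∀ i ω, ∫ z, P.oracleX i (((iter P W H s₀ ξ k ω).x i,
      (⟨(iter P W H s₀ ξ k ω).y i, h.y_mem k ω i⟩ : P.Y)), z) ∂P.dist i
      = P.gradX i ((iter P W H s₀ ξ k ω).x i) ((iter P W H s₀ ξ k ω).y i) := fun i ω =>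
    h.grad.unbiasedX i _ _ (h.y_mem k ω i)
  have key : ∀ i, Integrable (fun ω => inner ℝ (a ω • T ω) (sampleX P W H s₀ ξ k ω i
        - P.gradX i ((iter P W H s₀ ξ k ω).x i) ((iter P W H s₀ ξ k ω).y i))) Pr ∧
      ∫ ω, inner ℝ (a ω • T ω) (sampleX P W H s₀ ξ k ω i
        - P.gradX i ((iter P W H s₀ ξ k ω).x i) ((iter P W H s₀ ξ k ω).y i)) ∂Pr = 0 := fun i => by
    have := h.setting.prob i
    have key := integral_inner_oracle_sub_mean (past_le h.iid k) (h.iid.meas Block.primal i k)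
      (h.iid.law Block.primal i k) (indep_past h.iid Block.primal i k)
      (X := fun ω => ((iter P W H s₀ ξ k ω).x i,
        (⟨(iter P W H s₀ ξ k ω).y i, h.y_mem k ω i⟩ : P.Y)))
      ((hs.x i).prodMk ((hs.y i).subtype_mk)) (Problem.measurable_oracleX h.setting i)
      (fun a => h.grad.boundX i a.1 a.2 a.2.2) (T := fun ω => a ω • T ω) (ha.smul hT) (M := M * N)
      (by
        filter_upwards [haM, hTN] with ω h1 h2
        rw [norm_smul]
        exact mul_le_mul h1 h2 (norm_nonneg _) ((abs_nonneg _).trans h1))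
    simp only [e2] at key
    exact key
  simp only [e]
  refine ⟨(integrable_finsetSum _ fun i _ => (key i).1).const_mul _, ?_⟩
  rw [integral_const_mul, integral_finsetSum _ fun i _ => (key i).1,
    Finset.sum_eq_zero fun i _ => (key i).2, mul_zero]

lemma integral_noiseY (h : Model Pr P W H s₀ ξ μ L C c c' R Δ Z) (k : ℕ) {a : Ω → ℝ}
    {T : Ω → Fin n → Vec d} (ha : Measurable[past ξ k] a)
    (hT : ∀ i, Measurable[past ξ k] fun ω => T ω i) {M N : ℝ}
    (haM : ∀ᵐ ω ∂Pr, |a ω| ≤ M) (hTN : ∀ᵐ ω ∂Pr, ∀ i, ‖T ω i‖ ≤ N) :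
    Integrable (fun ω => a ω * ∑ i, inner ℝ (T ω i) (sampleY P W H s₀ ξ k ω i
      - P.gradY i ((iter P W H s₀ ξ k ω).x i) ((iter P W H s₀ ξ k ω).y i))) Pr ∧
    ∫ ω, a ω * ∑ i, inner ℝ (T ω i) (sampleY P W H s₀ ξ k ω i
      - P.gradY i ((iter P W H s₀ ξ k ω).x i) ((iter P W H s₀ ξ k ω).y i)) ∂Pr = 0 := by
  have hs := h.measurableState k
  have e : ∀ ω, a ω * ∑ i, inner ℝ (T ω i) (sampleY P W H s₀ ξ k ω i
      - P.gradY i ((iter P W H s₀ ξ k ω).x i) ((iter P W H s₀ ξ k ω).y i))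
      = ∑ i, inner ℝ (a ω • T ω i) (sampleY P W H s₀ ξ k ω i
        - P.gradY i ((iter P W H s₀ ξ k ω).x i) ((iter P W H s₀ ξ k ω).y i)) := fun ω => by
    simp only [Finset.mul_sum, real_inner_smul_left]
  have e2 : ∀ i ω, ∫ z, P.oracleY i (((iter P W H s₀ ξ k ω).x i,
      (⟨(iter P W H s₀ ξ k ω).y i, h.y_mem k ω i⟩ : P.Y)), z) ∂P.dist i
      = P.gradY i ((iter P W H s₀ ξ k ω).x i) ((iter P W H s₀ ξ k ω).y i) := fun i ω =>
    h.grad.unbiasedY i _ _ (h.y_mem k ω i)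
  have key : ∀ i, Integrable (fun ω => inner ℝ (a ω • T ω i) (sampleY P W H s₀ ξ k ω i
        - P.gradY i ((iter P W H s₀ ξ k ω).x i) ((iter P W H s₀ ξ k ω).y i))) Pr ∧
      ∫ ω, inner ℝ (a ω • T ω i) (sampleY P W H s₀ ξ k ω i
        - P.gradY i ((iter P W H s₀ ξ k ω).x i) ((iter P W H s₀ ξ k ω).y i)) ∂Pr = 0 := fun i => by
    have := h.setting.prob i
    have key := integral_inner_oracle_sub_mean (past_le h.iid k) (h.iid.meas Block.dual i k)
      (h.iid.law Block.dual i k) (indep_past h.iid Block.dual i k)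
      (X := fun ω => ((iter P W H s₀ ξ k ω).x i,
        (⟨(iter P W H s₀ ξ k ω).y i, h.y_mem k ω i⟩ : P.Y)))
      ((hs.x i).prodMk ((hs.y i).subtype_mk)) (Problem.measurable_oracleY h.setting i)
      (fun a => h.grad.boundY i a.1 a.2 a.2.2) (T := fun ω => a ω • T ω i) (ha.smul (hT i))
      (M := M * N)
      (by
        filter_upwards [haM, hTN] with ω h1 h2
        rw [norm_smul]
        exact mul_le_mul h1 (h2 i) (norm_nonneg _) ((abs_nonneg _).trans h1))
    simp only [e2] at key
    exact key
  simp only [e]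
  refine ⟨integrable_finsetSum _ fun i _ => (key i).1, ?_⟩
  rw [integral_finsetSum _ fun i _ => (key i).1, Finset.sum_eq_zero fun i _ => (key i).2]

end Model

/-! ### The five noise terms and the integrated bound. -/

namespace Model

variable {n p d : ℕ} {Ω Ξ : Type*} {mΩ : MeasurableSpace Ω} [mΞ : MeasurableSpace Ξ]
  {Pr : Measure Ω} [IsProbabilityMeasure Pr] {P : Problem n p d Ξ}
  {W : Matrix (Fin n) (Fin n) ℝ} {H : Hyper} {s₀ : State n p d} {ξ : Block → Fin n → ℕ → Ω → Ξ}
  {μ L C c c' R Δ : ℝ} {Z : ℝ≥0}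

/-- The scalar sequences along a random trajectory. -/
noncomputable def seqs (P : Problem n p d Ξ) (W : Matrix (Fin n) (Fin n) ℝ) (H : Hyper)
    (s₀ : State n p d) (ξ : Block → Fin n → ℕ → Ω → Ξ) (c : ℝ) (ω : Ω) : Seqs :=
  pathSeqs P H c (fun k => iter P W H s₀ ξ k ω) (fun k => sampleX P W H s₀ ξ k ω)
    fun k => sampleY P W H s₀ ξ k ω

lemma integral_noiseDescent (h : Model Pr P W H s₀ ξ μ L C c c' R Δ Z) (k : ℕ) :
    Integrable (fun ω => (seqs P W H s₀ ξ c ω).noiseDescent k) Pr ∧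
      ∫ ω, (seqs P W H s₀ ξ c ω).noiseDescent k ∂Pr = 0 := by
  have := h.integral_noiseX k (a := fun _ => -1) (M := 1) measurable_const (h.measurable_gradient k)
    (Filter.Eventually.of_forall fun ω => by simp) (N := C) (by
      filter_upwards [h.ae_run] with ω hr
      exact hr.norm_avgX_le _ (hr.yStar_mem _))
  simpa only [seqs, pathSeqs, neg_one_mul] using this

lemma integral_noiseTrack (h : Model Pr P W H s₀ ξ μ L C c c' R Δ Z) (k : ℕ) :
    Integrable (fun ω => (seqs P W H s₀ ξ c ω).noiseTrack k) Pr ∧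
      ∫ ω, (seqs P W H s₀ ξ c ω).noiseTrack k ∂Pr = 0 := by
  have := h.integral_noiseY k (a := fun _ => 1) (M := 1) measurable_const
    (T := fun ω i => (iter P W H s₀ ξ k ω).y i
      - P.yStar (lagRef c H.β (fun k => iter P W H s₀ ξ k ω) k))
    (fun i => ((h.measurableState k).y i).sub
      (h.continuous_yStar.measurable.comp (h.measurable_lagRef k)))
    (Filter.Eventually.of_forall fun ω => by simp) (N := 2 * C / μ) (by
      filter_upwards [h.ae_run] with ω hr i
      exact hr.norm_sub_le (hr.y_mem k i) (hr.yStar_mem _))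
  simpa only [seqs, pathSeqs, one_mul] using this

lemma integral_noiseLag (h : Model Pr P W H s₀ ξ μ L C c c' R Δ Z) (k : ℕ) :
    Integrable (fun ω => (seqs P W H s₀ ξ c ω).noiseLag k) Pr ∧
      ∫ ω, (seqs P W H s₀ ξ c ω).noiseLag k ∂Pr = 0 := by
  have hs := h.measurableState k
  have hu := hs.avg_U
  have hβ := h.hβ
  have hα := h.hβ.trans h.hα
  have hγ := h.hγx
  have := h.integral_noiseX k
    (a := fun ω => -(2 * H.γx * (1 - c ^ H.β * avg (iter P W H s₀ ξ k ω).U ^ (-H.β))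
      * avg (iter P W H s₀ ξ k ω).U ^ H.β * (iter P W H s₀ ξ k ω).vref ^ (-H.α)))
    -- The bound may grow with `k`: it serves integrability only.
    (M := 2 * H.γx * 1 * (c' + k * C ^ 2) ^ H.β * c ^ (-H.α))
    (((((measurable_const.sub ((hu.pow_const _).const_mul _)).const_mul _).mul
      (hu.pow_const _)).mul (hs.vref.pow_const _)).neg)
    (hs.xbar.sub (h.measurable_lagRef k)) (by
      filter_upwards [h.ae_run] with ω hr
      obtain ⟨t0, t1⟩ := hr.theta_eta_le_one k
      have hup := hr.avg_U_pos k
      have hvp := hr.vref_pos k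
      rw [abs_neg, abs_of_nonneg (mul_nonneg (mul_nonneg (mul_nonneg (by positivity)
        (sub_nonneg.2 t1)) (by positivity)) (by positivity))]
      have a1 : avg (iter P W H s₀ ξ k ω).U ^ H.β ≤ (c' + k * C ^ 2) ^ H.β :=
        Real.rpow_le_rpow hup.le (hr.accY.avg_le h.hn h.hd h.hW k) hβ.le
      have a2 : (iter P W H s₀ ξ k ω).vref ^ (-H.α) ≤ c ^ (-H.α) :=
        Real.rpow_le_rpow_of_nonpos h.hc (hr.accumX.lower k) (by linarith)
      have a3 : 0 ≤ 1 - c ^ H.β * avg (iter P W H s₀ ξ k ω).U ^ (-H.β) := sub_nonneg.2 t1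
      have a4 : 1 - c ^ H.β * avg (iter P W H s₀ ξ k ω).U ^ (-H.β) ≤ 1 := by linarith
      have a5 : 0 ≤ (c' + k * C ^ 2) ^ H.β := (by positivity : (0 : ℝ) ≤ _).trans a1
      gcongr)
    (N := Run.lagBound n p d H C c Z) (by
      filter_upwards [h.ae_run] with ω hr
      exact hr.norm_lag_le k)
  exact this

lemma integral_noiseMeanY (h : Model Pr P W H s₀ ξ μ L C c c' R Δ Z) (k : ℕ) :
    Integrable (fun ω => (seqs P W H s₀ ξ c ω).noiseMeanY k) Pr ∧
      ∫ ω, (seqs P W H s₀ ξ c ω).noiseMeanY k ∂Pr = 0 := by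
  have hs := h.measurableState k
  have := h.integral_noiseY k
    (a := fun ω => -(2 * avg (iter P W H s₀ ξ k ω).U ^ (-H.β))) (M := 2 * c ^ (-H.β))
    ((hs.avg_U.pow_const _).const_mul _).neg
    (T := fun ω i => P.gradY i ((iter P W H s₀ ξ k ω).x i) ((iter P W H s₀ ξ k ω).y i))
    (fun i => Problem.measurable_gradY h.setting h.grad i (hs.x i) (hs.y i)
      fun ω => h.y_mem k ω i)
    (by
      filter_upwards [h.ae_run] with ω hr
      have hup := hr.avg_U_pos k
      rw [abs_neg, abs_of_nonneg (by positivity)]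
      exact mul_le_mul_of_nonneg_left (Real.rpow_le_rpow_of_nonpos h.hc (hr.accumY.lower k)
        (by linarith [h.hβ])) (by norm_num))
    (N := C) (Filter.Eventually.of_forall fun ω i =>
      Problem.norm_gradY_le h.setting h.grad i _ (h.y_mem k ω i))
  exact this

lemma integral_noiseMeanX (h : Model Pr P W H s₀ ξ μ L C c c' R Δ Z) (k : ℕ) :
    Integrable (fun ω => (seqs P W H s₀ ξ c ω).noiseMeanX k) Pr ∧
      ∫ ω, (seqs P W H s₀ ξ c ω).noiseMeanX k ∂Pr = 0 := by
  have hs := h.measurableState k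
  have := h.integral_noiseX k
    (a := fun ω => -(2 * (iter P W H s₀ ξ k ω).vref⁻¹)) (M := 2 * c⁻¹)
    (hs.vref.inv.const_mul _).neg
    (T := fun ω => P.netX (iter P W H s₀ ξ k ω))
    (measurable_nmean fun i => Problem.measurable_gradX h.setting h.grad i (hs.x i) (hs.y i)
      fun ω => h.y_mem k ω i)
    (by
      filter_upwards [h.ae_run] with ω hr
      have hvp := hr.vref_pos k
      rw [abs_neg, abs_of_nonneg (by positivity)]
      exact mul_le_mul_of_nonneg_left (inv_anti₀ h.hc (hr.accumX.lower k)) (by norm_num))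
    (N := C) (Filter.Eventually.of_forall fun ω =>
      norm_nmean_le h.hn fun i => Problem.norm_gradX_le h.setting h.grad i _ (h.y_mem k ω i))
  exact this

lemma integrable_P2 (h : Model Pr P W H s₀ ξ μ L C c c' R Δ Z) (k : ℕ) :
    Integrable (fun ω => (seqs P W H s₀ ξ c ω).P2 k) Pr := by
  have hm := ((h.measurable_gradient k).mono (past_le h.iid k) le_rfl).norm.pow_const 2
  refine Integrable.of_bound hm.aestronglyMeasurable (C ^ 2) ?_
  filter_upwards [h.ae_run] with ω hr
  refine (Real.norm_of_nonneg (sq_nonneg _)).trans_le ?_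
  exact pow_le_pow_left₀ (norm_nonneg _) (hr.norm_avgX_le _ (hr.yStar_mem _)) 2

lemma lintegral_gradient (h : Model Pr P W H s₀ ξ μ L C c c' R Δ Z) (k : ℕ) :
    ∫⁻ ω, ENNReal.ofReal (‖gradient P.Phi (iter P W H s₀ ξ k ω).xbar‖ ^ 2) ∂Pr
      = ENNReal.ofReal (∫ ω, (seqs P W H s₀ ξ c ω).P2 k ∂Pr) := by
  rw [ofReal_integral_eq_lintegral_ofReal (h.integrable_P2 k)
    (Filter.Eventually.of_forall fun ω => sq_nonneg _)]
  refine lintegral_congr fun ω => ?_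
  rw [Problem.gradient_Phi h.hn h.hμ h.hL h.setting h.conc h.smooth h.grad h.nonempty]
  rfl

/-- The pathwise bound, integrated. -/
lemma sum_integral_le (h : Model Pr P W H s₀ ξ μ L C c c' R Δ Z) {q3 q4 q5 q6 b : ℝ} {K : ℕ}
    (hb : ∀ᵐ ω ∂Pr, ∑ k ∈ Finset.range K, (seqs P W H s₀ ξ c ω).P2 k ≤ b
      + 4 * ∑ k ∈ Finset.range K, (seqs P W H s₀ ξ c ω).noiseDescent k
      + q3 * ∑ k ∈ Finset.range K, (seqs P W H s₀ ξ c ω).noiseTrack k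
      + q4 * ∑ k ∈ Finset.range K, (seqs P W H s₀ ξ c ω).noiseLag k
      + q5 * ((gap W)⁻¹ * ∑ k ∈ Finset.range K, (seqs P W H s₀ ξ c ω).noiseMeanY k)
      + q6 * ∑ k ∈ Finset.range K, (seqs P W H s₀ ξ c ω).noiseMeanX k) :
    ∑ k ∈ Finset.range K, ∫ ω, (seqs P W H s₀ ξ c ω).P2 k ∂Pr ≤ b := by
  have key : ∀ {f : ℕ → Ω → ℝ}, (∀ k, Integrable (f k) Pr ∧ ∫ ω, f k ω ∂Pr = 0) →
      ∀ q : ℝ, Integrable (fun ω => q * ∑ k ∈ Finset.range K, f k ω) Pr ∧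
        ∫ ω, q * ∑ k ∈ Finset.range K, f k ω ∂Pr = 0 := fun {f} hf q => by
    have hi : Integrable (fun ω => ∑ k ∈ Finset.range K, f k ω) Pr :=
      integrable_finsetSum _ fun k _ => (hf k).1
    refine ⟨hi.const_mul _, ?_⟩
    rw [integral_const_mul, integral_finsetSum _ fun k _ => (hf k).1,
      Finset.sum_eq_zero fun k _ => (hf k).2, mul_zero]
  obtain ⟨i1, z1⟩ := key h.integral_noiseDescent 4
  obtain ⟨i3, z3⟩ := key h.integral_noiseTrack q3
  obtain ⟨i4, z4⟩ := key h.integral_noiseLag q4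
  obtain ⟨i5, z5⟩ := key h.integral_noiseMeanY (q5 * (gap W)⁻¹)
  obtain ⟨i6, z6⟩ := key h.integral_noiseMeanX q6
  simp only [← mul_assoc q5] at hb
  rw [← integral_finsetSum _ fun k _ => h.integrable_P2 k]
  refine (integral_mono_ae (integrable_finsetSum _ fun k _ => h.integrable_P2 k)
    ((((((integrable_const b).add i1).add i3).add i4).add i5).add i6) hb).trans_eq ?_
  have j1 := (integrable_const (μ := Pr) b).add i1
  have j3 := j1.add i3
  have j4 := j3.add i4
  have j5 := j4.add i5
  rw [integral_add' j5 i6, integral_add' j4 i5, integral_add' j3 i4, integral_add' j1 i3,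
    integral_add' (integrable_const b) i1, z1, z3, z4, z5, z6]
  simp

end Model

/-! ### Passage to extended nonnegative reals, and conclusion. -/

lemma sum_ofReal_div_le {K : ℕ} (hK : 1 ≤ K) {I : ℕ → ℝ} {a : ℝ} {v u : ℝ≥0∞} (hv : v ≠ ⊤)
    (hu : u ≠ ⊤) (hI : ∀ k, 0 ≤ I k) (ha : 0 ≤ a) {A : ℝ≥0} {n p d : ℕ} {κ2 C2 : ℝ} (hκ : 0 ≤ κ2)
    (hC : 0 ≤ C2)
    (h : ∑ k ∈ Finset.range K, I k
      ≤ K * (a + A * (n * (p * v.toReal + κ2 * d * u.toReal) * C2))) :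
    (∑ k ∈ Finset.range K, ENNReal.ofReal (I k)) / (K : ℝ≥0∞) ≤ ENNReal.ofReal a
      + A * ((n : ℝ≥0∞) * ((p : ℝ≥0∞) * v + ENNReal.ofReal κ2 * (d : ℝ≥0∞) * u)
        * ENNReal.ofReal C2) := by
  have hK0 : (0 : ℝ) < K := by exact_mod_cast hK
  have hv' := ENNReal.toReal_nonneg (a := v)
  have hu' := ENNReal.toReal_nonneg (a := u)
  have e1 : (K : ℝ≥0∞) = ENNReal.ofReal K := (ENNReal.ofReal_natCast K).symm
  rw [← ENNReal.ofReal_sum_of_nonneg fun k _ => hI k, e1, ← ENNReal.ofReal_div_of_pos hK0]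
  have h1 : (∑ k ∈ Finset.range K, I k) / K
      ≤ a + A * (n * (p * v.toReal + κ2 * d * u.toReal) * C2) := by
    rw [div_le_iff₀ hK0]; linarith
  refine (ENNReal.ofReal_le_ofReal h1).trans_eq ?_
  rw [ENNReal.ofReal_add ha (by positivity), ENNReal.ofReal_mul A.coe_nonneg,
    ENNReal.ofReal_mul (by positivity), ENNReal.ofReal_mul (by positivity),
    ENNReal.ofReal_add (by positivity) (by positivity), ENNReal.ofReal_mul (by positivity),
    ENNReal.ofReal_mul (by positivity), ENNReal.ofReal_mul hκ, ENNReal.ofReal_toReal hv,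
    ENNReal.ofReal_toReal hu]
  simp only [ENNReal.ofReal_natCast, ENNReal.ofReal_coe_nnreal]

/-- An infinite `ζ̂` makes the bound trivial; positivity of all factors excludes `0 · ∞`. -/
lemma steady_eq_top {n p d : ℕ} {A : ℝ≥0} {κ2 C2 : ℝ} {v u : ℝ≥0∞} (hn : 0 < n) (hp : 0 < p)
    (hd : 0 < d) (hA : 0 < A) (hκ : 0 < κ2) (hC : 0 < C2) (h : v = ⊤ ∨ u = ⊤) :
    A * ((n : ℝ≥0∞) * ((p : ℝ≥0∞) * v + ENNReal.ofReal κ2 * (d : ℝ≥0∞) * u)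
        * ENNReal.ofReal C2) = ⊤ := by
  have h1 : (p : ℝ≥0∞) * v + ENNReal.ofReal κ2 * (d : ℝ≥0∞) * u = ⊤ := by
    rcases h with h | h
    · rw [h, ENNReal.mul_top (by exact_mod_cast hp.ne'), top_add]
    · rw [h, ENNReal.mul_top (mul_ne_zero (by simpa using hκ) (by exact_mod_cast hd.ne')), add_top]
  rw [h1, ENNReal.mul_top (by exact_mod_cast hn.ne'), ENNReal.top_mul (by simpa using hC),
    ENNReal.mul_top (by exact_mod_cast hA.ne')]

end DAdaST

theorem theorem3 :
    -- the absolute constant of the steady-state term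
    ∃ A : ℝ≥0,
    ∀ (n p d : ℕ), 0 < n → 0 < p → 0 < d →
    ∀ (H : Hyper), 0 < H.γx → 0 < H.γy → 0 < H.β → H.β < H.α → H.α < 1 →
    ∀ (μ L C Δ R c c' c₀ : ℝ) (Z : ℝ≥0), 0 < μ → 0 < L → 0 < C → 0 < c → 0 < c₀ →
    -- the constant and the power of the logarithm of the transient terms
    ∃ (B : ℝ≥0) (N : ℕ),
    ∀ (Ω Ξ : Type*) [MeasurableSpace Ω] [MeasurableSpace Ξ]
      (Pr : Measure Ω) [IsProbabilityMeasure Pr]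
      (P : Problem n p d Ξ) (W : Matrix (Fin n) (Fin n) ℝ) (s₀ : State n p d)
      (ξ : Block → Fin n → ℕ → Ω → Ξ),
    P.Setting → P.StronglyConcave μ → P.Smooth L → P.StochGrad C →
    (∀ x x', P.Phi x - P.Phi x' ≤ Δ) →
    W ∈ doublyStochastic ℝ (Fin n) → rho W < 1 →
    IIDSamples P Pr ξ →
    (∀ i, s₀.y i ∈ P.Y) → (∑ i, ‖s₀.x i - s₀.xbar‖ ^ 2 ≤ R) →
    (∀ i j, c ≤ s₀.mx i j ∧ s₀.mx i j ≤ c') → (∀ i j, c ≤ s₀.my i j ∧ s₀.my i j ≤ c') →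
    Differentiable ℝ P.Phi ∧
    (supBound Pr (fun k ω => incons H.α (iter P W H s₀ ξ k ω).V) ≤ Z →
    supBound Pr (fun k ω => incons H.β (iter P W H s₀ ξ k ω).U) ≤ Z →
    ∀ K : ℕ, 1 ≤ K →
      c₀ * max ((H.γx ^ 2 * (L / μ) ^ 4 / H.γy ^ 2) ^ (1 / (H.α - H.β)))
          ((1 / (1 - rho W) ^ 2) ^ max (1 / H.α) (1 / H.β)) ≤ (K : ℝ) →
      (∑ k ∈ Finset.range K,
          ∫⁻ ω, ENNReal.ofReal (‖gradient P.Phi (iter P W H s₀ ξ k ω).xbar‖ ^ 2) ∂Pr) / (K : ℝ≥0∞)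
        ≤ ENNReal.ofReal (B * (1 + Real.log K) ^ N *
            (1 / (K : ℝ) ^ (1 - H.α) + 1 / ((1 - rho W) ^ H.α * (K : ℝ) ^ H.α)
              + 1 / (K : ℝ) ^ (1 - H.β) + 1 / ((1 - rho W) * (K : ℝ) ^ H.β)))
          + A * ((n : ℝ≥0∞) *
              ((p : ℝ≥0∞) * supBound Pr (fun k ω => inconsHat H.α (iter P W H s₀ ξ k ω).V)
                + ENNReal.ofReal ((L / μ) ^ 2) * (d : ℝ≥0∞) *
                  supBound Pr (fun k ω => inconsHat H.β (iter P W H s₀ ξ k ω).U))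
              * ENNReal.ofReal (C ^ 2))) := by
  -- `128 · 2` from the dual mismatch; the primal one needs only `6 · 2`.
  refine ⟨256, ?_⟩
  intro n p d hn hp hd H hγx hγy hβ hα hα1 μ L C Δ R c c' c₀ Z hμ hL hC hc hc₀
  -- The constants are fixed before any initial state is given, so `max c c'` stands in for `c'` to
  -- ensure that it is at least `c`. The value of `kE` is the one delivered by `inv_gap_sq_le`.
  obtain ⟨B, q3, q4, q5, q6, hB, hmain⟩ := exists_sum_bound _ (consts_ok (p := p) (d := d) Δ R Z hn
    hγx hγy hβ hα hα1 hμ hL hC hc (le_max_left c c') (by positivity : 0 ≤ 4 * c₀ ^ (-H.β)))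
  -- The `2` is the cost of `rate_div_le`; a single power of the logarithm suffices.
  refine ⟨(2 * B).toNNReal, 1, ?_⟩
  intro Ω Ξ _ _ Pr _ P W s₀ ξ hS hconc hsm hG hΔ hW hρ hiid hy0 hx0 hmx hmy
  have hne : P.Y.Nonempty := ⟨_, hy0 ⟨0, hn⟩⟩
  refine ⟨Problem.differentiable_Phi hn hμ hL hS hconc hsm hG hne, ?_⟩
  intro hV hU K hK hKc
  have h : Model Pr P W H s₀ ξ μ L C c (max c c') R Δ Z :=
    ⟨hn, hp, hd, hγx, hγy, hβ, hα, hα1, hμ, hL, hC, hc, hS, hconc, hsm, hG, hΔ, hW, hρ, hiid, hy0,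
      hx0, fun i j => ⟨(hmx i j).1, (hmx i j).2.trans (le_max_right _ _)⟩,
      fun i j => ⟨(hmy i j).1, (hmy i j).2.trans (le_max_right _ _)⟩, hV, hU⟩
  have hgap := gap_pos hρ
  have hr : 0 < 1 - rho W := by linarith
  have hK1 : (1 : ℝ) ≤ K := by exact_mod_cast hK
  have hK0 : (0 : ℝ) < K := by linarith
  have hlog : 0 ≤ Real.log K := Real.log_nonneg hK1
  have hn0 : (0 : ℝ) < n := by exact_mod_cast hn
  have hn1 : (1 : ℝ) ≤ n := by exact_mod_cast hn
  rw [Real.coe_toNNReal _ (by positivity), pow_one]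
  set v := supBound Pr fun k ω => inconsHat H.α (iter P W H s₀ ξ k ω).V
  set u := supBound Pr fun k ω => inconsHat H.β (iter P W H s₀ ξ k ω).U
  by_cases htop : v = ⊤ ∨ u = ⊤
  · rw [steady_eq_top hn hp hd (by norm_num) (by positivity) (by positivity) htop, add_top]
    exact le_top
  push Not at htop
  obtain ⟨hv, hu⟩ := htop
  simp only [h.lintegral_gradient]
  refine sum_ofReal_div_le hK hv hu (fun k => integral_nonneg fun ω => sq_nonneg _) (by positivity)
    (by positivity) (by positivity) ?_
  have hgK : (gap W)⁻¹ ^ 2 ≤ 4 * c₀ ^ (-H.β) * (K : ℝ) ^ H.β :=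
    inv_gap_sq_le hρ hβ hc₀ ((mul_le_mul_of_nonneg_left (le_max_right _ _) hc₀.le).trans hKc)
  have hb := h.sum_integral_le (K := K) (q3 := q3) (q4 := q4) (q5 := q5) (q6 := q6)
    (b := B * rate H.α H.β (gap W) K + K * (6 * (2 * p * v.toReal * C ^ 2)
      + 128 * (L ^ 2 / (n * μ ^ 2)) * (2 * n * d * u.toReal * C ^ 2))) (by
    filter_upwards [h.ae_run, ae_le_of_supBound_le hv le_rfl, ae_le_of_supBound_le hu le_rfl]
      with ω hω h1 h2
    exact hmain _ _ _ _ K hgap (gap_le_one W) hK hgK (hω.seqs_ok _ h1 h2))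
  refine hb.trans ?_
  have h3 := mul_le_mul_of_nonneg_left (rate_div_le hρ hβ hα hα1 hK) hB
  set T := 1 / (K : ℝ) ^ (1 - H.α) + 1 / ((1 - rho W) ^ H.α * (K : ℝ) ^ H.α)
    + 1 / (K : ℝ) ^ (1 - H.β) + 1 / ((1 - rho W) * (K : ℝ) ^ H.β)
  have h4 : B * rate H.α H.β (gap W) K ≤ K * (2 * B * (1 + Real.log K) * T) := by
    have := mul_le_mul_of_nonneg_left h3 hK0.le
    have e : K * (B * (rate H.α H.β (gap W) K / K)) = B * rate H.α H.β (gap W) K := by field_simp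
    linarith
  have hv' := ENNReal.toReal_nonneg (a := v)
  have hu' := ENNReal.toReal_nonneg (a := u)
  have h5 : 6 * (2 * p * v.toReal * C ^ 2)
      + 128 * (L ^ 2 / (n * μ ^ 2)) * (2 * n * d * u.toReal * C ^ 2)
      ≤ 256 * (n * (p * v.toReal + (L / μ) ^ 2 * d * u.toReal) * C ^ 2) := by
    have e : 128 * (L ^ 2 / (n * μ ^ 2)) * (2 * n * d * u.toReal * C ^ 2)
        = 256 * ((L / μ) ^ 2 * d * u.toReal * C ^ 2) := by field_simp; ring
    have a1 : 0 ≤ p * v.toReal * C ^ 2 := by positivity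
    have a2 : 0 ≤ (L / μ) ^ 2 * d * u.toReal * C ^ 2 := by positivity
    have a3 := mul_le_mul_of_nonneg_right hn1 (add_nonneg a1 a2)
    rw [e]
    linarith
  have h6 := mul_le_mul_of_nonneg_left h5 hK0.le
  push_cast
  linarith
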